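/- Let $j\ge 1$ be an integer, $m=2j+1$, and let $s\in\mathbb R$ with $s\ne \ell+\tfrac12+km$ for all $0\le \ell\le j-1$ and all integers $k\ge 0$ (for $s\le j+1$ this says $s\notin\{\tfrac12,\tfrac32,\dots,j-\tfrac12\}$). Put $\mu_\ell=\frac{s+j-\ell}{m}$. For $T>0$ consider the problem $$\partial_t u+(-1)^{j+1}\partial_x^{m}u=0\quad (x>0,\ 0<t<T),\qquad u(x,0)=0,\qquad \partial_x^\ell u(0,t)=G_\ell(t)\quad (0\le\ell\le j-1),$$ with data $G_\ell\in H^{\mu_\ell}(0,T)$ (restrictions to $(0,T)$ of elements of $H^{\mu_\ell}(\mathbb R)$) that are compatible with the zero initial data: $G_\ell^{(k)}(0)=0$ for every integer $k\ge 0$ with $k<\mu_\ell-\tfrac12$ (for $s\le j+1$: $G_\ell(0)=0$ whenever $\mu_\ell>\tfrac12$, i.e. $s>\ell+\tfrac12$). Its solution is given, for $x>0$, by $$S[0,G_0,\dots,G_{j-1};0](x,t)=\sum_{p=1}^{j}\sum_{\ell=0}^{j-1}C'_{p,\ell}\int_{\partial D_{2p}^+}e^{i\xi x+i\xi^m t}(i\xi)^{2j-\ell}\,\tilde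 G_\ell(\xi^m,T)\,d\xi,\qquad \tilde G_\ell(z,T)=\int_0^T e^{-iz\tau}G_\ell(\tau)\,d\tau ,$$ where $D_{2p}^+=\{\xi\neq 0:(2p-1)\frac{\pi}{m}<\arg\xi<2p\frac{\pi}{m}\}$, $\partial D_{2p}^+$ is oriented with $D_{2p}^+$ on its left, and for each $\ell$ the constants $C'_{p,\ell}$ are determined by $\sum_{p=1}^{j}C'_{p,\ell}\,e^{2\pi i p(k-\ell)/m}=(-1)^{j+1}\frac{m}{2\pi}\delta_{k\ell}$, $0\le k\le j-1$. (If $\mu_\ell<0$, the integral defining $\tilde G_\ell$ is the duality pairing of $G_\ell$ with $\chi_{(0,T)}e^{-iz\,\cdot}$, which makes sense for $\mu_\ell>-\frac12$.) With $\widehat v(\xi,\tau)=\int_{\mathbb R^2} e^{-i(\xi x+\tau t)}v(x,t)\,dx\,dt$ let $$\|v\|_{X^{s,b,\alpha}}^2=\int_{\mathbb R^2}(1+|\xi|)^{2s}(1+|\tau-\xi^m|)^{2b}|\widehat v(\xi,\tau)|^2\,d\xi\,d\tau+\int_{\mathbb R}\int_{-1}^{1}(1+|\tau|)^{2\alpha}|\widehat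 v(\xi,\tau)|^2\,d\xi\,d\tau ,$$ and let the norms of $H^s(0,\infty)$, $H^{\mu}(0,T)$ and $X^{s,b,\alpha}(\mathbb R^+\times(0,T))$ be the restriction norms, i.e. the infima of the norms of the extensions to $\mathbb R$, $\mathbb R$ and $\mathbb R^2$. (i) If $s\ge 0$, there is a constant $c$ depending only on $s$ and $m$ such that for all $T>0$ and all such data $$\sup_{t\le T}\|S[0,G_0,\dots,G_{j-1};0](\cdot,t)\|_{H^s(0,\infty)}\le c\sum_{\ell=0}^{j-1}\|G_\ell\|_{H^{\mu_\ell}(0,T)} ,$$ and if moreover $s<\frac12$, the same holds with the supremum over all $t\in\mathbb R$. (ii) If $s>-j-\frac12$, $0\le b<\frac12$, $\frac12<\alpha\le\frac12+\frac1m\left(s+j+\frac12\right)$ and $T_0>0$, there is a constant $c$ depending only on $s,b,\alpha,m,T_0$ such that for all $0<T\le T_0$ and all such data $$\|S[0,G_0,\dots,G_{j-1};0]\|_{X^{s,b,\alpha}(\mathbb R^+\times(0,T))}\le c\sum_{\ell=0}^{j-1}\|G_\ell\|_{H^{\mu_\ell}(0,T)} .$$ -/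

import Mathlib

open MeasureTheory Set
open scoped NNReal ENNReal SchwartzMap FourierTransform

noncomputable section

namespace KdVm

/-! ### Fourier transforms, weighted norms and restriction norms -/

section Spaces

variable {V : Type*} [NormedAddCommGroup V] [InnerProductSpace ℝ V] [FiniteDimensional ℝ V]
  [MeasurableSpace V] [BorelSpace V]

/-- The Fourier transform `f̂` of the tempered distribution `f`, in the normalization
`f̂(ζ) = ∫ e^{-i⟨ζ, z⟩} f(z) dz`, is the function `F`. (Mathlib's `𝓕` has the phase
`e^{-2πi⟨η, z⟩}`, so that `𝓕 f (η) = f̂(2πη)`.) -/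
def HasFourierFunction (f : 𝓢'(V, ℂ)) (F : V → ℂ) : Prop :=
  ∀ φ : 𝓢(V, ℂ), Integrable (fun η => F ((2 * Real.pi) • η) * φ η) ∧
    𝓕 f φ = ∫ η, F ((2 * Real.pi) • η) * φ η

open Classical in
/-- The function `f̂` (unique up to null sets), for a tempered distribution `f` whose Fourier
transform is a function. -/
def fourierFunction (f : 𝓢'(V, ℂ)) : V → ℂ :=
  if h : ∃ F, HasFourierFunction f F then h.choose else 0

open Classical in
/-- The norm `(∫ w(ζ) |f̂(ζ)|² dζ)^{1/2}`; it is `∞` if `f̂` is not a function. -/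
def weightedNorm (w : V → ℝ) (f : 𝓢'(V, ℂ)) : ℝ≥0∞ :=
  if ∃ F, HasFourierFunction f F then
    (∫⁻ ζ, ENNReal.ofReal (w ζ) * ‖fourierFunction f ζ‖ₑ ^ 2) ^ (1 / 2 : ℝ)
  else ⊤

/-- Two functionals agree as distributions on `Ω`: they have the same values on the test
functions with compact support in `Ω`. -/
def AgreeOn (Ω : Set V) (u v : 𝓢(V, ℂ) → ℂ) : Prop :=
  ∀ φ : 𝓢(V, ℂ), HasCompactSupport φ → tsupport φ ⊆ Ω → u φ = v φ

/-- The distribution on `Ω` that is given by a function `u`. -/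
def functional (Ω : Set V) (u : V → ℂ) : 𝓢(V, ℂ) → ℂ :=
  fun φ => ∫ z in Ω, u z * φ z

/-- The restriction norm on `Ω`: the infimum of the norms of all tempered distributions on the
whole space that agree with `u` on `Ω` (`∞` if there is none of finite norm). -/
def restrictionNorm (Ω : Set V) (w : V → ℝ) (u : 𝓢(V, ℂ) → ℂ) : ℝ≥0∞ :=
  ⨅ (v : 𝓢'(V, ℂ)) (_ : AgreeOn Ω v u), weightedNorm w v

end Spaces

/-- The weight of `H^μ(ℝ)`. -/
def sobolevWeight (μ : ℝ) (ξ : ℝ) : ℝ := (1 + ξ ^ 2) ^ μ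

/-- The norm of `H^μ(ℝ)`. -/
def sobolevNorm (μ : ℝ) (f : 𝓢'(ℝ, ℂ)) : ℝ≥0∞ := weightedNorm (sobolevWeight μ) f

/-- The norm of `H^s(0,∞)` of a function on the half-line. -/
def halfLineSobolevNorm (s : ℝ) (u : ℝ → ℂ) : ℝ≥0∞ :=
  restrictionNorm (Ioi 0) (sobolevWeight s) (functional (Ioi 0) u)

/-- The norm of `H^μ(0,T)` of the restriction to `(0,T)` of a distribution `g`. -/
def intervalSobolevNorm (T μ : ℝ) (g : 𝓢'(ℝ, ℂ)) : ℝ≥0∞ :=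
  restrictionNorm (Ioo 0 T) (sobolevWeight μ) g

/-- The weight of the modified Bourgain space `X^{s,b,α}(ℝ²)` with dispersion `τ = ξ^m`,
at the frequency `(ξ, τ)`. -/
def bourgainWeight (m : ℕ) (s b α ξ τ : ℝ) : ℝ :=
  (1 + |ξ|) ^ (2 * s) * (1 + |τ - ξ ^ m|) ^ (2 * b) +
    (if |ξ| ≤ 1 then (1 + |τ|) ^ (2 * α) else 0)

/-- The space-time domain `ℝ⁺ × (0,T)`; the coordinates are `(x, t)`. -/
def halfStrip (T : ℝ) : Set (EuclideanSpace ℝ (Fin 2)) :=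
  {z | 0 < z 0 ∧ 0 < z 1 ∧ z 1 < T}

/-- The norm of `X^{s,b,α}(ℝ⁺ × (0,T))` of a function `u(x,t)`. -/
def bourgainNorm (m : ℕ) (s b α T : ℝ) (u : ℝ → ℝ → ℂ) : ℝ≥0∞ :=
  restrictionNorm (halfStrip T) (fun ζ => bourgainWeight m s b α (ζ 0) (ζ 1))
    (functional (halfStrip T) fun z => u (z 0) (z 1))

/-! ### The Fokas solution formula for zero initial data and zero forcing -/

/-- The temporal transform `g̃(z,T) = ∫_0^T e^{-izτ} g(τ) dτ`, i.e. the pairing of `g` with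
`χ_{(0,T)} e^{-iz·}`, written on the Fourier side (Parseval) so that it makes sense, by an
absolutely convergent integral, for all `g ∈ H^μ(ℝ)` with `μ > -1/2`. It only depends on the
restriction of `g` to `(0,T)`. -/
def timeTransform (g : 𝓢'(ℝ, ℂ)) (T : ℝ) (z : ℂ) : ℂ :=
  (1 / (2 * Real.pi) : ℂ) * ∫ η : ℝ, fourierFunction g η *
    ∫ τ in (0 : ℝ)..T, Complex.exp (-Complex.I * (z - η) * τ)

/-- Right boundary direction `e^{i(2p-1)π/m}` of the sector `D_{2p}^+`. -/
def rightDir (j p : ℕ) : ℂ :=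
  Complex.exp (Complex.I * ((2 * p - 1) * Real.pi / (2 * j + 1)))

/-- Left boundary direction `e^{i2pπ/m}` of the sector `D_{2p}^+`. -/
def leftDir (j p : ℕ) : ℂ :=
  Complex.exp (Complex.I * (2 * p * Real.pi / (2 * j + 1)))

/-- The contour integral `∫_{∂D_{2p}^+} f(ξ) dξ` over the boundary of
`D_{2p}^+ = {ξ ≠ 0 : (2p-1)π/m < arg ξ < 2pπ/m}`, oriented with the sector on the left:
inwards along the left ray and outwards along the right ray. -/
def sectorIntegral (j p : ℕ) (f : ℂ → ℂ) : ℂ :=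
  (∫ r in Ioi (0 : ℝ), f (r * rightDir j p) * rightDir j p) -
    ∫ r in Ioi (0 : ℝ), f (r * leftDir j p) * leftDir j p

/-- The constants `C'_{p,ℓ}` (the index `p : Fin j` stands for `p + 1 ∈ {1,…,j}`) that solving
for the unknown boundary data produces: with the nodes `ω_p = e^{2πip/m}`, `p = 1,…,j`,
`C'_{p,ℓ} = (-1)^{j+1} (m / 2π) ω_p^ℓ (V⁻¹)_{ℓ,p}` for the (invertible) Vandermonde matrix
`V_{p,k} = ω_p^k`. Equivalently, they are the unique solution of the system
`∑_p C'_{p,ℓ} ω_p^{k-ℓ} = (-1)^{j+1} (m / 2π) δ_{kℓ}`, `0 ≤ k, ℓ < j`, which says that the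
`k`-th normal derivative of the solution formula at `x = 0` is the `k`-th boundary datum.
For `j = 1` this is `3 / 2π`. -/
def fokasConst (j : ℕ) (p ℓ : Fin j) : ℂ :=
  (-1) ^ (j + 1) * ((2 * j + 1) / (2 * Real.pi)) * leftDir j (p + 1) ^ (ℓ : ℕ) *
    (Matrix.vandermonde fun q : Fin j => leftDir j (q + 1))⁻¹ ℓ p

/-- The solution `S[0, G_0, …, G_{j-1}; 0](x,t)` of
`∂_t u + (-1)^{j+1} ∂_x^m u = 0`, `u(x,0) = 0`, `∂_x^ℓ u(0,t) = G_ℓ(t)` (`0 ≤ ℓ < j`),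
`m = 2j+1`, given by the Fokas formula
`∑_p ∑_ℓ C'_{p,ℓ} ∫_{∂D_{2p}^+} e^{iξx + iξ^m t} (iξ)^{2j-ℓ} G̃_ℓ(ξ^m, T) dξ`,
where `G_ℓ` is the restriction of `g ℓ` to `(0,T)`. -/
def pureSolution (j : ℕ) (T : ℝ) (g : Fin j → 𝓢'(ℝ, ℂ)) (x t : ℝ) : ℂ :=
  ∑ p : Fin j, ∑ ℓ : Fin j, fokasConst j p ℓ *
    sectorIntegral j (p + 1) fun ξ =>
      Complex.exp (Complex.I * ξ * x + Complex.I * ξ ^ (2 * j + 1) * t) *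
        (Complex.I * ξ) ^ (2 * j - (ℓ : ℕ)) * timeTransform (g ℓ) T (ξ ^ (2 * j + 1))

/-! ### The boundary data -/

/-- The Sobolev order `μ_ℓ = (s + j - ℓ) / m` of the `ℓ`-th boundary datum. -/
def dataOrder (j : ℕ) (s : ℝ) (ℓ : Fin j) : ℝ := (s + j - (ℓ : ℕ)) / (2 * j + 1)

/-- The `k`-th derivative of `g|_{(0,T)}` has trace zero at `t = 0`: on `(0,T)`, `g` is a
`C^k` function on the line whose `k`-th derivative vanishes at `0`. -/
def TraceZero (T : ℝ) (k : ℕ) (g : 𝓢'(ℝ, ℂ)) : Prop :=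
  ∃ f : ℝ → ℂ, ContDiff ℝ k f ∧ AgreeOn (Ioo 0 T) g (functional (Ioo 0 T) f) ∧
    iteratedDeriv k f 0 = 0

/-- `G_ℓ ∈ H^{μ_ℓ}(0,T)` (restrictions to `(0,T)` of `g ℓ ∈ H^{μ_ℓ}(ℝ)`), compatible with zero
initial data: every derivative of `G_ℓ` that has a trace at `t = 0`, that is of order
`k < μ_ℓ - 1/2`, vanishes there. -/
structure IsBoundaryData (j : ℕ) (s T : ℝ) (g : Fin j → 𝓢'(ℝ, ℂ)) : Prop where
  mem : ∀ ℓ, sobolevNorm (dataOrder j s ℓ) (g ℓ) < ⊤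
  compatible : ∀ ℓ, ∀ k : ℕ, (k : ℝ) + 1 / 2 < dataOrder j s ℓ → TraceZero T k (g ℓ)

end KdVm

end

noncomputable section

namespace KdVm


/-! ### Tempered distributions whose Fourier transform is a function -/

section FourierFunction

variable {V : Type*} [NormedAddCommGroup V] [InnerProductSpace ℝ V] [FiniteDimensional ℝ V]
  [MeasurableSpace V] [BorelSpace V]

open scoped ContDiff in
theorem exists_schwartzMap_eq_ofReal {E : Type*} [NormedAddCommGroup E] [NormedSpace ℝ E]
    {g : E → ℝ} (hg : ContDiff ℝ ∞ g) (hgs : HasCompactSupport g) :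
    ∃ φ : 𝓢(E, ℂ), ∀ x, φ x = g x := by
  have hcd : ContDiff ℝ ∞ (fun y => (g y : ℂ)) := Complex.ofRealCLM.contDiff.comp hg
  have hcs : HasCompactSupport (fun y => (g y : ℂ)) := 
    hgs.comp_left (g := Complex.ofReal) Complex.ofReal_zero
  exact ⟨hcs.toSchwartzMap hcd, fun x => rfl⟩

theorem two_pi_ne_zero' : (2 * Real.pi : ℝ) ≠ 0 := by positivity

theorem HasFourierFunction.locallyIntegrable {f : 𝓢'(V, ℂ)} {F : V → ℂ}
    (h : HasFourierFunction f F) : LocallyIntegrable (fun η => F ((2 * Real.pi) • η)) := by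
  intro x
  let χ : ContDiffBump x := ⟨1, 2, by norm_num, by norm_num⟩
  obtain ⟨φ, hφ⟩ := exists_schwartzMap_eq_ofReal χ.contDiff χ.hasCompactSupport
  have hi := (h φ).1
  refine ⟨Metric.closedBall x 1, Metric.closedBall_mem_nhds x one_pos, ?_⟩
  refine (hi.integrableOn (s := Metric.closedBall x 1)).congr_fun (fun y hy => ?_)
    Metric.isClosed_closedBall.measurableSet
  have : χ y = 1 := χ.one_of_mem_closedBall hy
  simp [hφ, this]

theorem HasFourierFunction.aestronglyMeasurable {f : 𝓢'(V, ℂ)} {F : V → ℂ}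
    (h : HasFourierFunction f F) : AEStronglyMeasurable F := by
  have h1 := h.locallyIntegrable.aestronglyMeasurable.comp_quasiMeasurePreserving
    (Measure.quasiMeasurePreserving_smul (volume : Measure V) (inv_ne_zero two_pi_ne_zero'))
  refine h1.congr (ae_of_all _ fun x => ?_)
  simp only [Function.comp, smul_smul, mul_inv_cancel₀ two_pi_ne_zero', one_smul]

theorem HasFourierFunction.ae_unique {f : 𝓢'(V, ℂ)} {F G : V → ℂ}
    (hF : HasFourierFunction f F) (hG : HasFourierFunction f G) : F =ᵐ[volume] G := by
  have h1 : ∀ᵐ η : V, F ((2 * Real.pi) • η) = G ((2 * Real.pi) • η) := by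
    refine ae_eq_of_integral_contDiff_smul_eq hF.locallyIntegrable hG.locallyIntegrable
      fun g hg hgs => ?_
    obtain ⟨φ, hφ⟩ := exists_schwartzMap_eq_ofReal hg hgs
    have h2 := (hF φ).2.symm.trans (hG φ).2
    simpa [hφ, mul_comm] using h2
  have h3 := (Measure.quasiMeasurePreserving_smul (volume : Measure V)
    (inv_ne_zero two_pi_ne_zero')).ae h1
  filter_upwards [h3] with x hx
  simpa only [smul_smul, mul_inv_cancel₀ two_pi_ne_zero', one_smul] using hx

theorem HasFourierFunction.fourierFunction {f : 𝓢'(V, ℂ)} {F : V → ℂ}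
    (hF : HasFourierFunction f F) : HasFourierFunction f (fourierFunction f) := by
  have h : ∃ F, HasFourierFunction f F := ⟨F, hF⟩
  rw [KdVm.fourierFunction, dif_pos h]
  exact h.choose_spec

theorem HasFourierFunction.apply_eq {f : 𝓢'(V, ℂ)} {F : V → ℂ}
    (hF : HasFourierFunction f F) (φ : 𝓢(V, ℂ)) :
    Integrable (fun η => F ((2 * Real.pi) • η) * (𝓕⁻ φ) η) ∧
      f φ = ∫ η, F ((2 * Real.pi) • η) * (𝓕⁻ φ) η := by
  have h := hF (𝓕⁻ φ)
  rw [TemperedDistribution.fourier_apply, FourierTransform.fourier_fourierInv_eq] at h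
  exact h

/-- The weighted norm as an `L²` norm of any representative of the Fourier transform. -/
theorem HasFourierFunction.weightedNorm_eq {f : 𝓢'(V, ℂ)} {F : V → ℂ}
    (hF : HasFourierFunction f F) {w : V → ℝ} (hw : ∀ ζ, 0 ≤ w ζ) :
    weightedNorm w f = eLpNorm (fun ζ => (√(w ζ) : ℂ) * F ζ) 2 := by
  have h : ∃ F, HasFourierFunction f F := ⟨F, hF⟩
  rw [weightedNorm, if_pos h, eLpNorm_eq_lintegral_rpow_enorm_toReal two_ne_zero ENNReal.ofNat_ne_top]
  simp only [ENNReal.toReal_ofNat]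
  congr 1
  refine lintegral_congr_ae ?_
  filter_upwards [hF.fourierFunction.ae_unique hF] with ζ hζ
  rw [hζ, enorm_mul, ENNReal.mul_rpow_of_nonneg _ _ (by norm_num)]
  congr 1
  · rw [← ofReal_norm, Complex.norm_real, Real.norm_of_nonneg (Real.sqrt_nonneg _),
      ENNReal.ofReal_rpow_of_nonneg (Real.sqrt_nonneg _) (by norm_num), Real.rpow_two,
      Real.sq_sqrt (hw ζ)]
  · norm_cast

theorem hasFourierFunction_of_weightedNorm_lt_top {w : V → ℝ} {f : 𝓢'(V, ℂ)}
    (h : weightedNorm w f < ⊤) : HasFourierFunction f (fourierFunction f) := by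
  by_cases h1 : ∃ F, HasFourierFunction f F
  · exact h1.choose_spec.fourierFunction
  · simp [weightedNorm, h1] at h

/-- A function that is square integrable against a power weight is the Fourier transform of a
tempered distribution. -/
theorem exists_hasFourierFunction {F : V → ℂ} {r : ℝ}
    (hF : MemLp (fun ζ : V => (((1 + ‖ζ‖ ^ 2) ^ (-r) : ℝ) : ℂ) * F ζ) 2) :
    ∃ v : 𝓢'(V, ℂ), HasFourierFunction v F := by
  set G : V → ℂ := fun η => (((1 + ‖(2 * Real.pi) • η‖ ^ 2) ^ (-r) : ℝ) : ℂ) *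
    F ((2 * Real.pi) • η) with hG
  have hGm : MemLp G 2 := by
    have h1 : MemLp (fun ζ : V => (((1 + ‖ζ‖ ^ 2) ^ (-r) : ℝ) : ℂ) * F ζ) 2
        (Measure.map ((2 * Real.pi) • · : V → V) volume) := by
      rw [Measure.map_addHaar_smul _ two_pi_ne_zero']
      exact hF.smul_measure ENNReal.ofReal_ne_top
    exact h1.comp_of_map (measurable_const_smul _).aemeasurable
  set w : V → ℂ := fun η => (((1 + ‖(2 * Real.pi) • η‖ ^ 2) ^ r : ℝ) : ℂ) with hw
  have hwt : w.HasTemperateGrowth := by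
    have h1 : Function.HasTemperateGrowth (fun η : V => (2 * Real.pi) • η) :=
      ((2 * Real.pi) • ContinuousLinearMap.id ℝ V).hasTemperateGrowth
    exact Function.Complex.hasTemperateGrowth_ofReal.comp
      ((Function.hasTemperateGrowth_one_add_norm_sq_rpow V r).comp h1)
  have hpt : ∀ η, w η * G η = F ((2 * Real.pi) • η) := by
    intro η
    simp only [hw, hG]
    rw [← mul_assoc, ← Complex.ofReal_mul, ← Real.rpow_add (by positivity), add_neg_cancel,
      Real.rpow_zero, Complex.ofReal_one, one_mul]
  set v : 𝓢'(V, ℂ) := 𝓕⁻ (TemperedDistribution.smulLeftCLM ℂ w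
    (Lp.toTemperedDistribution (hGm.toLp G))) with hv
  refine ⟨v, fun φ => ?_⟩
  have hae : ∀ᵐ η : V, (SchwartzMap.smulLeftCLM ℂ w φ) η • (hGm.toLp G : V → ℂ) η =
      F ((2 * Real.pi) • η) * φ η := by
    filter_upwards [hGm.coeFn_toLp] with η hη
    rw [hη, SchwartzMap.smulLeftCLM_apply_apply hwt, ← hpt η]
    simp only [smul_eq_mul]; ring
  constructor
  · refine Integrable.congr ?_ hae
    have h2 := (SchwartzMap.smulLeftCLM ℂ w φ).memLp 2 (volume : Measure V)
    exact h2.integrable_mul (Lp.memLp (hGm.toLp G))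
  · rw [hv, FourierTransform.fourier_fourierInv_eq, TemperedDistribution.smulLeftCLM_apply_apply,
      Lp.toTemperedDistribution_apply]
    exact integral_congr_ae hae

/-- Plancherel's theorem for integrable square integrable functions. -/
theorem eLpNorm_fourier_eq {f : V → ℂ} (h1 : Integrable f) (h2 : MemLp f 2) :
    eLpNorm (𝓕 f) 2 = eLpNorm f 2 := by
  set L := h2.toLp f
  have key : ((𝓕 L : Lp (α := V) ℂ 2 volume) : V → ℂ) =ᵐ[volume] 𝓕 f := by
    refine ae_eq_of_integral_contDiff_smul_eq ((Lp.memLp (𝓕 L)).locallyIntegrable one_le_two) ?_ fun g hg hgs => ?_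
    · exact (VectorFourier.fourierIntegral_continuous Real.continuous_fourierChar
        (by exact continuous_inner) h1).locallyIntegrable
    obtain ⟨φ, hφ⟩ := exists_schwartzMap_eq_ofReal hg hgs
    have h3 := DFunLike.congr_fun (Lp.fourier_toTemperedDistribution_eq L) φ
    rw [TemperedDistribution.fourier_apply, Lp.toTemperedDistribution_apply,
      Lp.toTemperedDistribution_apply] at h3
    have h4 : ∫ x, (𝓕 φ) x • (L : V → ℂ) x = ∫ x, (𝓕 φ) x • f x := by
      refine integral_congr_ae ?_
      filter_upwards [h2.coeFn_toLp] with x hx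
      rw [hx]
    have h5 : ∫ x, (𝓕 (φ : V → ℂ)) x • f x = ∫ x, φ x • (𝓕 f) x := by
      have := VectorFourier.integral_fourierIntegral_smul_eq_flip (μ := (volume : Measure V))
        (ν := (volume : Measure V)) (L := innerₗ V)
        Real.continuous_fourierChar (by exact continuous_inner) φ.integrable h1
      rw [flip_innerₗ] at this
      exact this
    calc ∫ x, g x • ((𝓕 L : Lp (α := V) ℂ 2 volume) : V → ℂ) x = ∫ x, φ x • ((𝓕 L : Lp (α := V) ℂ 2 volume) : V → ℂ) x := by simp [hφ]
      _ = ∫ x, (𝓕 φ) x • f x := by rw [← h3, h4]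
      _ = ∫ x, φ x • (𝓕 f) x := h5
      _ = _ := by simp [hφ]
  rw [← eLpNorm_congr_ae key, ← eLpNorm_congr_ae h2.coeFn_toLp]
  have := Lp.norm_fourier_eq L
  rw [Lp.norm_def, Lp.norm_def] at this
  exact (ENNReal.toReal_eq_toReal_iff' (Lp.eLpNorm_ne_top _) (Lp.eLpNorm_ne_top _)).1 this

end FourierFunction


/-! ### Schur's test and homogeneous kernels -/

section Schur

theorem sq_lintegral_mul_le {Y : Type*} [MeasurableSpace Y] (ν : Measure Y) {f g : Y → ℝ≥0∞}
    (hf : AEMeasurable f ν) (hg : AEMeasurable g ν) :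
    (∫⁻ y, f y * g y ∂ν) ^ 2 ≤ (∫⁻ y, f y ^ 2 ∂ν) * ∫⁻ y, g y ^ 2 ∂ν := by
  have h := ENNReal.lintegral_mul_le_Lp_mul_Lq ν Real.HolderConjugate.two_two hf hg
  simp only [Pi.mul_apply, ENNReal.rpow_two] at h
  calc _ ≤ ((∫⁻ y, f y ^ 2 ∂ν) ^ (1 / 2 : ℝ) * (∫⁻ y, g y ^ 2 ∂ν) ^ (1 / 2 : ℝ)) ^ 2 := by gcongr
    _ = _ := by
      rw [mul_pow, ← ENNReal.rpow_two, ← ENNReal.rpow_two, ← ENNReal.rpow_mul, ← ENNReal.rpow_mul]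
      norm_num

theorem enorm_integral_mul_le {Y : Type*} [MeasurableSpace Y] {ν : Measure Y} {f g : Y → ℂ}
    (hf : AEStronglyMeasurable f ν) (hg : AEStronglyMeasurable g ν) :
    ∫⁻ y, ‖f y * g y‖ₑ ∂ν ≤ eLpNorm f 2 ν * eLpNorm g 2 ν := by
  have h := eLpNorm_smul_le_mul_eLpNorm (p := 2) (q := 2) (r := 1) hg hf
  rw [eLpNorm_one_eq_lintegral_enorm] at h
  exact h

/-- **Schur's test.** -/
theorem lintegral_sq_lintegral_le {X Y : Type*} [MeasurableSpace X] [MeasurableSpace Y]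
    {μ : Measure X} {ν : Measure Y} [SFinite μ] [SFinite ν] {k : X → Y → ℝ≥0∞}
    (hk : Measurable (Function.uncurry k)) {p : X → ℝ≥0∞} {q : Y → ℝ≥0∞}
    (hp : Measurable p) (hq : Measurable q) (hq0 : ∀ᵐ y ∂ν, q y ≠ 0 ∧ q y ≠ ⊤) {A B : ℝ≥0∞}
    (h1 : ∀ᵐ x ∂μ, ∫⁻ y, k x y * q y ∂ν ≤ A * p x)
    (h2 : ∀ᵐ y ∂ν, ∫⁻ x, k x y * p x ∂μ ≤ B * q y)
    {f : Y → ℝ≥0∞} (hf : AEMeasurable f ν) :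
    ∫⁻ x, (∫⁻ y, k x y * f y ∂ν) ^ 2 ∂μ ≤ A * B * ∫⁻ y, f y ^ 2 ∂ν := by
  have hkx : ∀ x, Measurable (k x) := fun x => hk.comp measurable_prodMk_left
  have hky : ∀ y, Measurable fun x => k x y := fun y => hk.comp measurable_prodMk_right
  have step1 : ∀ᵐ x ∂μ, (∫⁻ y, k x y * f y ∂ν) ^ 2 ≤
      A * ∫⁻ y, p x * (k x y * ((q y)⁻¹ * f y ^ 2)) ∂ν := by
    filter_upwards [h1] with x hx
    have e1 : ∫⁻ y, k x y * f y ∂ν =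
        ∫⁻ y, (k x y * q y) ^ (1 / 2 : ℝ) * (k x y * ((q y)⁻¹ * f y ^ 2)) ^ (1 / 2 : ℝ) ∂ν := by
      refine lintegral_congr_ae ?_
      filter_upwards [hq0] with y hy
      rw [← ENNReal.mul_rpow_of_nonneg _ _ (by norm_num)]
      have : k x y * q y * (k x y * ((q y)⁻¹ * f y ^ 2)) = (k x y * f y) ^ (2 : ℝ) := by
        calc _ = (q y * (q y)⁻¹) * (k x y * f y) ^ 2 := by ring
          _ = _ := by rw [ENNReal.mul_inv_cancel hy.1 hy.2, one_mul, ENNReal.rpow_two]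
      rw [this, ← ENNReal.rpow_mul]; norm_num
    have hs : ∀ a : ℝ≥0∞, (a ^ (1 / 2 : ℝ)) ^ 2 = a := fun a => by
      rw [← ENNReal.rpow_two, ← ENNReal.rpow_mul]; norm_num
    have hG : AEMeasurable (fun y => k x y * ((q y)⁻¹ * f y ^ 2)) ν :=
      (hkx x).aemeasurable.mul (hq.inv.aemeasurable.mul (hf.pow_const 2))
    have e2 := sq_lintegral_mul_le ν (f := fun y => (k x y * q y) ^ (1 / 2 : ℝ))
      (g := fun y => (k x y * ((q y)⁻¹ * f y ^ 2)) ^ (1 / 2 : ℝ))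
      (((hkx x).mul hq).pow_const _).aemeasurable
      (hG.pow_const _)
    rw [e1]
    refine e2.trans ?_
    simp only [hs]
    rw [lintegral_const_mul'' _ hG, ← mul_assoc]
    gcongr
  have hm : AEMeasurable (Function.uncurry fun x y => p x * (k x y * ((q y)⁻¹ * f y ^ 2)))
      (μ.prod ν) := by
    have hf2 : AEMeasurable (fun z : X × Y => f z.2) (μ.prod ν) :=
      hf.comp_quasiMeasurePreserving Measure.quasiMeasurePreserving_snd
    exact (hp.comp measurable_fst).aemeasurable.mul (hk.aemeasurable.mul
      ((hq.comp measurable_snd).inv.aemeasurable.mul (hf2.pow_const 2)))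
  calc ∫⁻ x, (∫⁻ y, k x y * f y ∂ν) ^ 2 ∂μ
      ≤ ∫⁻ x, A * ∫⁻ y, p x * (k x y * ((q y)⁻¹ * f y ^ 2)) ∂ν ∂μ := lintegral_mono_ae step1
    _ = A * ∫⁻ y, ∫⁻ x, p x * (k x y * ((q y)⁻¹ * f y ^ 2)) ∂μ ∂ν := by
      rw [← lintegral_lintegral_swap hm]
      exact lintegral_const_mul'' _ hm.lintegral_prod_right'
    _ ≤ A * ∫⁻ y, B * f y ^ 2 ∂ν := by
      gcongr A * ?_
      refine lintegral_mono_ae ?_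
      filter_upwards [h2, hq0] with y hy hy0
      calc ∫⁻ x, p x * (k x y * ((q y)⁻¹ * f y ^ 2)) ∂μ
          = ∫⁻ x, (k x y * p x) * ((q y)⁻¹ * f y ^ 2) ∂μ := by
            refine lintegral_congr fun x => by ring
        _ = (∫⁻ x, k x y * p x ∂μ) * ((q y)⁻¹ * f y ^ 2) :=
            lintegral_mul_const _ ((hky y).mul hp)
        _ ≤ B * q y * ((q y)⁻¹ * f y ^ 2) := by gcongr
        _ = (q y * (q y)⁻¹) * (B * f y ^ 2) := by ring
        _ = _ := by rw [ENNReal.mul_inv_cancel hy0.1 hy0.2, one_mul]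
    _ = _ := by rw [lintegral_const_mul'' _ (hf.pow_const 2), mul_assoc]

theorem lintegral_Ioi_rpow_div_add_le {γ : ℝ} (h0 : 0 < γ) (h1 : γ < 1) {a : ℝ} (ha : 0 < a) :
    ∫⁻ b in Ioi (0 : ℝ), ENNReal.ofReal (b ^ (-γ) / (a + b)) ≤
      ENNReal.ofReal ((1 / (1 - γ) + 1 / γ) * a ^ (-γ)) := by
  have hsplit : Ioi (0 : ℝ) = Ioc 0 a ∪ Ioi a := (Ioc_union_Ioi_eq_Ioi ha.le).symm
  have hA : ∫⁻ b in Ioc 0 a, ENNReal.ofReal (b ^ (-γ) / (a + b)) ≤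
      ENNReal.ofReal (1 / (1 - γ) * a ^ (-γ)) := by
    have hi : IntegrableOn (fun b : ℝ => a⁻¹ * b ^ (-γ)) (Ioc 0 a) :=
      ((intervalIntegral.intervalIntegrable_rpow' (by linarith : -1 < -γ) (a := 0) (b := a)).1).const_mul _
    calc _ ≤ ∫⁻ b in Ioc 0 a, ENNReal.ofReal (a⁻¹ * b ^ (-γ)) := by
          refine setLIntegral_mono' measurableSet_Ioc fun b hb => ENNReal.ofReal_le_ofReal ?_
          rw [div_eq_inv_mul]
          have := hb.1
          gcongr; linarith
      _ = ENNReal.ofReal (∫ b in Ioc 0 a, a⁻¹ * b ^ (-γ)) := by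
          rw [ofReal_integral_eq_lintegral_ofReal hi]
          filter_upwards [ae_restrict_mem measurableSet_Ioc] with b hb
          have := hb.1
          positivity
      _ ≤ _ := by
          refine ENNReal.ofReal_le_ofReal (le_of_eq ?_)
          rw [integral_const_mul, ← intervalIntegral.integral_of_le ha.le,
            integral_rpow (Or.inl (by linarith)), Real.zero_rpow (by linarith), sub_zero,
            show -γ + 1 = -γ + (1:ℝ) from rfl, Real.rpow_add_one ha.ne']
          have : 1 - γ ≠ 0 := by linarith
          have : -γ + 1 ≠ 0 := by linarith
          field_simp
          ring
  have hB : ∫⁻ b in Ioi a, ENNReal.ofReal (b ^ (-γ) / (a + b)) ≤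
      ENNReal.ofReal (1 / γ * a ^ (-γ)) := by
    have hi : IntegrableOn (fun b : ℝ => b ^ (-γ - 1)) (Ioi a) :=
      integrableOn_Ioi_rpow_of_lt (by linarith) ha
    calc _ ≤ ∫⁻ b in Ioi a, ENNReal.ofReal (b ^ (-γ - 1)) := by
          refine setLIntegral_mono' measurableSet_Ioi fun b hb => ENNReal.ofReal_le_ofReal ?_
          have hb0 : 0 < b := ha.trans hb
          rw [Real.rpow_sub_one hb0.ne']
          gcongr; linarith
      _ = ENNReal.ofReal (∫ b in Ioi a, b ^ (-γ - 1)) := by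
          rw [ofReal_integral_eq_lintegral_ofReal hi]
          filter_upwards [ae_restrict_mem measurableSet_Ioi] with b hb
          have : 0 < b := ha.trans hb
          positivity
      _ ≤ _ := by
          refine ENNReal.ofReal_le_ofReal (le_of_eq ?_)
          rw [integral_Ioi_rpow_of_lt (by linarith) ha]
          simp only [sub_add_cancel]
          field_simp
  rw [hsplit, lintegral_union measurableSet_Ioi]
  · rw [add_mul, ENNReal.ofReal_add]
    · exact add_le_add hA hB
    · have : 0 < 1 - γ := by linarith
      positivity
    · positivity
  · exact Set.disjoint_left.2 fun x hx hx' => not_lt.2 hx.2 hx'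

theorem lintegral_abs_eq (g : ℝ → ℝ≥0∞) :
    ∫⁻ x, g |x| = 2 * ∫⁻ x in Ioi (0 : ℝ), g x := by
  have h1 : ∫⁻ x, g |x| = (∫⁻ x in Iic (0 : ℝ), g |x|) + ∫⁻ x in Ioi (0 : ℝ), g |x| := by
    rw [← lintegral_union measurableSet_Ioi, Iic_union_Ioi, setLIntegral_univ]
    exact Set.disjoint_left.2 fun x hx hx' => not_lt.2 (mem_Iic.1 hx) hx'
  have h2 : ∫⁻ x in Ioi (0 : ℝ), g |x| = ∫⁻ x in Ioi (0 : ℝ), g x :=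
    setLIntegral_congr_fun measurableSet_Ioi fun x hx => by rw [abs_of_pos hx]
  have h3 : ∫⁻ x in Iic (0 : ℝ), g |x| = ∫⁻ x in Ioi (0 : ℝ), g x := by
    rw [setLIntegral_congr Iio_ae_eq_Iic.symm]
    have := (Measure.measurePreserving_neg (volume : Measure ℝ)).setLIntegral_comp_preimage_emb
      (MeasurableEquiv.neg ℝ).measurableEmbedding g (Ioi 0)
    rw [← this]
    have hs : (Neg.neg ⁻¹' Ioi (0 : ℝ)) = Iio 0 := by ext; simp
    rw [hs]
    exact setLIntegral_congr_fun measurableSet_Iio fun x hx => by rw [abs_of_neg hx]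
  rw [h1, h2, h3, two_mul]

theorem lintegral_comp_one_add_abs_le (g : ℝ → ℝ≥0∞) :
    ∫⁻ x, g (1 + |x|) ≤ 2 * ∫⁻ x in Ioi (0 : ℝ), g x := by
  rw [lintegral_abs_eq fun x => g (1 + x)]
  gcongr 2 * ?_
  have := (measurePreserving_add_left (volume : Measure ℝ) 1).setLIntegral_comp_preimage_emb
      (measurableEmbedding_addLeft 1) g (Ioi 1)
  have hs : ((fun x : ℝ => 1 + x) ⁻¹' Ioi (1 : ℝ)) = Ioi 0 := by ext; simp
  rw [hs] at this
  rw [this]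
  exact lintegral_mono_set (Ioi_subset_Ioi zero_le_one)

theorem abs_rpow_sub_one_mul_le {σ x : ℝ} (hσ : |σ| ≤ 1) (hx : 0 < x) :
    |x ^ σ - 1| * (x + 1) ≤ 2 * |x - 1| * max 1 (x ^ σ) := by
  have base : ∀ {σ x : ℝ}, 0 ≤ σ → σ ≤ 1 → 1 ≤ x → (x ^ σ - 1) * (x + 1) ≤ 2 * (x - 1) * x ^ σ := by
    intro σ x h0 h1 hx
    have hx0 : 0 < x := by linarith
    have e1 : x ^ σ ≤ x := by simpa using Real.rpow_le_rpow_of_exponent_le hx h1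
    have e2 : 1 ≤ x ^ σ := Real.one_le_rpow hx h0
    nlinarith
  have pos : ∀ {σ x : ℝ}, 0 ≤ σ → σ ≤ 1 → 0 < x →
      |x ^ σ - 1| * (x + 1) ≤ 2 * |x - 1| * max 1 (x ^ σ) := by
    intro σ x h0 h1 hx
    rcases le_total 1 x with h | h
    · rw [abs_of_nonneg (sub_nonneg.2 (Real.one_le_rpow h h0)), abs_of_nonneg (sub_nonneg.2 h)]
      refine (base h0 h1 h).trans ?_
      exact mul_le_mul_of_nonneg_left (le_max_right _ _) (by linarith)
    · have e1 : x ^ σ ≤ 1 := Real.rpow_le_one hx.le h h0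
      have e2 : x ≤ x ^ σ := by
        simpa using Real.rpow_le_rpow_of_exponent_ge hx h h1
      rw [abs_of_nonpos (by linarith), abs_of_nonpos (by linarith), max_eq_left e1]
      nlinarith
  rcases le_total 0 σ with h | h
  · exact pos h (by linarith [le_abs_self σ]) hx
  · have h1 := pos (σ := -σ) (by linarith) (by linarith [neg_abs_le σ]) hx
    have hp : 0 < x ^ σ := by positivity
    have e : x ^ σ * x ^ (-σ) = 1 := by rw [← Real.rpow_add hx]; simp
    calc |x ^ σ - 1| * (x + 1) = x ^ σ * (|x ^ (-σ) - 1| * (x + 1)) := by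
          rw [← mul_assoc]
          congr 1
          rw [← abs_of_pos hp, ← abs_mul, abs_of_pos hp, mul_sub, e, mul_one, abs_sub_comm]
      _ ≤ x ^ σ * (2 * |x - 1| * max 1 (x ^ (-σ))) := by gcongr
      _ = 2 * |x - 1| * (x ^ σ * max 1 (x ^ (-σ))) := by ring
      _ = _ := by rw [mul_max_of_nonneg _ _ hp.le, e, mul_one, max_comm]

/-- The commutator of a power weight with a kernel of size `1 / |z - η|`. -/
theorem abs_rpow_sub_rpow_le {σ a b : ℝ} (hσ : |σ| ≤ 1) (ha : 0 < a) (hb : 0 < b) :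
    |a ^ σ - b ^ σ| ≤ |a - b| * b ^ σ * (2 * (1 + (a / b) ^ σ) / (a + b)) := by
  have h := abs_rpow_sub_one_mul_le hσ (div_pos ha hb)
  have hbp : 0 < b ^ σ := by positivity
  have e1 : |a ^ σ - b ^ σ| = b ^ σ * |(a / b) ^ σ - 1| := by
    rw [← abs_of_pos hbp, ← abs_mul, abs_of_pos hbp, mul_sub, Real.div_rpow ha.le hb.le,
      mul_div_cancel₀ _ hbp.ne', mul_one]
  have e2 : |a - b| = b * |a / b - 1| := by
    rw [← abs_of_pos hb, ← abs_mul, abs_of_pos hb, mul_sub, mul_div_cancel₀ _ hb.ne', mul_one]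
  have e3 : max 1 ((a / b) ^ σ) ≤ 1 + (a / b) ^ σ := by
    have : 0 < (a / b) ^ σ := by positivity
    exact max_le (by linarith) (by linarith)
  have e4 : |(a / b) ^ σ - 1| ≤ 2 * |a / b - 1| * (1 + (a / b) ^ σ) / (a / b + 1) := by
    rw [le_div_iff₀ (by positivity)]
    exact h.trans (by gcongr)
  rw [e1, e2]
  calc _ ≤ b ^ σ * (2 * |a / b - 1| * (1 + (a / b) ^ σ) / (a / b + 1)) := by gcongr
    _ = _ := by field_simp

end Schur


/-! ### Time cut-offs as Fourier multipliers on weighted `L²` spaces -/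

section Multiplier

open Filter Topology

theorem integral_schwartz_mul_fourier_sub {κ : ℝ → ℂ} (hκ : Integrable κ) (φ : 𝓢(ℝ, ℂ)) (x : ℝ) :
    ∫ ξ, φ ξ * 𝓕 κ (x - ξ) = 𝓕 (fun τ => κ τ * (𝓕⁻ φ) τ) x := by
  have h1 : ∫ ξ, φ ξ * 𝓕 κ (x - ξ) = ∫ ξ, 𝓕 κ ξ * φ (x - ξ) := by
    rw [← integral_sub_left_eq_self _ _ x]
    simp only [sub_sub_cancel, mul_comm]
  have hφx : Integrable (fun ξ => φ (x - ξ)) := φ.integrable.comp_sub_left x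
  have h2 := VectorFourier.integral_fourierIntegral_smul_eq_flip (μ := (volume : Measure ℝ))
    (ν := (volume : Measure ℝ)) (L := innerₗ ℝ)
    Real.continuous_fourierChar (by exact continuous_inner) hκ hφx
  rw [flip_innerₗ] at h2
  have h2' : ∫ ξ, 𝓕 κ ξ * φ (x - ξ) = ∫ τ, κ τ * 𝓕 (fun ξ => φ (x - ξ)) τ := h2
  rw [h1, h2', Real.fourier_eq']
  refine integral_congr_ae (ae_of_all _ fun τ => ?_)
  have h3 : 𝓕 (fun ξ => φ (x - ξ)) τ =
      Complex.exp (↑(-2 * Real.pi * inner ℝ τ x) * Complex.I) * (𝓕⁻ φ) τ := by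
    rw [SchwartzMap.fourierInv_coe, Real.fourierInv_eq', Real.fourier_eq',
      ← integral_sub_left_eq_self _ _ x, ← integral_const_mul]
    refine integral_congr_ae (ae_of_all _ fun ξ => ?_)
    simp only [sub_sub_cancel, smul_eq_mul]
    rw [← mul_assoc, ← Complex.exp_add]
    congr 2
    simp
    ring
  simp only [h3, smul_eq_mul]
  ring

theorem eLpNorm_integral_mul_fourier_le {κ W : ℝ → ℂ} {A : ℝ} (hκ : Integrable κ)
    (hA : ∀ τ, ‖κ τ‖ ≤ A) (hκ2 : MemLp (𝓕 κ) 2) (hW : MemLp W 2) :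
    eLpNorm (fun x => ∫ ξ, W ξ * 𝓕 κ (x - ξ)) 2 ≤ ENNReal.ofReal A * eLpNorm W 2 := by
  have hA0 : 0 ≤ A := (norm_nonneg _).trans (hA 0)
  have hS : ∀ φ : 𝓢(ℝ, ℂ), eLpNorm (fun x => ∫ ξ, φ ξ * 𝓕 κ (x - ξ)) 2 ≤
      ENNReal.ofReal A * eLpNorm φ 2 ∧
      AEStronglyMeasurable (fun x => ∫ ξ, φ ξ * 𝓕 κ (x - ξ)) := by
    intro φ
    set ψ : 𝓢(ℝ, ℂ) := 𝓕⁻ φ with hψ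
    have e1 : (fun x => ∫ ξ, φ ξ * 𝓕 κ (x - ξ)) = 𝓕 (fun τ => κ τ * ψ τ) :=
      funext fun x => integral_schwartz_mul_fourier_sub hκ φ x
    have hb : ∀ᵐ τ, ‖κ τ * ψ τ‖ ≤ ‖((A : ℂ) * ψ τ)‖ := ae_of_all _ fun τ => by
      rw [norm_mul, norm_mul, Complex.norm_real, Real.norm_of_nonneg hA0]
      gcongr; exact hA τ
    have hm : AEStronglyMeasurable (fun τ => κ τ * ψ τ) :=
      hκ.1.mul ψ.continuous.aestronglyMeasurable
    have hi : Integrable (fun τ => κ τ * ψ τ) :=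
      (ψ.integrable.const_mul (A : ℂ)).mono hm hb
    have h2 : MemLp (fun τ => κ τ * ψ τ) 2 :=
      ((ψ.memLp 2).const_mul (A : ℂ)).of_le hm hb
    refine ⟨?_, ?_⟩
    · rw [e1, eLpNorm_fourier_eq hi h2]
      have e2 : eLpNorm φ 2 (volume : Measure ℝ) = eLpNorm ψ 2 := by
        rw [← eLpNorm_fourier_eq ψ.integrable (ψ.memLp 2), ← SchwartzMap.fourier_coe, hψ,
          FourierTransform.fourier_fourierInv_eq]
      rw [e2]
      refine (eLpNorm_mono_ae hb).trans ?_
      have := eLpNorm_const_smul_le (c := (A : ℂ)) (f := ψ) (p := 2) (μ := (volume : Measure ℝ))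
      refine this.trans (le_of_eq ?_)
      rw [← ofReal_norm, Complex.norm_real, Real.norm_of_nonneg hA0]
    · rw [e1]
      exact (VectorFourier.fourierIntegral_continuous Real.continuous_fourierChar
        (by exact continuous_inner) hi).aestronglyMeasurable
  obtain ⟨u, hu⟩ : ∃ u : ℕ → 𝓢(ℝ, ℂ), Tendsto (fun n => (u n).toLp 2) atTop (𝓝 (hW.toLp W)) := by
    have hd := SchwartzMap.denseRange_toLpCLM (E := ℝ) (F := ℂ) (p := 2)
      (μ := (volume : Measure ℝ)) ENNReal.ofNat_ne_top
    obtain ⟨y, hy, hyt⟩ := mem_closure_iff_seq_limit.1 (hd (hW.toLp W))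
    choose u hu using hy
    refine ⟨u, ?_⟩
    have e : y = fun n => (u n).toLp 2 := funext fun n => (hu n).symm
    rwa [e] at hyt
  have hu0 : Tendsto (fun n => eLpNorm (⇑(u n) - W) 2) atTop (𝓝 0) := by
    have := Lp.tendsto_Lp_iff_tendsto_eLpNorm'' (fi := atTop) (fun n => u n) (fun n => (u n).memLp 2) W hW
    exact this.1 hu
  have hpt : ∀ x, Tendsto (fun n => ∫ ξ, u n ξ * 𝓕 κ (x - ξ)) atTop
      (𝓝 (∫ ξ, W ξ * 𝓕 κ (x - ξ))) := by
    intro x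
    have hx2 : MemLp (fun ξ => 𝓕 κ (x - ξ)) 2 :=
      hκ2.comp_measurePreserving (Measure.measurePreserving_sub_left volume x)
    rw [tendsto_iff_edist_tendsto_0]
    have hle : ∀ n, edist (∫ ξ, u n ξ * 𝓕 κ (x - ξ)) (∫ ξ, W ξ * 𝓕 κ (x - ξ)) ≤
        eLpNorm (⇑(u n) - W) 2 * eLpNorm (fun ξ => 𝓕 κ (x - ξ)) 2 := by
      intro n
      have i1 : Integrable (fun ξ => u n ξ * 𝓕 κ (x - ξ)) := ((u n).memLp 2).integrable_mul hx2
      have i2 : Integrable (fun ξ => W ξ * 𝓕 κ (x - ξ)) := hW.integrable_mul hx2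
      rw [edist_eq_enorm_sub, ← integral_sub i1 i2]
      refine (enorm_integral_le_lintegral_enorm _).trans ?_
      simp only [← sub_mul]
      exact enorm_integral_mul_le (((u n).memLp 2).sub hW).1 hx2.1
    have hne : eLpNorm (fun ξ => 𝓕 κ (x - ξ)) 2 volume ≠ ⊤ := hx2.eLpNorm_ne_top
    have h0 := ENNReal.Tendsto.mul_const hu0 (Or.inr hne)
    rw [zero_mul] at h0
    exact tendsto_of_tendsto_of_tendsto_of_le_of_le' tendsto_const_nhds h0
      (Eventually.of_forall fun _ => bot_le) (Eventually.of_forall hle)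
  have hlim := Lp.eLpNorm_lim_le_liminf_eLpNorm (p := 2) (fun n => (hS (u n)).2)
    (fun x => ∫ ξ, W ξ * 𝓕 κ (x - ξ)) (ae_of_all _ hpt)
  refine hlim.trans ?_
  have hle : ∀ n, eLpNorm (fun x => ∫ ξ, u n ξ * 𝓕 κ (x - ξ)) 2 ≤
      ENNReal.ofReal A * (eLpNorm (⇑(u n) - W) 2 + eLpNorm W 2) := by
    intro n
    refine (hS (u n)).1.trans ?_
    gcongr
    have := eLpNorm_add_le (((u n).memLp 2).sub hW).1 hW.1 (p := 2) one_le_two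
    simpa using this
  refine (liminf_le_liminf (Eventually.of_forall hle)).trans (le_of_eq ?_)
  have := ENNReal.Tendsto.const_mul (a := ENNReal.ofReal A)
    (hu0.add_const (eLpNorm W 2)) (Or.inr ENNReal.ofReal_ne_top)
  rw [zero_add] at this
  exact this.liminf_eq

/-- `κ̂(z) = ∫ e^{-izτ} κ(τ) dτ`. -/
def hatKernel (κ : ℝ → ℂ) (z : ℝ) : ℂ := ∫ τ, κ τ * Complex.exp (-Complex.I * z * τ)

/-- On the Fourier side, multiplication by `κ`. -/
def multiplier (κ V : ℝ → ℂ) (z : ℝ) : ℂ :=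
  (1 / (2 * Real.pi) : ℂ) * ∫ η, V η * hatKernel κ (z - η)

/-- The norm of `H^σ` on the Fourier side. -/
def jnorm (σ : ℝ) (V : ℝ → ℂ) : ℝ≥0∞ :=
  eLpNorm (fun η => (((1 + |η|) ^ σ : ℝ) : ℂ) * V η) 2

theorem fourier_eq_hatKernel (κ : ℝ → ℂ) (x : ℝ) : 𝓕 κ x = hatKernel κ (2 * Real.pi * x) := by
  rw [Real.fourier_eq', hatKernel]
  refine integral_congr_ae (ae_of_all _ fun τ => ?_)
  simp only [smul_eq_mul]
  rw [mul_comm]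
  congr 2
  simp
  ring

theorem continuous_hatKernel {κ : ℝ → ℂ} (hκ : Integrable κ) : Continuous (hatKernel κ) := by
  have h : hatKernel κ = fun z => 𝓕 κ ((2 * Real.pi)⁻¹ * z) := by
    funext z
    rw [fourier_eq_hatKernel, mul_inv_cancel_left₀ two_pi_ne_zero']
  rw [h]
  exact (VectorFourier.fourierIntegral_continuous Real.continuous_fourierChar
    (by exact continuous_inner) hκ).comp (continuous_const.mul continuous_id)

theorem eLpNorm_comp_two_pi_mul {f : ℝ → ℂ} (hf : AEStronglyMeasurable f) :
    eLpNorm (fun x => f (2 * Real.pi * x)) 2 =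
      ENNReal.ofReal |((2 * Real.pi) ^ Module.finrank ℝ ℝ)⁻¹| ^ (1 / 2 : ℝ) * eLpNorm f 2 := by
  have h := Measure.map_addHaar_smul (volume : Measure ℝ) two_pi_ne_zero'
  have h2 : AEStronglyMeasurable f (Measure.map ((2 * Real.pi) • · : ℝ → ℝ) volume) := by
    rw [h]; exact hf.smul_measure _
  have h1 := eLpNorm_map_measure (p := 2) h2 (measurable_const_smul _).aemeasurable
  rw [h, eLpNorm_smul_measure_of_ne_zero (by positivity)] at h1
  simpa [Function.comp_def] using h1.symm

theorem aestronglyMeasurable_multiplier {κ V : ℝ → ℂ} (hκ : Integrable κ)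
    (hV : AEStronglyMeasurable V) : AEStronglyMeasurable (multiplier κ V) := by
  refine AEStronglyMeasurable.const_mul ?_ _
  refine AEStronglyMeasurable.integral_prod_right' (f := fun p : ℝ × ℝ =>
    V p.2 * hatKernel κ (p.1 - p.2)) ?_
  exact hV.comp_snd.mul
    ((continuous_hatKernel hκ).comp (continuous_fst.sub continuous_snd)).aestronglyMeasurable

theorem memLp_one_add_abs_rpow {r : ℝ} (hr : 1 / 2 < r) :
    MemLp (fun η : ℝ => (((1 + |η|) ^ (-r) : ℝ) : ℂ)) 2 := by
  refine MemLp.ofReal (K := ℂ) ?_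
  rw [memLp_two_iff_integrable_sq]
  · have h := integrable_one_add_norm (E := ℝ) (μ := volume) (r := 2 * r) (by simp; linarith)
    refine h.congr (ae_of_all _ fun η => ?_)
    simp only [Real.norm_eq_abs]
    change (1 + |η|) ^ (-(2 * r)) = ((1 + |η|) ^ (-r)) ^ 2
    rw [← Real.rpow_natCast, ← Real.rpow_mul (by positivity)]
    congr 1; push_cast; ring
  · refine (Continuous.rpow_const (by fun_prop) fun x => Or.inl ?_).aestronglyMeasurable
    positivity

theorem eLpNorm_multiplier_le {κ V : ℝ → ℂ} {A : ℝ} (hκ : Integrable κ) (hA : ∀ τ, ‖κ τ‖ ≤ A)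
    (hκ2 : MemLp (hatKernel κ) 2) (hV : MemLp V 2) :
    eLpNorm (multiplier κ V) 2 ≤ ENNReal.ofReal A * eLpNorm V 2 := by
  have hsc : ∀ {f : ℝ → ℂ}, MemLp f 2 → MemLp (fun x => f (2 * Real.pi * x)) 2 := by
    intro f hf
    refine ⟨hf.1.comp_quasiMeasurePreserving
      (Measure.quasiMeasurePreserving_smul (volume : Measure ℝ) two_pi_ne_zero'), ?_⟩
    rw [eLpNorm_comp_two_pi_mul hf.1]
    exact ENNReal.mul_lt_top (ENNReal.rpow_lt_top_of_nonneg (by norm_num) ENNReal.ofReal_ne_top) hf.2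
  have hF : 𝓕 κ = fun x => hatKernel κ (2 * Real.pi * x) := funext (fourier_eq_hatKernel κ)
  have h := eLpNorm_integral_mul_fourier_le hκ hA (by rw [hF]; exact hsc hκ2) (hsc hV)
  have e : (fun x => ∫ ξ, V (2 * Real.pi * ξ) * 𝓕 κ (x - ξ)) =
      fun x => multiplier κ V (2 * Real.pi * x) := by
    funext x
    have h1 := Measure.integral_comp_mul_left
      (fun η => V η * hatKernel κ (2 * Real.pi * x - η)) (2 * Real.pi)
    rw [multiplier, hF]
    simp only [mul_sub] at h1 ⊢
    rw [h1, abs_of_pos (by positivity), Complex.real_smul]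
    simp
  rw [e, eLpNorm_comp_two_pi_mul (aestronglyMeasurable_multiplier hκ hV.1),
    eLpNorm_comp_two_pi_mul hV.1, mul_left_comm] at h
  refine (ENNReal.mul_le_mul_iff_right ?_ ?_).1 h
  · have : 0 < ENNReal.ofReal |((2 * Real.pi) ^ Module.finrank ℝ ℝ)⁻¹| := by
      rw [ENNReal.ofReal_pos]; positivity
    exact (ENNReal.rpow_pos this ENNReal.ofReal_ne_top).ne'
  · exact ENNReal.rpow_ne_top_of_nonneg (by norm_num) ENNReal.ofReal_ne_top

end Multiplier


section WeightedMultiplier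

open Filter Topology

theorem one_add_abs_pos (η : ℝ) : 0 < 1 + |η| := by positivity

theorem continuous_one_add_abs_rpow (σ : ℝ) : Continuous fun η : ℝ => (1 + |η|) ^ σ :=
  Continuous.rpow_const (by fun_prop) fun x => Or.inl (one_add_abs_pos x).ne'

theorem memLp_of_jnorm_lt_top {σ : ℝ} {V : ℝ → ℂ} (hV : AEStronglyMeasurable V)
    (h : jnorm σ V < ⊤) : MemLp (fun η => (((1 + |η|) ^ σ : ℝ) : ℂ) * V η) 2 :=
  ⟨(Complex.continuous_ofReal.comp (continuous_one_add_abs_rpow σ)).aestronglyMeasurable.mul hV, h⟩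

theorem enorm_one_add_abs_rpow_mul (σ η : ℝ) (v : ℂ) :
    ‖(((1 + |η|) ^ σ : ℝ) : ℂ) * v‖ₑ = ENNReal.ofReal ((1 + |η|) ^ σ) * ‖v‖ₑ := by
  rw [enorm_mul, ← ofReal_norm (((1 + |η|) ^ σ : ℝ) : ℂ), Complex.norm_real,
    Real.norm_of_nonneg (by have := one_add_abs_pos η; positivity)]

/-- The constant in the embedding of `H^σ` in a weighted `L¹` space on the Fourier side. -/
def embeddingConst (r : ℝ) : ℝ≥0∞ := eLpNorm (fun η : ℝ => (((1 + |η|) ^ (-r) : ℝ) : ℂ)) 2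

theorem embeddingConst_lt_top {r : ℝ} (hr : 1 / 2 < r) : embeddingConst r < ⊤ :=
  (memLp_one_add_abs_rpow hr).2

theorem lintegral_enorm_le_jnorm {σ : ℝ} (ρ : ℝ) {V : ℝ → ℂ} (hV : AEStronglyMeasurable V) :
    ∫⁻ η, ENNReal.ofReal ((1 + |η|) ^ ρ) * ‖V η‖ₑ ≤ embeddingConst (σ - ρ) * jnorm σ V := by
  have h := enorm_integral_mul_le (ν := (volume : Measure ℝ))
    (f := fun η : ℝ => (((1 + |η|) ^ (-(σ - ρ)) : ℝ) : ℂ))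
    (g := fun η => (((1 + |η|) ^ σ : ℝ) : ℂ) * V η)
    (Complex.continuous_ofReal.comp (continuous_one_add_abs_rpow _)).aestronglyMeasurable
    ((Complex.continuous_ofReal.comp (continuous_one_add_abs_rpow σ)).aestronglyMeasurable.mul hV)
  refine le_trans (le_of_eq ?_) h
  refine lintegral_congr fun η => ?_
  rw [← mul_assoc, ← Complex.ofReal_mul, ← Real.rpow_add (one_add_abs_pos η), neg_sub,
    sub_add_cancel, enorm_one_add_abs_rpow_mul]

theorem integrable_rpow_mul_of_jnorm {σ ρ : ℝ} (h : 1 / 2 < σ - ρ) {V : ℝ → ℂ}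
    (hV : AEStronglyMeasurable V) (hj : jnorm σ V < ⊤) :
    Integrable fun η => (((1 + |η|) ^ ρ : ℝ) : ℂ) * V η := by
  refine ⟨(Complex.continuous_ofReal.comp
    (continuous_one_add_abs_rpow ρ)).aestronglyMeasurable.mul hV, ?_⟩
  rw [hasFiniteIntegral_iff_enorm]
  simp only [enorm_one_add_abs_rpow_mul]
  exact (lintegral_enorm_le_jnorm (σ := σ) ρ hV).trans_lt
    (ENNReal.mul_lt_top (embeddingConst_lt_top h) hj)

/-- An integrable function, bounded by `A`, whose transform is bounded by `A / |z|`. -/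
structure IsCutoff (A : ℝ) (κ : ℝ → ℂ) : Prop where
  integrable : Integrable κ
  bound : ∀ τ, ‖κ τ‖ ≤ A
  decay : ∀ z, |z| * ‖hatKernel κ z‖ ≤ A

theorem norm_hatKernel_le (κ : ℝ → ℂ) (z : ℝ) : ‖hatKernel κ z‖ ≤ ∫ τ, ‖κ τ‖ := by
  refine (norm_integral_le_integral_norm _).trans (le_of_eq ?_)
  refine integral_congr_ae (ae_of_all _ fun τ => ?_)
  have : ‖Complex.exp (-Complex.I * z * τ)‖ = 1 := by
    rw [show -Complex.I * z * τ = ((-(z * τ) : ℝ) : ℂ) * Complex.I by push_cast; ring]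
    exact Complex.norm_exp_ofReal_mul_I _
  simp only [norm_mul, this, mul_one]

theorem IsCutoff.norm_hatKernel_le {A : ℝ} {κ : ℝ → ℂ} (h : IsCutoff A κ) (z : ℝ) :
    ‖hatKernel κ z‖ ≤ (A + ∫ τ, ‖κ τ‖) * (1 + |z|)⁻¹ := by
  rw [← div_eq_mul_inv, le_div_iff₀ (one_add_abs_pos z)]
  have := h.decay z
  have := KdVm.norm_hatKernel_le κ z
  nlinarith

theorem inv_one_add_abs_sub_le (z η : ℝ) :
    (1 + |z - η|)⁻¹ ≤ (1 + |z|) * (1 + |η|)⁻¹ := by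
  rw [inv_le_iff_one_le_mul₀ (one_add_abs_pos _), mul_right_comm, ← div_eq_mul_inv,
    le_div_iff₀ (one_add_abs_pos _)]
  have h1 : |η| ≤ |z| + |z - η| := by
    have := abs_sub z (z - η); simpa using this
  nlinarith [abs_nonneg z, abs_nonneg (z - η)]

theorem IsCutoff.nonneg {A : ℝ} {κ : ℝ → ℂ} (h : IsCutoff A κ) : 0 ≤ A :=
  (norm_nonneg _).trans (h.bound 0)

theorem integrable_mul_of_norm_le {σ : ℝ} (hσ : -(1 / 2) < σ) {V g : ℝ → ℂ}
    (hV : AEStronglyMeasurable V) (hj : jnorm σ V < ⊤) (hg : AEStronglyMeasurable g) {B : ℝ}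
    (hB : ∀ η, ‖g η‖ ≤ B * (1 + |η|)⁻¹) : Integrable fun η => V η * g η := by
  have h := integrable_rpow_mul_of_jnorm (σ := σ) (ρ := -1) (by linarith) hV hj
  refine (h.const_mul (B : ℂ)).mono (hV.mul hg) (ae_of_all _ fun η => ?_)
  have h0 := one_add_abs_pos η
  have hB0 : 0 ≤ B := by
    have := (norm_nonneg _).trans (hB 0); simpa using this
  rw [norm_mul, norm_mul, norm_mul, Complex.norm_real, Complex.norm_real, Real.norm_of_nonneg hB0,
    Real.norm_of_nonneg (by positivity), Real.rpow_neg_one, mul_comm ‖V η‖, ← mul_assoc]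
  gcongr
  exact hB η

theorem IsCutoff.integrable_mul {A σ : ℝ} {κ V : ℝ → ℂ} (h : IsCutoff A κ) (hσ : -(1 / 2) < σ)
    (hV : AEStronglyMeasurable V) (hj : jnorm σ V < ⊤) (z : ℝ) :
    Integrable fun η => V η * hatKernel κ (z - η) := by
  refine integrable_mul_of_norm_le hσ hV hj
    ((continuous_hatKernel h.integrable).comp (continuous_sub_left z)).aestronglyMeasurable
    (B := (A + ∫ τ, ‖κ τ‖) * (1 + |z|)) fun η => ?_
  have hB : 0 ≤ A + ∫ τ, ‖κ τ‖ := add_nonneg h.nonneg (integral_nonneg fun _ => norm_nonneg _)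
  refine (h.norm_hatKernel_le (z - η)).trans ?_
  rw [mul_assoc]
  gcongr
  exact inv_one_add_abs_sub_le z η

theorem IsCutoff.memLp_hatKernel {A : ℝ} {κ : ℝ → ℂ} (h : IsCutoff A κ) :
    MemLp (hatKernel κ) 2 := by
  have h1 := (memLp_one_add_abs_rpow (r := 1) (by norm_num)).const_mul
    (((A + ∫ τ, ‖κ τ‖ : ℝ)) : ℂ)
  refine h1.of_le (continuous_hatKernel h.integrable).aestronglyMeasurable (ae_of_all _ fun z => ?_)
  have h0 := one_add_abs_pos z
  have hB : 0 ≤ A + ∫ τ, ‖κ τ‖ := add_nonneg h.nonneg (integral_nonneg fun _ => norm_nonneg _)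
  rw [norm_mul, Complex.norm_real, Complex.norm_real, Real.norm_of_nonneg hB,
    Real.norm_of_nonneg (by positivity), Real.rpow_neg_one]
  exact h.norm_hatKernel_le z

/-- The kernel of the commutator of the weight `(1 + |·|)^σ` with a cut-off. -/
def commKernel (σ : ℝ) (a b : ℝ) : ℝ := 2 * (1 + (a / b) ^ σ) / (a + b)

theorem commKernel_nonneg (σ : ℝ) {a b : ℝ} (ha : 0 < a) (hb : 0 < b) : 0 ≤ commKernel σ a b := by
  unfold commKernel; positivity

theorem lintegral_commKernel_right_le {σ : ℝ} (h1 : -(1 / 2) < σ) (h2 : σ < 1 / 2) {a : ℝ}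
    (ha : 0 < a) :
    ∫⁻ b in Ioi (0 : ℝ), ENNReal.ofReal (commKernel σ a b * b ^ (-(1 / 2) : ℝ)) ≤
      ENNReal.ofReal (2 * ((1 / (1 - 1 / 2) + 1 / (1 / 2)) +
        (1 / (1 - (1 / 2 + σ)) + 1 / (1 / 2 + σ))) * a ^ (-(1 / 2) : ℝ)) := by
  have e : ∀ b ∈ Ioi (0 : ℝ), ENNReal.ofReal (commKernel σ a b * b ^ (-(1 / 2) : ℝ)) =
      ENNReal.ofReal 2 * ENNReal.ofReal (b ^ (-(1 / 2) : ℝ) / (a + b)) +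
      ENNReal.ofReal (2 * a ^ σ) * ENNReal.ofReal (b ^ (-(1 / 2 + σ)) / (a + b)) := by
    intro b hb
    have hb0 : 0 < b := hb
    rw [← ENNReal.ofReal_mul (by positivity), ← ENNReal.ofReal_mul (by positivity),
      ← ENNReal.ofReal_add (by positivity) (by positivity)]
    congr 1
    rw [commKernel, Real.div_rpow ha.le hb0.le, neg_add, Real.rpow_add hb0, Real.rpow_neg hb0.le σ]
    field_simp
  have hm : ∀ γ : ℝ, Measurable fun b : ℝ => ENNReal.ofReal (b ^ (-γ) / (a + b)) := fun γ => by
    fun_prop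
  rw [setLIntegral_congr_fun measurableSet_Ioi e,
    lintegral_add_left ((hm _).const_mul _),
    lintegral_const_mul _ (hm _), lintegral_const_mul _ (hm _)]
  have i1 := lintegral_Ioi_rpow_div_add_le (γ := 1 / 2) (by norm_num) (by norm_num) ha
  have i2 := lintegral_Ioi_rpow_div_add_le (γ := 1 / 2 + σ) (by linarith) (by linarith) ha
  refine (add_le_add (mul_le_mul_right i1 _) (mul_le_mul_right i2 _)).trans (le_of_eq ?_)
  have p1 : 0 < 1 / 2 + σ := by linarith
  have p2 : 0 < 1 - (1 / 2 + σ) := by linarith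
  rw [← ENNReal.ofReal_mul (by positivity), ← ENNReal.ofReal_mul (by positivity),
    ← ENNReal.ofReal_add (by positivity) (by positivity)]
  congr 1
  rw [neg_add, Real.rpow_add ha, Real.rpow_neg ha.le σ]
  have : a ^ σ ≠ 0 := by positivity
  field_simp

theorem commKernel_swap (σ : ℝ) {a b : ℝ} (ha : 0 < a) (hb : 0 < b) :
    commKernel σ a b = commKernel (-σ) b a := by
  rw [commKernel, commKernel, add_comm a b, Real.rpow_neg (by positivity),
    ← Real.inv_rpow (by positivity), inv_div]

theorem exists_lintegral_commKernel_le {σ : ℝ} (h1 : -(1 / 2) < σ) (h2 : σ < 1 / 2) :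
    ∃ C : ℝ≥0, ∀ f : ℝ → ℝ≥0∞, AEMeasurable f →
      ∫⁻ z, (∫⁻ η, ENNReal.ofReal (commKernel σ (1 + |z|) (1 + |η|)) * f η) ^ 2 ≤
        C * ∫⁻ η, f η ^ 2 := by
  have one : ∀ σ : ℝ, -(1 / 2) < σ → σ < 1 / 2 → ∃ C : ℝ≥0, ∀ a : ℝ, 0 < a →
      ∫⁻ η : ℝ, ENNReal.ofReal (commKernel σ a (1 + |η|)) *
        ENNReal.ofReal ((1 + |η|) ^ (-(1 / 2) : ℝ)) ≤ C * ENNReal.ofReal (a ^ (-(1 / 2) : ℝ)) := by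
    intro σ h1 h2
    set K := 2 * ((1 / (1 - 1 / 2) + 1 / (1 / 2)) + (1 / (1 - (1 / 2 + σ)) + 1 / (1 / 2 + σ)))
    have p1 : 0 < 1 / 2 + σ := by linarith
    have p2 : 0 < 1 - (1 / 2 + σ) := by linarith
    refine ⟨2 * K.toNNReal, fun a ha => ?_⟩
    have h := (lintegral_comp_one_add_abs_le fun b =>
      ENNReal.ofReal (commKernel σ a b * b ^ (-(1 / 2) : ℝ))).trans
      (mul_le_mul_right (lintegral_commKernel_right_le h1 h2 ha) 2)
    refine le_trans (le_of_eq (lintegral_congr fun η => ?_)) (h.trans (le_of_eq ?_))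
    · rw [ENNReal.ofReal_mul (commKernel_nonneg σ ha (one_add_abs_pos η))]
    · rw [ENNReal.ofReal_mul (by positivity)]
      push_cast
      rw [mul_assoc]; rfl
  obtain ⟨A, hA⟩ := one σ h1 h2
  obtain ⟨B, hB⟩ := one (-σ) (by linarith) (by linarith)
  refine ⟨A * B, fun f hf => ?_⟩
  have hpm : Measurable fun η : ℝ => ENNReal.ofReal ((1 + |η|) ^ (-(1 / 2) : ℝ)) :=
    (continuous_one_add_abs_rpow _).measurable.ennreal_ofReal
  have hkm : Measurable (Function.uncurry fun z η : ℝ =>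
      ENNReal.ofReal (commKernel σ (1 + |z|) (1 + |η|))) := by
    unfold commKernel Function.uncurry
    fun_prop
  have := lintegral_sq_lintegral_le (μ := volume) (ν := volume) hkm hpm hpm
    (ae_of_all _ fun η => ⟨by
      have := one_add_abs_pos η
      have : 0 < (1 + |η|) ^ (-(1 / 2) : ℝ) := by positivity
      exact (ENNReal.ofReal_pos.2 this).ne', ENNReal.ofReal_ne_top⟩)
    (A := A) (B := B) (ae_of_all _ fun z => hA _ (one_add_abs_pos z))
    (ae_of_all _ fun η => by
      simp only [fun z : ℝ => commKernel_swap σ (one_add_abs_pos z) (one_add_abs_pos η)]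
      exact hB _ (one_add_abs_pos η)) hf
  exact_mod_cast this

theorem jnorm_zero (V : ℝ → ℂ) : jnorm 0 V = eLpNorm V 2 := by
  simp [jnorm]

/-- Time cut-offs act boundedly on `H^σ` for `|σ| < 1/2`. -/
theorem exists_jnorm_multiplier_le {σ : ℝ} (h1 : -(1 / 2) < σ) (h2 : σ < 1 / 2) :
    ∃ C : ℝ≥0, ∀ (A : ℝ) (κ V : ℝ → ℂ), IsCutoff A κ → AEStronglyMeasurable V →
      jnorm σ V < ⊤ → jnorm σ (multiplier κ V) ≤ C * ENNReal.ofReal A * jnorm σ V := by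
  obtain ⟨C, hC⟩ := exists_lintegral_commKernel_le h1 h2
  refine ⟨1 + (C ^ (1 / 2 : ℝ)), fun A κ V hκ hV hj => ?_⟩
  set W : ℝ → ℂ := fun η => (((1 + |η|) ^ σ : ℝ) : ℂ) * V η with hW
  have hWL : MemLp W 2 := memLp_of_jnorm_lt_top hV hj
  set R : ℝ → ℂ := fun z => (1 / (2 * Real.pi) : ℂ) *
    ∫ η, ((((1 + |z|) ^ σ - (1 + |η|) ^ σ : ℝ) : ℂ) * V η * hatKernel κ (z - η)) with hR
  have hdec : (fun z => (((1 + |z|) ^ σ : ℝ) : ℂ) * multiplier κ V z) = multiplier κ W + R := by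
    funext z
    have i1 := hκ.integrable_mul h1 hV hj z
    have i2 := hκ.integrable_mul (σ := 0) (by norm_num) hWL.1 (by rw [jnorm_zero]; exact hWL.2) z
    simp only [Pi.add_apply, multiplier, hR]
    rw [← mul_add, mul_left_comm, ← integral_const_mul]
    congr 1
    rw [← integral_add i2]
    · refine integral_congr_ae (ae_of_all _ fun η => ?_)
      simp only [hW]; push_cast; ring
    · refine ((i1.const_mul (((1 + |z|) ^ σ : ℝ) : ℂ)).sub i2).congr (ae_of_all _ fun η => ?_)
      simp only [hW, Pi.sub_apply]; push_cast; ring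
  have hm1 : AEStronglyMeasurable (multiplier κ W) :=
    aestronglyMeasurable_multiplier hκ.integrable hWL.1
  have hm2 : AEStronglyMeasurable R := by
    have : R = (fun z => (((1 + |z|) ^ σ : ℝ) : ℂ) * multiplier κ V z) - multiplier κ W := by
      rw [hdec]; simp
    rw [this]
    exact ((Complex.continuous_ofReal.comp (continuous_one_add_abs_rpow σ)).aestronglyMeasurable.mul
      (aestronglyMeasurable_multiplier hκ.integrable hV)).sub hm1
  have b1 : eLpNorm (multiplier κ W) 2 ≤ ENNReal.ofReal A * jnorm σ V :=
    eLpNorm_multiplier_le hκ.integrable hκ.bound hκ.memLp_hatKernel hWL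
  have hRpt : ∀ z, ‖R z‖ₑ ≤ ENNReal.ofReal A *
      ∫⁻ η, ENNReal.ofReal (commKernel σ (1 + |z|) (1 + |η|)) * ‖W η‖ₑ := by
    intro z
    have hc : ‖(1 / (2 * Real.pi) : ℂ)‖ₑ ≤ 1 := by
      rw [← ofReal_norm, ENNReal.ofReal_le_one]
      have : (1 / (2 * Real.pi) : ℂ) = ((1 / (2 * Real.pi) : ℝ) : ℂ) := by push_cast; rfl
      rw [this, Complex.norm_real, Real.norm_of_nonneg (by positivity)]
      rw [div_le_one (by positivity)]
      linarith [Real.pi_gt_three]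
    rw [hR]
    simp only [enorm_mul]
    refine (mul_le_mul' hc (enorm_integral_le_lintegral_enorm _)).trans ?_
    rw [one_mul, ← lintegral_const_mul' _ _ ENNReal.ofReal_ne_top]
    refine lintegral_mono fun η => ?_
    have ha := one_add_abs_pos z
    have hb := one_add_abs_pos η
    have hk := commKernel_nonneg σ ha hb
    simp only [hW]
    rw [← ofReal_norm, ← ofReal_norm (_ * V η), ← ENNReal.ofReal_mul hk,
      ← ENNReal.ofReal_mul hκ.nonneg]
    refine ENNReal.ofReal_le_ofReal ?_
    rw [norm_mul, norm_mul, norm_mul, Complex.norm_real, Complex.norm_real, Real.norm_eq_abs,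
      Real.norm_of_nonneg (by positivity : 0 ≤ (1 + |η|) ^ σ)]
    have hσ : |σ| ≤ 1 := abs_le.2 ⟨by linarith, by linarith⟩
    have hc := abs_rpow_sub_rpow_le hσ ha hb
    have hab : |(1 + |z|) - (1 + |η|)| ≤ |z - η| := by
      rw [add_sub_add_left_eq_sub]; exact abs_abs_sub_abs_le_abs_sub z η
    calc |(1 + |z|) ^ σ - (1 + |η|) ^ σ| * ‖V η‖ * ‖hatKernel κ (z - η)‖
        ≤ (|z - η| * (1 + |η|) ^ σ * commKernel σ (1 + |z|) (1 + |η|)) * ‖V η‖ *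
          ‖hatKernel κ (z - η)‖ := by
          gcongr
          exact hc.trans (by rw [commKernel]; gcongr)
      _ = (|z - η| * ‖hatKernel κ (z - η)‖) * (commKernel σ (1 + |z|) (1 + |η|) *
          ((1 + |η|) ^ σ * ‖V η‖)) := by ring
      _ ≤ _ := by
          gcongr
          exact hκ.decay _
  have hsq : ∀ a : ℝ≥0∞, (a ^ (2 : ℝ)) ^ (1 / 2 : ℝ) = a := fun a => by
    rw [← ENNReal.rpow_mul]; norm_num
  have hnorm : ∀ f : ℝ → ℂ, eLpNorm f 2 = (∫⁻ z, ‖f z‖ₑ ^ 2) ^ (1 / 2 : ℝ) := fun f => by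
    rw [eLpNorm_eq_lintegral_rpow_enorm_toReal two_ne_zero ENNReal.ofNat_ne_top]
    simp
  have b2 : eLpNorm R 2 ≤ (C ^ (1 / 2 : ℝ) : ℝ≥0) * ENNReal.ofReal A * jnorm σ V := by
    have e1 : ∫⁻ z, ‖R z‖ₑ ^ 2 ≤ ENNReal.ofReal A ^ 2 * (C * ∫⁻ η, ‖W η‖ₑ ^ 2) := by
      calc ∫⁻ z, ‖R z‖ₑ ^ 2 ≤ ∫⁻ z, ENNReal.ofReal A ^ 2 *
            (∫⁻ η, ENNReal.ofReal (commKernel σ (1 + |z|) (1 + |η|)) * ‖W η‖ₑ) ^ 2 := by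
            refine lintegral_mono fun z => ?_
            rw [← mul_pow]
            exact pow_le_pow_left₀ bot_le (hRpt z) 2
        _ ≤ _ := by
            rw [lintegral_const_mul' _ _ (by simp)]
            gcongr
            exact hC _ hWL.1.enorm
    rw [hnorm, jnorm, hnorm]
    refine (ENNReal.rpow_le_rpow e1 (by norm_num)).trans (le_of_eq ?_)
    rw [ENNReal.mul_rpow_of_nonneg _ _ (by norm_num), ENNReal.mul_rpow_of_nonneg _ _ (by norm_num),
      ← ENNReal.rpow_two, hsq, ENNReal.coe_rpow_of_nonneg _ (by norm_num)]
    ring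
  rw [jnorm, hdec]
  refine (eLpNorm_add_le hm1 hm2 one_le_two).trans ((add_le_add b1 b2).trans (le_of_eq ?_))
  push_cast
  ring

end WeightedMultiplier


section HalfLineCutoff

open Filter Topology

theorem aestronglyMeasurable_weight_mul (σ : ℝ) {V : ℝ → ℂ} (hV : AEStronglyMeasurable V) :
    AEStronglyMeasurable fun η => (((1 + |η|) ^ σ : ℝ) : ℂ) * V η :=
  (Complex.continuous_ofReal.comp (continuous_one_add_abs_rpow σ)).aestronglyMeasurable.mul hV

theorem jnorm_add_le (σ : ℝ) {V W : ℝ → ℂ} (hV : AEStronglyMeasurable V)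
    (hW : AEStronglyMeasurable W) : jnorm σ (fun η => V η + W η) ≤ jnorm σ V + jnorm σ W := by
  have := eLpNorm_add_le (aestronglyMeasurable_weight_mul σ hV)
    (aestronglyMeasurable_weight_mul σ hW) (p := 2) one_le_two
  refine le_trans (le_of_eq ?_) this
  rw [jnorm]; congr 1; funext η; simp only [Pi.add_apply]; ring

theorem jnorm_mono_of_norm_le {σ ρ : ℝ} {V W : ℝ → ℂ}
    (h : ∀ η, (1 + |η|) ^ σ * ‖V η‖ ≤ (1 + |η|) ^ ρ * ‖W η‖) : jnorm σ V ≤ jnorm ρ W := by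
  refine eLpNorm_mono fun η => ?_
  have h0 := one_add_abs_pos η
  rw [norm_mul, norm_mul, Complex.norm_real, Complex.norm_real, Real.norm_of_nonneg (by positivity),
    Real.norm_of_nonneg (by positivity)]
  exact h η

theorem jnorm_mono {σ ρ : ℝ} (h : σ ≤ ρ) (V : ℝ → ℂ) : jnorm σ V ≤ jnorm ρ V :=
  jnorm_mono_of_norm_le fun η => by
    have := abs_nonneg η
    gcongr
    linarith

theorem jnorm_const_mul (σ : ℝ) (c : ℂ) (V : ℝ → ℂ) :
    jnorm σ (fun η => c * V η) = ‖c‖ₑ * jnorm σ V := by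
  have := eLpNorm_const_smul c (fun η => (((1 + |η|) ^ σ : ℝ) : ℂ) * V η) 2
    (volume : Measure ℝ)
  rw [jnorm, jnorm, ← this]
  congr 1; funext η; simp only [Pi.smul_apply, smul_eq_mul]; ring

theorem jnorm_id_mul_le (σ : ℝ) (V : ℝ → ℂ) :
    jnorm σ (fun η => Complex.I * η * V η) ≤ jnorm (σ + 1) V :=
  jnorm_mono_of_norm_le fun η => by
    have h0 := one_add_abs_pos η
    rw [Real.rpow_add_one h0.ne', norm_mul, norm_mul, Complex.norm_I, one_mul, Complex.norm_real,
      Real.norm_eq_abs, ← mul_assoc]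
    gcongr
    linarith

theorem jnorm_add_one_le (σ : ℝ) {V : ℝ → ℂ} (hV : AEStronglyMeasurable V) :
    jnorm (σ + 1) V ≤ jnorm σ V + jnorm σ (fun η => Complex.I * η * V η) := by
  have hm : AEStronglyMeasurable fun η : ℝ => Complex.I * η * V η :=
    (by fun_prop : Continuous fun η : ℝ => Complex.I * (η : ℂ)).aestronglyMeasurable.mul hV
  have := eLpNorm_add_le (p := 2) (aestronglyMeasurable_weight_mul σ (Complex.continuous_ofReal.comp_aestronglyMeasurable hV.norm))
    (aestronglyMeasurable_weight_mul σ (Complex.continuous_ofReal.comp_aestronglyMeasurable hm.norm)) one_le_two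
  refine le_trans (eLpNorm_mono fun η => ?_) (this.trans (add_le_add (eLpNorm_mono fun η => ?_)
    (eLpNorm_mono fun η => ?_)))
  · have h0 := one_add_abs_pos η
    simp only [Pi.add_apply]
    rw [← Complex.ofReal_mul, ← Complex.ofReal_mul, ← Complex.ofReal_add, norm_mul,
      Complex.norm_real, Complex.norm_real, Real.norm_of_nonneg (by positivity),
      Real.norm_of_nonneg (by positivity), Real.rpow_add_one h0.ne', norm_mul, norm_mul,
      Complex.norm_I, Complex.norm_real, Real.norm_eq_abs]
    refine le_of_eq ?_
    ring
  · simp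
  · simp

/-- The time cut-off `χ_{(0,∞)}(τ) a(τ / S)`. -/
def halfCutoff (a : 𝓢(ℝ, ℂ)) (S : ℝ) : ℝ → ℂ := (Ioi 0).indicator fun τ => a (τ / S)

theorem integrable_comp_div (a : 𝓢(ℝ, ℂ)) {S : ℝ} (hS : 0 < S) :
    Integrable fun τ => a (τ / S) := a.integrable.comp_div hS.ne'

theorem integrable_halfCutoff (a : 𝓢(ℝ, ℂ)) {S : ℝ} (hS : 0 < S) :
    Integrable (halfCutoff a S) := (integrable_comp_div a hS).indicator measurableSet_Ioi

theorem hatKernel_halfCutoff (a : 𝓢(ℝ, ℂ)) (S z : ℝ) : hatKernel (halfCutoff a S) z =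
    ∫ τ in Ioi (0 : ℝ), a (τ / S) * Complex.exp (-Complex.I * z * τ) := by
  rw [hatKernel, ← integral_indicator measurableSet_Ioi]
  refine integral_congr_ae (ae_of_all _ fun τ => ?_)
  simp only [halfCutoff, indicator]
  split_ifs <;> simp

theorem norm_exp_neg_I_mul (z τ : ℝ) : ‖Complex.exp (-Complex.I * z * τ)‖ = 1 := by
  rw [show -Complex.I * z * τ = ((-(z * τ) : ℝ) : ℂ) * Complex.I by push_cast; ring]
  exact Complex.norm_exp_ofReal_mul_I _

theorem integrable_mul_exp {f : ℝ → ℂ} {s : Set ℝ} (hf : IntegrableOn f s) (z : ℝ) :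
    IntegrableOn (fun τ : ℝ => f τ * Complex.exp (-Complex.I * z * τ)) s := by
  refine Integrable.mono hf (hf.1.mul (by fun_prop : Continuous fun τ : ℝ =>
    Complex.exp (-Complex.I * z * τ)).aestronglyMeasurable) (ae_of_all _ fun τ => ?_)
  rw [norm_mul, norm_exp_neg_I_mul, mul_one]

theorem I_mul_hatKernel_halfCutoff (a : 𝓢(ℝ, ℂ)) {S : ℝ} (hS : 0 < S) (z : ℝ) :
    Complex.I * z * hatKernel (halfCutoff a S) z =
      a 0 + (S⁻¹ : ℝ) * hatKernel (halfCutoff (SchwartzMap.derivCLM ℂ ℂ a) S) z := by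
  set a' := SchwartzMap.derivCLM ℂ ℂ a
  have hd : ∀ τ : ℝ, HasDerivAt (fun τ : ℝ => a (τ / S) * Complex.exp (-Complex.I * z * τ))
      ((S⁻¹ : ℝ) * (a' (τ / S) * Complex.exp (-Complex.I * z * τ)) -
        Complex.I * z * (a (τ / S) * Complex.exp (-Complex.I * z * τ))) τ := by
    intro τ
    have h1 : HasDerivAt (fun τ : ℝ => a (τ / S)) ((S⁻¹ : ℝ) • a' (τ / S)) τ := by
      have := (a.hasDerivAt (τ / S)).scomp τ ((hasDerivAt_id τ).div_const S)
      simpa [Function.comp_def, a'] using this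
    have h2 : HasDerivAt (fun τ : ℝ => Complex.exp (-Complex.I * z * τ))
        (Complex.exp (-Complex.I * z * τ) * (-Complex.I * z)) τ := by
      have h3 : HasDerivAt (fun τ : ℝ => -Complex.I * z * (τ : ℂ)) (-Complex.I * z) τ := by
        simpa using (Complex.ofRealCLM.hasDerivAt (x := τ)).const_mul (-Complex.I * (z : ℂ))
      exact h3.cexp
    refine (h1.mul h2).congr_deriv ?_
    rw [Complex.real_smul]
    ring
  have i1 : IntegrableOn (fun τ : ℝ => a (τ / S) * Complex.exp (-Complex.I * z * τ)) (Ioi 0) :=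
    integrable_mul_exp (integrable_comp_div a hS).integrableOn z
  have i2 : IntegrableOn (fun τ : ℝ => a' (τ / S) * Complex.exp (-Complex.I * z * τ)) (Ioi 0) :=
    integrable_mul_exp (integrable_comp_div a' hS).integrableOn z
  have ht : Tendsto (fun τ : ℝ => a (τ / S) * Complex.exp (-Complex.I * z * τ)) atTop (𝓝 0) := by
    rw [tendsto_zero_iff_norm_tendsto_zero]
    simp only [norm_mul, norm_exp_neg_I_mul, mul_one]
    rw [← tendsto_zero_iff_norm_tendsto_zero]
    exact (a.tendsto_cocompact.mono_left atTop_le_cocompact).comp (tendsto_id.atTop_div_const hS)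
  have h := integral_Ioi_of_hasDerivAt_of_tendsto' (a := 0) (fun τ _ => hd τ)
    ((i2.const_mul _).sub (i1.const_mul _)) ht
  have h' := integral_sub (i2.const_mul ((S⁻¹ : ℝ) : ℂ)) (i1.const_mul (Complex.I * z))
  rw [integral_const_mul, integral_const_mul] at h'
  rw [hatKernel_halfCutoff, hatKernel_halfCutoff]
  have h2 := h'.symm.trans h
  simp only [zero_div, Complex.ofReal_zero, mul_zero, Complex.exp_zero, mul_one, zero_sub] at h2
  linear_combination -h2

theorem exists_isCutoff_halfCutoff (a : 𝓢(ℝ, ℂ)) :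
    ∃ A : ℝ, ∀ S : ℝ, 0 < S → IsCutoff A (halfCutoff a S) := by
  set a' := SchwartzMap.derivCLM ℂ ℂ a
  set M := SchwartzMap.seminorm ℂ 0 0 a
  have hM : ∀ x, ‖a x‖ ≤ M := fun x => SchwartzMap.norm_le_seminorm ℂ a x
  have hM0 : 0 ≤ M := (norm_nonneg _).trans (hM 0)
  have hI : 0 ≤ ∫ τ, ‖a' τ‖ := integral_nonneg fun _ => norm_nonneg _
  refine ⟨M + ∫ τ, ‖a' τ‖, fun S hS => ⟨integrable_halfCutoff a hS, fun τ => ?_, fun z => ?_⟩⟩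
  · refine le_trans ?_ (le_add_of_nonneg_right hI)
    rw [halfCutoff, indicator]
    split_ifs
    · exact hM _
    · simpa using hM0
  · have h1 : |z| * ‖hatKernel (halfCutoff a S) z‖ =
        ‖Complex.I * z * hatKernel (halfCutoff a S) z‖ := by simp
    rw [h1, I_mul_hatKernel_halfCutoff a hS]
    refine (norm_add_le _ _).trans (add_le_add (hM 0) ?_)
    rw [norm_mul, Complex.norm_real, Real.norm_of_nonneg (by positivity)]
    have h2 : ‖hatKernel (halfCutoff a' S) z‖ ≤ S * ∫ τ, ‖a' τ‖ := by
      refine (norm_hatKernel_le _ z).trans ?_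
      have h3 : ∫ τ, ‖a' (τ / S)‖ = S * ∫ τ, ‖a' τ‖ := by
        rw [Measure.integral_comp_div (fun τ => ‖a' τ‖) S, abs_of_pos hS, smul_eq_mul]
      rw [← h3]
      refine integral_mono (integrable_halfCutoff a' hS).norm (integrable_comp_div a' hS).norm
        fun τ => ?_
      simp only [halfCutoff]
      exact norm_indicator_le_norm_self _ _
    calc _ ≤ S⁻¹ * (S * ∫ τ, ‖a' τ‖) := by gcongr
      _ = _ := by field_simp

theorem I_mul_multiplier_halfCutoff (a : 𝓢(ℝ, ℂ)) {S : ℝ} (hS : 0 < S) {σ : ℝ}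
    (hσ : 1 / 2 < σ) {V : ℝ → ℂ} (hV : AEStronglyMeasurable V) (hj : jnorm σ V < ⊤)
    (h0 : ∫ η, V η = 0) (z : ℝ) :
    Complex.I * z * multiplier (halfCutoff a S) V z =
      (S⁻¹ : ℝ) * multiplier (halfCutoff (SchwartzMap.derivCLM ℂ ℂ a) S) V z +
        multiplier (halfCutoff a S) (fun η => Complex.I * η * V η) z := by
  obtain ⟨A, hA⟩ := exists_isCutoff_halfCutoff a
  obtain ⟨A', hA'⟩ := exists_isCutoff_halfCutoff (SchwartzMap.derivCLM ℂ ℂ a)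
  have hVi : Integrable V := by
    simpa using integrable_rpow_mul_of_jnorm (σ := σ) (ρ := 0) (by linarith) hV hj
  have hm : AEStronglyMeasurable fun η : ℝ => Complex.I * η * V η :=
    (by fun_prop : Continuous fun η : ℝ => Complex.I * (η : ℂ)).aestronglyMeasurable.mul hV
  have hj' : jnorm (σ - 1) (fun η => Complex.I * η * V η) < ⊤ :=
    (jnorm_id_mul_le (σ - 1) V).trans_lt (by simpa using hj)
  have i0 := (hA S hS).integrable_mul (by linarith) hV hj z
  have i1 := (hA' S hS).integrable_mul (by linarith) hV hj z
  have i2 := (hA S hS).integrable_mul (by linarith) hm hj' z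
  have key : ∀ η, Complex.I * z * (V η * hatKernel (halfCutoff a S) (z - η)) =
      V η * a 0 + ((S⁻¹ : ℝ) * (V η *
        hatKernel (halfCutoff (SchwartzMap.derivCLM ℂ ℂ a) S) (z - η)) +
      Complex.I * η * V η * hatKernel (halfCutoff a S) (z - η)) := by
    intro η
    have := I_mul_hatKernel_halfCutoff a hS (z - η)
    push_cast at this ⊢
    linear_combination (V η) * this
  simp only [multiplier]
  rw [mul_left_comm, ← integral_const_mul]
  simp only [key]
  have i1' := i1.const_mul ((S⁻¹ : ℝ) : ℂ)
  have e1 := integral_add (hVi.mul_const (a 0)) (i1'.add i2)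
  have e2 := integral_add i1' i2
  simp only [Pi.add_apply] at e1
  rw [e1, e2, integral_mul_const, h0, integral_const_mul]
  ring

/-- The cut-off `χ_{(0,∞)}` acts boundedly on the functions in `H^μ` whose traces at `0` vanish. -/
theorem exists_jnorm_halfCutoff_le {σ : ℝ} (h1 : -(1 / 2) < σ) (h2 : σ < 1 / 2) (n : ℕ) :
    ∀ a : 𝓢(ℝ, ℂ), ∃ C : ℝ≥0, ∀ (S : ℝ) (V : ℝ → ℂ), 1 ≤ S → AEStronglyMeasurable V →
      jnorm (σ + n) V < ⊤ → (∀ k < n, ∫ η : ℝ, (η : ℂ) ^ k * V η = 0) →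
      jnorm (σ + n) (multiplier (halfCutoff a S) V) ≤ C * jnorm (σ + n) V := by
  induction n with
  | zero =>
    intro a
    obtain ⟨A, hA⟩ := exists_isCutoff_halfCutoff a
    obtain ⟨C, hC⟩ := exists_jnorm_multiplier_le h1 h2
    refine ⟨C * A.toNNReal, fun S V hS hV hj _ => ?_⟩
    simp only [Nat.cast_zero, add_zero] at hj ⊢
    have := hC A _ V (hA S (by linarith)) hV hj
    push_cast
    exact this
  | succ n ih =>
    intro a
    obtain ⟨C, hC⟩ := ih a
    obtain ⟨C', hC'⟩ := ih (SchwartzMap.derivCLM ℂ ℂ a)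
    refine ⟨C + (C' + C), fun S V hS hV hj h0 => ?_⟩
    have hS0 : 0 < S := by linarith
    have hn0 : (0 : ℝ) ≤ n := n.cast_nonneg
    push_cast at hj ⊢
    rw [← add_assoc] at hj ⊢
    have hmono := jnorm_mono (show σ + n ≤ σ + n + 1 by linarith) V
    have hjn : jnorm (σ + n) V < ⊤ := hmono.trans_lt hj
    have hm : AEStronglyMeasurable fun η : ℝ => Complex.I * η * V η :=
      (by fun_prop : Continuous fun η : ℝ => Complex.I * (η : ℂ)).aestronglyMeasurable.mul hV
    have hid := jnorm_id_mul_le (σ + n) V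
    have hV0 : ∫ η, V η = 0 := by simpa using h0 0 (Nat.succ_pos n)
    have hma := aestronglyMeasurable_multiplier (integrable_halfCutoff a hS0) hV
    have hma' := aestronglyMeasurable_multiplier
      (integrable_halfCutoff (SchwartzMap.derivCLM ℂ ℂ a) hS0) hV
    have hmI := aestronglyMeasurable_multiplier (integrable_halfCutoff a hS0) hm
    refine (jnorm_add_one_le (σ + n) hma).trans ?_
    have b1 := (hC S V hS hV hjn fun k hk => h0 k (hk.trans n.lt_succ_self)).trans
      (mul_le_mul_right hmono _)
    have b2 := (hC' S V hS hV hjn fun k hk => h0 k (hk.trans n.lt_succ_self)).trans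
      (mul_le_mul_right hmono _)
    have b3 := (hC S _ hS hm (hid.trans_lt hj) fun k hk => by
      have := h0 (k + 1) (by omega)
      rw [← mul_zero Complex.I, ← this, ← integral_const_mul]
      refine integral_congr_ae (ae_of_all _ fun η => ?_)
      simp only; ring).trans (mul_le_mul_right hid _)
    have e : (fun z => Complex.I * z * multiplier (halfCutoff a S) V z) = fun z =>
        (S⁻¹ : ℝ) * multiplier (halfCutoff (SchwartzMap.derivCLM ℂ ℂ a) S) V z +
        multiplier (halfCutoff a S) (fun η => Complex.I * η * V η) z :=
      funext fun z => I_mul_multiplier_halfCutoff a hS0 (σ := σ + n + 1) (by linarith) hV hj hV0 z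
    rw [e]
    have b4 := jnorm_add_le (σ + n) (hma'.const_mul ((S⁻¹ : ℝ) : ℂ)) hmI
    rw [jnorm_const_mul] at b4
    have hS1 : ‖((S⁻¹ : ℝ) : ℂ)‖ₑ ≤ 1 := by
      rw [← ofReal_norm, ENNReal.ofReal_le_one, Complex.norm_real,
        Real.norm_of_nonneg (by positivity)]
      exact inv_le_one_of_one_le₀ hS
    calc _ ≤ C * jnorm (σ + n + 1) V + (1 * (C' * jnorm (σ + n + 1) V) +
          C * jnorm (σ + n + 1) V) :=
          add_le_add b1 (b4.trans (add_le_add (mul_le_mul' hS1 b2) b3))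
      _ = _ := by ring

end HalfLineCutoff


section Restriction

open Filter Topology

/-- The indicator function of `(a, b]`. -/
def intervalCutoff (a b : ℝ) : ℝ → ℂ := (Ioc a b).indicator fun _ => 1

theorem integrable_intervalCutoff (a b : ℝ) : Integrable (intervalCutoff a b) :=
  (integrableOn_const (by simp)).integrable_indicator measurableSet_Ioc

theorem hatKernel_intervalCutoff {a b : ℝ} (h : a ≤ b) (z : ℝ) :
    hatKernel (intervalCutoff a b) z = ∫ τ in a..b, Complex.exp (-Complex.I * z * τ) := by
  rw [hatKernel, intervalIntegral.integral_of_le h, ← integral_indicator measurableSet_Ioc]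
  refine integral_congr_ae (ae_of_all _ fun τ => ?_)
  simp only [intervalCutoff, indicator]
  split_ifs <;> simp

theorem isCutoff_intervalCutoff {a b : ℝ} (h : a ≤ b) : IsCutoff 2 (intervalCutoff a b) where
  integrable := integrable_intervalCutoff a b
  bound τ := by
    simp only [intervalCutoff, indicator]
    split_ifs <;> simp
  decay z := by
    rcases eq_or_ne z 0 with rfl | hz
    · simp
    have hc : -Complex.I * (z : ℂ) ≠ 0 := by simpa using hz
    rw [hatKernel_intervalCutoff h, integral_exp_mul_complex hc, norm_div]
    have h1 : ‖-Complex.I * (z : ℂ)‖ = |z| := by simp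
    rw [h1, mul_div_cancel₀ _ (abs_ne_zero.2 hz)]
    refine (norm_sub_le _ _).trans ?_
    rw [norm_exp_neg_I_mul, norm_exp_neg_I_mul]
    norm_num

theorem integral_norm_intervalCutoff_le {a b : ℝ} (h : a ≤ b) :
    ∫ τ, ‖intervalCutoff a b τ‖ ≤ b - a := by
  have e : (fun τ => ‖intervalCutoff a b τ‖) = (Ioc a b).indicator fun _ => (1 : ℝ) := by
    funext τ
    simp only [intervalCutoff, indicator]
    split_ifs <;> simp
  rw [e, integral_indicator measurableSet_Ioc]
  simp [h]

theorem timeTransform_ofReal (g : 𝓢'(ℝ, ℂ)) {T : ℝ} (hT : 0 ≤ T) (z : ℝ) :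
    timeTransform g T z = multiplier (intervalCutoff 0 T) (fourierFunction g) z := by
  rw [timeTransform, multiplier]
  congr 1
  refine integral_congr_ae (ae_of_all _ fun η => ?_)
  simp only [hatKernel_intervalCutoff hT, Complex.ofReal_sub]

open scoped ContDiff in
theorem exists_schwartzMap_mollifier :
    ∃ ρ : 𝓢(ℝ, ℂ), ∫ s, ρ s = 1 ∧ ∀ δ : ℝ, 0 < δ → ∀ τ : ℝ, ∃ φ : 𝓢(ℝ, ℂ),
      (∀ t, φ t = (δ⁻¹ : ℝ) * ρ (δ⁻¹ * (τ - t))) ∧ HasCompactSupport φ ∧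
      tsupport φ ⊆ Metric.closedBall τ (δ / 2) := by
  let b : ContDiffBump (0 : ℝ) := ⟨1 / 4, 1 / 2, by norm_num, by norm_num⟩
  set g : ℝ → ℝ := b.normed volume with hg
  have hgc : ContDiff ℝ ∞ g := b.contDiff_normed
  have hgs : HasCompactSupport g := b.hasCompactSupport_normed
  obtain ⟨ρ, hρ⟩ := exists_schwartzMap_eq_ofReal hgc hgs
  refine ⟨ρ, ?_, fun δ hδ τ => ?_⟩
  · simp only [hρ]
    rw [integral_complex_ofReal, b.integral_normed, Complex.ofReal_one]
  · set g' : ℝ → ℝ := fun t => δ⁻¹ * g (δ⁻¹ * (τ - t)) with hg'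
    have hg'c : ContDiff ℝ ∞ g' :=
      contDiff_const.mul (hgc.comp (contDiff_const.mul (contDiff_const.sub contDiff_id)))
    have hsupp : ∀ t, t ∉ Metric.closedBall τ (δ / 2) → g' t = 0 := by
      intro t ht
      have h1 : δ⁻¹ * (τ - t) ∉ Function.support g := by
        rw [hg, b.support_normed_eq, Metric.mem_ball, dist_zero_right, Real.norm_eq_abs, abs_mul,
          abs_of_pos (inv_pos.2 hδ), not_lt]
        rw [Metric.mem_closedBall, dist_comm, Real.dist_eq, not_le] at ht
        rw [inv_mul_eq_div, le_div_iff₀ hδ]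
        change 1 / 2 * δ ≤ _
        linarith
      simp only [hg', Function.notMem_support.1 h1, mul_zero]
    have hg's : HasCompactSupport g' :=
      HasCompactSupport.intro (isCompact_closedBall τ (δ / 2)) hsupp
    obtain ⟨φ, hφ⟩ := exists_schwartzMap_eq_ofReal hg'c hg's
    have hφ0 : ∀ t, t ∉ Metric.closedBall τ (δ / 2) → φ t = 0 := fun t ht => by
      rw [hφ, hsupp t ht, Complex.ofReal_zero]
    refine ⟨φ, fun t => ?_, HasCompactSupport.intro (isCompact_closedBall τ (δ / 2)) hφ0, ?_⟩
    · rw [hφ, hρ]; simp only [hg']; push_cast; rfl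
    · refine closure_minimal (fun t ht => ?_) Metric.isClosed_closedBall
      by_contra h
      exact ht (hφ0 t h)

theorem fourierInv_mollifier {ρ φ : 𝓢(ℝ, ℂ)} {δ τ : ℝ} (hδ : 0 < δ)
    (h : ∀ t, φ t = (δ⁻¹ : ℝ) * ρ (δ⁻¹ * (τ - t))) (η : ℝ) :
    (𝓕⁻ φ) η = Complex.exp (Complex.I * (2 * Real.pi * η : ℝ) * τ) *
      hatKernel ρ (δ * (2 * Real.pi * η)) := by
  rw [SchwartzMap.fourierInv_coe, Real.fourierInv_eq', hatKernel, ← integral_const_mul,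
    ← integral_sub_left_eq_self _ _ τ]
  have h1 := Measure.integral_comp_mul_left (fun y : ℝ =>
    Complex.exp (↑(2 * Real.pi * inner ℝ (τ - y) η) * Complex.I) • φ (τ - y)) δ
  rw [abs_of_pos (inv_pos.2 hδ), eq_inv_smul_iff₀ hδ.ne'] at h1
  rw [← h1, Complex.real_smul, ← integral_const_mul]
  refine integral_congr_ae (ae_of_all _ fun s => ?_)
  simp only [h, sub_sub_cancel, inv_mul_cancel_left₀ hδ.ne', smul_eq_mul]
  have e : Complex.exp (↑(2 * Real.pi * inner ℝ (τ - δ * s) η) * Complex.I) =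
      Complex.exp (Complex.I * (2 * Real.pi * η : ℝ) * τ) *
        Complex.exp (-Complex.I * (δ * (2 * Real.pi * η) : ℝ) * s) := by
    rw [← Complex.exp_add]
    congr 1
    simp
    ring
  have hδ' : (δ : ℂ) ≠ 0 := by exact_mod_cast hδ.ne'
  rw [e]
  push_cast
  field_simp

theorem exists_norm_hatKernel_schwartz_le (ρ : 𝓢(ℝ, ℂ)) :
    ∃ C : ℝ, 0 ≤ C ∧ ∀ z, ‖hatKernel ρ z‖ ≤ C * (1 + |z|)⁻¹ := by
  obtain ⟨C, hC0, hC⟩ := (𝓕 ρ).decay 1 0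
  refine ⟨2 * Real.pi * C + ∫ τ, ‖ρ τ‖, by positivity, fun z => ?_⟩
  have h1 := hC ((2 * Real.pi)⁻¹ * z)
  rw [SchwartzMap.fourier_coe, norm_iteratedFDeriv_zero, fourier_eq_hatKernel,
    mul_inv_cancel_left₀ two_pi_ne_zero', pow_one, Real.norm_eq_abs, abs_mul,
    abs_of_pos (by positivity)] at h1
  have h2 := norm_hatKernel_le ρ z
  rw [← div_eq_mul_inv, le_div_iff₀ (one_add_abs_pos z), mul_add, mul_one]
  have h3 : ‖hatKernel ρ z‖ * |z| ≤ 2 * Real.pi * C := by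
    have : ‖hatKernel ρ z‖ * |z| = 2 * Real.pi * ((2 * Real.pi)⁻¹ * |z| * ‖hatKernel ρ z‖) := by
      field_simp
    rw [this]
    gcongr
  linarith

theorem multiplier_intervalCutoff_eq_zero {D : ℝ → ℂ} (hD : AEStronglyMeasurable D) {σ : ℝ}
    (hσ : -(1 / 2) < σ) (hj : jnorm σ D < ⊤) {T : ℝ} (hT : 0 < T)
    (h : ∀ φ : 𝓢(ℝ, ℂ), HasCompactSupport φ → tsupport φ ⊆ Ioo 0 T →
      ∫ η, D (2 * Real.pi * η) * (𝓕⁻ φ) η = 0) (z : ℝ) :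
    multiplier (intervalCutoff 0 T) D z = 0 := by
  obtain ⟨ρ, hρ1, hρ⟩ := exists_schwartzMap_mollifier
  obtain ⟨Cρ, hCρ0, hCρ⟩ := exists_norm_hatKernel_schwartz_le ρ
  have hcρ : Continuous (hatKernel ρ) := continuous_hatKernel ρ.integrable
  have hzero : ∀ δ : ℝ, 0 < δ → ∀ τ ∈ Icc δ (T - δ),
      ∫ η, D η * (Complex.exp (Complex.I * η * τ) * hatKernel ρ (δ * η)) = 0 := by
    intro δ hδ τ hτ
    obtain ⟨φ, hφ, hφc, hφs⟩ := hρ δ hδ τ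
    have h1 := h φ hφc (hφs.trans fun t ht => by
      rw [Real.closedBall_eq_Icc] at ht
      exact ⟨by linarith [ht.1, hτ.1], by linarith [ht.2, hτ.2]⟩)
    simp only [fourierInv_mollifier hδ hφ] at h1
    have h2 := Measure.integral_comp_mul_left (fun η : ℝ =>
      D η * (Complex.exp (Complex.I * η * τ) * hatKernel ρ (δ * η))) (2 * Real.pi)
    rw [h1] at h2
    have h3 : |(2 * Real.pi)⁻¹| ≠ 0 := by positivity
    exact (smul_eq_zero.1 h2.symm).resolve_left h3
  have hint : ∀ δ : ℝ, 0 < δ → Integrable fun η => D η * hatKernel ρ (δ * η) := by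
    intro δ hδ
    refine integrable_mul_of_norm_le hσ hD hj
      (hcρ.comp (continuous_const.mul continuous_id)).aestronglyMeasurable
      (B := Cρ * (1 + δ⁻¹)) fun η => ?_
    refine (hCρ _).trans ?_
    rw [mul_assoc]
    gcongr
    have e : 1 + |η| ≤ (1 + δ⁻¹) * (1 + |δ * η|) := by
      rw [abs_mul, abs_of_pos hδ]
      have : δ⁻¹ * (δ * |η|) = |η| := by field_simp
      have : 0 ≤ δ * |η| := by positivity
      have : 0 < δ⁻¹ := by positivity
      nlinarith
    rw [inv_le_iff_one_le_mul₀ (one_add_abs_pos _), mul_right_comm, ← div_eq_mul_inv,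
      le_div_iff₀ (one_add_abs_pos _), one_mul]
    exact e
  have hF : ∀ δ ∈ Ioo 0 (T / 2),
      ∫ η, D η * hatKernel ρ (δ * η) * hatKernel (intervalCutoff δ (T - δ)) (z - η) = 0 := by
    intro δ hδ
    have hle : δ ≤ T - δ := by linarith [hδ.2]
    have hswap := integral_integral_swap (μ := volume.restrict (Ioc δ (T - δ)))
      (ν := (volume : Measure ℝ)) (f := fun τ η : ℝ => Complex.exp (-Complex.I * z * τ) *
        (D η * (Complex.exp (Complex.I * η * τ) * hatKernel ρ (δ * η)))) (by
        have hb : Integrable (fun p : ℝ × ℝ => (1 : ℂ) * (D p.2 * hatKernel ρ (δ * p.2)))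
            ((volume.restrict (Ioc δ (T - δ))).prod volume) :=
          (integrable_const (1 : ℂ)).mul_prod (hint δ hδ.1)
        refine hb.mono ?_ (ae_of_all _ fun p => ?_)
        · refine (by fun_prop : Continuous fun p : ℝ × ℝ =>
            Complex.exp (-Complex.I * z * p.1)).aestronglyMeasurable.mul (hD.comp_snd.mul ?_)
          exact ((by fun_prop : Continuous fun p : ℝ × ℝ =>
            Complex.exp (Complex.I * p.2 * p.1)).mul
              (hcρ.comp (continuous_const.mul continuous_snd))).aestronglyMeasurable
        · have e1 := norm_exp_neg_I_mul z p.1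
          have e2 : ‖Complex.exp (Complex.I * p.2 * p.1)‖ = 1 := by
            simpa using norm_exp_neg_I_mul (-p.2) p.1
          simp only [Function.uncurry, norm_mul, e1, e2, one_mul, le_refl])
    have hl : ∫ τ in Ioc δ (T - δ), ∫ η, Complex.exp (-Complex.I * z * τ) *
        (D η * (Complex.exp (Complex.I * η * τ) * hatKernel ρ (δ * η))) = 0 := by
      rw [setIntegral_congr_fun (g := fun _ => (0 : ℂ)) measurableSet_Ioc, integral_zero]
      intro τ hτ
      simp only
      rw [integral_const_mul, hzero δ hδ.1 τ ⟨hτ.1.le, hτ.2⟩, mul_zero]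
    rw [hl] at hswap
    rw [hswap]
    refine integral_congr_ae (ae_of_all _ fun η => ?_)
    simp only
    rw [hatKernel_intervalCutoff hle, intervalIntegral.integral_of_le hle, ← integral_const_mul]
    refine integral_congr_ae (ae_of_all _ fun τ => ?_)
    simp only
    have e : Complex.exp (-Complex.I * (z - η : ℝ) * τ) =
        Complex.exp (-Complex.I * z * τ) * Complex.exp (Complex.I * η * τ) := by
      rw [← Complex.exp_add]; congr 1; push_cast; ring
    rw [e]; ring
  have hlim : Tendsto (fun δ : ℝ => ∫ η, D η * hatKernel ρ (δ * η) *
      hatKernel (intervalCutoff δ (T - δ)) (z - η)) (𝓝[>] 0)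
      (𝓝 (∫ η, D η * 1 * hatKernel (intervalCutoff 0 T) (z - η))) := by
    set M := ∫ τ, ‖ρ τ‖
    set B := M * ((2 + T) * (1 + |z|))
    have hM : 0 ≤ M := integral_nonneg fun _ => norm_nonneg _
    have hbi : Integrable fun η => D η * ((B * (1 + |η|)⁻¹ : ℝ) : ℂ) := by
      refine integrable_mul_of_norm_le hσ hD hj (B := B) ?_ fun η => ?_
      · refine (Complex.continuous_ofReal.comp (continuous_const.mul
          (Continuous.inv₀ (by fun_prop) fun η => (one_add_abs_pos η).ne'))).aestronglyMeasurable
      · have := one_add_abs_pos η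
        rw [Complex.norm_real, Real.norm_of_nonneg (by positivity)]
    have hev : ∀ᶠ δ : ℝ in 𝓝[>] 0, δ ∈ Ioo 0 (T / 2) := Ioo_mem_nhdsGT (by linarith)
    refine tendsto_integral_filter_of_dominated_convergence _ ?_ ?_ hbi.norm ?_
    · refine Eventually.of_forall fun δ => ?_
      exact (hD.mul (hcρ.comp (continuous_const.mul continuous_id)).aestronglyMeasurable).mul
        ((continuous_hatKernel (integrable_intervalCutoff _ _)).comp
          (continuous_sub_left z)).aestronglyMeasurable
    · filter_upwards [hev] with δ hδ
      refine ae_of_all _ fun η => ?_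
      have hη := one_add_abs_pos η
      rw [norm_mul, norm_mul, norm_mul, Complex.norm_real, Real.norm_of_nonneg (by positivity),
        mul_assoc]
      gcongr ‖D η‖ * ?_
      have hle : δ ≤ T - δ := by linarith [hδ.2]
      have c := isCutoff_intervalCutoff hle
      have k1 := c.norm_hatKernel_le (z - η)
      have k2 := integral_norm_intervalCutoff_le hle
      have k3 := inv_one_add_abs_sub_le z η
      calc ‖hatKernel ρ (δ * η)‖ * ‖hatKernel (intervalCutoff δ (T - δ)) (z - η)‖
          ≤ M * ((2 + T) * ((1 + |z|) * (1 + |η|)⁻¹)) := by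
            gcongr
            · exact norm_hatKernel_le _ _
            · refine k1.trans ?_
              gcongr
              linarith [hδ.1]
        _ = _ := by simp only [B]; ring
    · refine ae_of_all _ fun η => ?_
      refine (Tendsto.mul tendsto_const_nhds ?_).mul ?_
      · have h0 : hatKernel ρ (0 * η) = 1 := by
          rw [zero_mul, hatKernel]; simpa using hρ1
        rw [← h0]
        exact ((hcρ.comp (continuous_id.mul continuous_const)).tendsto 0).mono_left
          nhdsWithin_le_nhds
      · have hi : ∀ a b : ℝ, IntervalIntegrable
            (fun τ : ℝ => Complex.exp (-Complex.I * (z - η : ℝ) * τ)) volume a b := fun a b =>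
          (by fun_prop : Continuous fun τ : ℝ =>
            Complex.exp (-Complex.I * (z - η : ℝ) * τ)).intervalIntegrable a b
        have hc := intervalIntegral.continuous_primitive hi 0
        have ht : Tendsto (fun δ : ℝ => ∫ τ in δ..(T - δ),
            Complex.exp (-Complex.I * (z - η : ℝ) * τ)) (𝓝 0)
            (𝓝 (∫ τ in (0 : ℝ)..(T - 0), Complex.exp (-Complex.I * (z - η : ℝ) * τ))) := by
          have : Continuous fun δ : ℝ => ∫ τ in δ..(T - δ),
              Complex.exp (-Complex.I * (z - η : ℝ) * τ) := by
            have e : (fun δ : ℝ => ∫ τ in δ..(T - δ),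
                Complex.exp (-Complex.I * (z - η : ℝ) * τ)) = fun δ =>
                (∫ τ in (0 : ℝ)..(T - δ), Complex.exp (-Complex.I * (z - η : ℝ) * τ)) -
                ∫ τ in (0 : ℝ)..δ, Complex.exp (-Complex.I * (z - η : ℝ) * τ) := by
              funext δ
              rw [intervalIntegral.integral_interval_sub_left (hi _ _) (hi _ _)]
            rw [e]
            exact (hc.comp (continuous_sub_left T)).sub hc
          exact this.tendsto 0
        rw [hatKernel_intervalCutoff hT.le]
        rw [sub_zero] at ht
        refine (ht.mono_left nhdsWithin_le_nhds).congr' ?_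
        filter_upwards [hev] with δ hδ
        rw [hatKernel_intervalCutoff (by linarith [hδ.2])]
  have h0 : ∫ η, D η * 1 * hatKernel (intervalCutoff 0 T) (z - η) = 0 := by
    refine tendsto_nhds_unique hlim (tendsto_const_nhds.congr' ?_)
    filter_upwards [Ioo_mem_nhdsGT (show (0 : ℝ) < T / 2 by linarith)] with δ hδ
    exact (hF δ hδ).symm
  simp only [mul_one] at h0
  rw [multiplier, h0, mul_zero]

end Restriction


section Traces

open Filter Topology

theorem jnorm_sub_lt_top {σ : ℝ} {V W : ℝ → ℂ} (hV : AEStronglyMeasurable V)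
    (hW : AEStronglyMeasurable W) (h1 : jnorm σ V < ⊤) (h2 : jnorm σ W < ⊤) :
    jnorm σ (fun η => V η - W η) < ⊤ := by
  have h := jnorm_add_le σ hV (hW.const_mul (-1))
  rw [jnorm_const_mul] at h
  simp only [neg_one_mul, ← sub_eq_add_neg] at h
  exact h.trans_lt (ENNReal.add_lt_top.2 ⟨h1, ENNReal.mul_lt_top (by simp) h2⟩)

theorem multiplier_eq_of_agreeOn {f g : 𝓢'(ℝ, ℂ)} {F G : ℝ → ℂ} (hF : HasFourierFunction f F)
    (hG : HasFourierFunction g G) {σ : ℝ} (hσ : -(1 / 2) < σ) (hjF : jnorm σ F < ⊤)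
    (hjG : jnorm σ G < ⊤) {T : ℝ} (hT : 0 < T) (h : AgreeOn (Ioo 0 T) f g) (z : ℝ) :
    multiplier (intervalCutoff 0 T) F z = multiplier (intervalCutoff 0 T) G z := by
  have hFm := hF.aestronglyMeasurable
  have hGm := hG.aestronglyMeasurable
  have h0 := multiplier_intervalCutoff_eq_zero (hFm.sub hGm) hσ
    (jnorm_sub_lt_top hFm hGm hjF hjG) hT (fun φ hφ hφs => by
      have e := h φ hφ hφs
      obtain ⟨i1, e1⟩ := hF.apply_eq φ
      obtain ⟨i2, e2⟩ := hG.apply_eq φ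
      rw [e1, e2, ← sub_eq_zero, ← integral_sub i1 i2] at e
      rw [← e]
      refine integral_congr_ae (ae_of_all _ fun η => ?_)
      simp only [Pi.sub_apply, smul_eq_mul]
      ring) z
  have hc := isCutoff_intervalCutoff hT.le
  have i1 := hc.integrable_mul hσ hFm hjF z
  have i2 := hc.integrable_mul hσ hGm hjG z
  rw [multiplier] at h0 ⊢
  rw [multiplier, ← sub_eq_zero, ← mul_sub, ← integral_sub i1 i2, ← h0]
  congr 1
  refine integral_congr_ae (ae_of_all _ fun η => ?_)
  simp only [Pi.sub_apply]
  ring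

theorem integral_mul_fourierInv_eq {W : ℝ → ℂ} (hW : Integrable W) (φ : 𝓢(ℝ, ℂ)) :
    ∫ η, W η * (𝓕⁻ φ) η = ∫ t, 𝓕 (fun x => W (-x)) t * φ t := by
  have h2 := VectorFourier.integral_fourierIntegral_smul_eq_flip (μ := (volume : Measure ℝ))
    (ν := (volume : Measure ℝ)) (L := innerₗ ℝ)
    Real.continuous_fourierChar (by exact continuous_inner) hW.comp_neg φ.integrable
  rw [flip_innerₗ] at h2
  have h3 : ∫ t, 𝓕 (fun x => W (-x)) t * φ t = ∫ η, W (-η) * 𝓕 (φ : ℝ → ℂ) η := h2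
  rw [h3, ← integral_neg_eq_self]
  refine integral_congr_ae (ae_of_all _ fun η => ?_)
  simp only
  rw [SchwartzMap.fourierInv_coe, Real.fourierInv_eq_fourier_neg, neg_neg]

theorem integrable_pow_mul_of_jnorm {σ : ℝ} {V : ℝ → ℂ} (hV : AEStronglyMeasurable V)
    (hj : jnorm σ V < ⊤) {k : ℕ} (hk : (k : ℝ) + 1 / 2 < σ) :
    Integrable fun η : ℝ => (η : ℂ) ^ k * V η := by
  have h := integrable_rpow_mul_of_jnorm (σ := σ) (ρ := k) (by linarith) hV hj
  refine h.mono ((by fun_prop : Continuous fun η : ℝ =>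
    (η : ℂ) ^ k).aestronglyMeasurable.mul hV) (ae_of_all _ fun η => ?_)
  rw [norm_mul, norm_mul, norm_pow, Complex.norm_real, Complex.norm_real, Real.rpow_natCast,
    Real.norm_of_nonneg (by positivity : 0 ≤ (1 + |η|) ^ k), Real.norm_eq_abs]
  have := abs_nonneg η
  gcongr
  linarith

/-- If `v ∈ H^μ` with `k < μ - 1/2` has a vanishing `k`-th trace at `0`, then the `k`-th moment of
its Fourier transform vanishes. -/
theorem integral_pow_mul_eq_zero_of_traceZero {v g : 𝓢'(ℝ, ℂ)} {F : ℝ → ℂ}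
    (hF : HasFourierFunction v F) {μ : ℝ} (hj : jnorm μ F < ⊤) {T : ℝ} (hT : 0 < T)
    (hvg : AgreeOn (Ioo 0 T) v g) {k : ℕ} (hk : (k : ℝ) + 1 / 2 < μ) (ht : TraceZero T k g) :
    ∫ η : ℝ, (η : ℂ) ^ k * F η = 0 := by
  obtain ⟨f, hfc, hfg, hf0⟩ := ht
  have hFm := hF.aestronglyMeasurable
  set W : ℝ → ℂ := fun η => F (2 * Real.pi * η) with hW
  have hWk : ∀ n : ℕ, n ≤ k → Integrable fun x : ℝ => (x : ℂ) ^ n * W x := by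
    intro n hn
    have hn' : (n : ℝ) ≤ k := by exact_mod_cast hn
    have h1 := (integrable_pow_mul_of_jnorm hFm hj (k := n) (by linarith)).comp_mul_left'
      two_pi_ne_zero'
    refine (h1.const_mul (((2 * Real.pi : ℝ) : ℂ) ^ n)⁻¹).congr (ae_of_all _ fun x => ?_)
    have : (((2 * Real.pi : ℝ) : ℂ) ^ n) ≠ 0 := by
      have := two_pi_ne_zero'
      exact pow_ne_zero _ (by exact_mod_cast this)
    simp only [hW]
    rw [Complex.ofReal_mul (2 * Real.pi) x, mul_pow]
    field_simp
  have hWi : Integrable W := by simpa using hWk 0 (Nat.zero_le _)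
  set U : ℝ → ℂ := fun x => W (-x) with hU
  have hUk : ∀ n : ℕ, (n : ℕ∞) ≤ (k : ℕ∞) → Integrable fun x : ℝ => x ^ n • U x := by
    intro n hn
    have h1 := (hWk n (by exact_mod_cast hn)).comp_neg
    refine (h1.const_mul ((-1) ^ n)).congr (ae_of_all _ fun x => ?_)
    simp only [hU]
    rw [Complex.real_smul, ← mul_assoc, Complex.ofReal_neg, ← mul_pow]
    simp
  have huc : ContDiff ℝ k (𝓕 U) := Real.contDiff_fourier (N := k) fun n hn => by
    refine (hUk n hn).norm.congr (ae_of_all _ fun x => ?_)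
    simp
  have hae : ∀ᵐ t, t ∈ Ioo 0 T → (𝓕 U - f) t = 0 := by
    refine isOpen_Ioo.ae_eq_zero_of_integral_contDiff_smul_eq_zero
      ((huc.continuous.sub hfc.continuous).locallyIntegrable.locallyIntegrableOn _)
      fun ψ hψ hψs hψsupp => ?_
    obtain ⟨φ, hφ⟩ := exists_schwartzMap_eq_ofReal hψ hψs
    have hφe : (φ : ℝ → ℂ) = fun x => (ψ x : ℂ) := funext hφ
    have hφs : HasCompactSupport φ := by
      rw [hφe]; exact hψs.comp_left (g := Complex.ofReal) Complex.ofReal_zero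
    have hφsupp : tsupport φ ⊆ Ioo 0 T := by
      refine Subset.trans (closure_mono ?_) hψsupp
      intro x hx
      rw [Function.mem_support, hφ] at hx
      exact fun h => hx (by rw [h, Complex.ofReal_zero])
    have e1 := (hvg φ hφs hφsupp).trans (hfg φ hφs hφsupp)
    rw [(hF.apply_eq φ).2] at e1
    have e2 := integral_mul_fourierInv_eq hWi φ
    simp only [smul_eq_mul] at e1
    rw [e2, functional] at e1
    have e3 : ∫ t in Ioo 0 T, f t * φ t = ∫ t, f t * φ t := by
      refine setIntegral_eq_integral_of_forall_compl_eq_zero fun t ht => ?_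
      rw [image_eq_zero_of_notMem_tsupport fun h => ht (hφsupp h), mul_zero]
    rw [e3] at e1
    have i1 : Integrable fun t => 𝓕 U t * φ t :=
      (huc.continuous.mul φ.continuous).integrable_of_hasCompactSupport hφs.mul_left
    have i2 : Integrable fun t => f t * φ t :=
      (hfc.continuous.mul φ.continuous).integrable_of_hasCompactSupport hφs.mul_left
    have e4 := integral_sub i1 i2
    rw [e1, sub_self] at e4
    rw [← e4]
    refine integral_congr_ae (ae_of_all _ fun t => ?_)
    simp only [hφ, Pi.sub_apply, Complex.real_smul]
    ring
  have heq : EqOn (𝓕 U) f (Ioo 0 T) := by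
    refine Measure.eqOn_open_of_ae_eq (μ := volume) ?_ isOpen_Ioo huc.continuous.continuousOn
      hfc.continuous.continuousOn
    rw [Filter.EventuallyEq, ae_restrict_iff' measurableSet_Ioo]
    filter_upwards [hae] with t ht htm
    exact sub_eq_zero.1 (ht htm)
  have hder := (heq.iteratedDeriv_of_isOpen isOpen_Ioo k).closure
    (huc.continuous_iteratedDeriv k le_rfl) (hfc.continuous_iteratedDeriv k le_rfl)
  have h0 := hder (show (0 : ℝ) ∈ closure (Ioo 0 T) by
    rw [closure_Ioo hT.ne]; exact ⟨le_rfl, hT.le⟩)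
  rw [hf0, Real.iteratedDeriv_fourier hUk le_rfl, Real.fourier_eq'] at h0
  simp only [inner_zero_right, mul_zero, Complex.ofReal_zero, zero_mul, Complex.exp_zero, one_smul]
    at h0
  rw [← integral_neg_eq_self] at h0
  have hs := Measure.integral_comp_mul_left (fun η : ℝ => (η : ℂ) ^ k * F η) (2 * Real.pi)
  have e5 : ∫ x : ℝ, (-2 * Real.pi * Complex.I * ((-x : ℝ) : ℂ)) ^ k • U (-x) =
      Complex.I ^ k * ∫ x : ℝ, ((2 * Real.pi * x : ℝ) : ℂ) ^ k * F (2 * Real.pi * x) := by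
    rw [← integral_const_mul]
    refine integral_congr_ae (ae_of_all _ fun x => ?_)
    simp only [hU, hW, neg_neg, smul_eq_mul]
    rw [← mul_assoc, ← mul_pow]
    congr 2
    push_cast; ring
  rw [e5, hs] at h0
  have h1 : Complex.I ^ k ≠ 0 := pow_ne_zero _ Complex.I_ne_zero
  have h2 : |(2 * Real.pi)⁻¹| ≠ 0 := by positivity
  exact (smul_eq_zero.1 ((mul_eq_zero.1 h0).resolve_left h1)).resolve_left h2

end Traces


/-! ### Contour deformation in the sectors -/

section Contour

open Filter Topology

theorem integral_ray_eq_of_decay {f : ℂ → ℂ} (hf : Differentiable ℂ f) {θ₁ θ₂ : ℝ} (hθ : θ₁ ≤ θ₂)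
    {g : ℝ → ℝ} (hb : ∀ r : ℝ, 0 < r → ∀ θ ∈ Icc θ₁ θ₂, ‖f (r * Complex.exp (θ * Complex.I))‖ ≤ g r)
    (hg : IntegrableOn g (Ioi 0)) (hlim : Tendsto (fun r => r * g r) atTop (𝓝 0)) :
    ∫ r in Ioi (0 : ℝ), f (r * Complex.exp (θ₁ * Complex.I)) * Complex.exp (θ₁ * Complex.I) =
      ∫ r in Ioi (0 : ℝ), f (r * Complex.exp (θ₂ * Complex.I)) * Complex.exp (θ₂ * Complex.I) := by
  obtain ⟨F, hF⟩ := hf.isExactOn_univ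
  have hF' : ∀ z, HasDerivAt F (f z) z := fun z => hF z (mem_univ z)
  have hint : ∀ θ ∈ Icc θ₁ θ₂, IntegrableOn (fun r : ℝ =>
      f (r * Complex.exp (θ * Complex.I)) * Complex.exp (θ * Complex.I)) (Ioi 0) := by
    intro θ hθ
    refine Integrable.mono' hg ?_ ?_
    · exact ((hf.continuous.comp (by fun_prop)).mul continuous_const).aestronglyMeasurable
    · filter_upwards [ae_restrict_mem measurableSet_Ioi] with r hr
      rw [norm_mul, Complex.norm_exp_ofReal_mul_I, mul_one]
      exact hb r hr θ hθ
  have hprim : ∀ θ R : ℝ, ∫ r in (0 : ℝ)..R, f (r * Complex.exp (θ * Complex.I)) *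
      Complex.exp (θ * Complex.I) = F (R * Complex.exp (θ * Complex.I)) - F 0 := by
    intro θ R
    have hd : ∀ r ∈ uIcc 0 R, HasDerivAt (fun r : ℝ => F (r * Complex.exp (θ * Complex.I)))
        (f (r * Complex.exp (θ * Complex.I)) * Complex.exp (θ * Complex.I)) r := by
      intro r _
      have h1 : HasDerivAt (fun r : ℝ => (r : ℂ) * Complex.exp (θ * Complex.I))
          (Complex.exp (θ * Complex.I)) r := by
        simpa using (Complex.ofRealCLM.hasDerivAt (x := r)).mul_const (Complex.exp (θ * Complex.I))
      exact (hF' _).comp r h1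
    have hc : Continuous fun r : ℝ => f (r * Complex.exp (θ * Complex.I)) *
        Complex.exp (θ * Complex.I) := (hf.continuous.comp (by fun_prop)).mul continuous_const
    rw [intervalIntegral.integral_eq_sub_of_hasDerivAt hd (hc.intervalIntegrable _ _)]
    simp
  have hm1 : θ₁ ∈ Icc θ₁ θ₂ := ⟨le_rfl, hθ⟩
  have hm2 : θ₂ ∈ Icc θ₁ θ₂ := ⟨hθ, le_rfl⟩
  have t1 := intervalIntegral_tendsto_integral_Ioi 0 (hint θ₁ hm1) tendsto_id
  have t2 := intervalIntegral_tendsto_integral_Ioi 0 (hint θ₂ hm2) tendsto_id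
  simp only [hprim, id] at t1 t2
  have hsub := t2.sub t1
  simp only [sub_sub_sub_cancel_right] at hsub
  have h0 : Tendsto (fun R : ℝ => F (R * Complex.exp (θ₂ * Complex.I)) -
      F (R * Complex.exp (θ₁ * Complex.I))) atTop (𝓝 0) := by
    have hlim' := hlim.mul_const (θ₂ - θ₁)
    rw [zero_mul] at hlim'
    refine squeeze_zero_norm' ?_ hlim'
    filter_upwards [eventually_gt_atTop 0] with R hR
    have hd : ∀ θ ∈ Icc θ₁ θ₂, HasDerivWithinAt (fun θ : ℝ => F (R * Complex.exp (θ * Complex.I)))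
        (f (R * Complex.exp (θ * Complex.I)) * (R * (Complex.exp (θ * Complex.I) * Complex.I)))
        (Icc θ₁ θ₂) θ := by
      intro θ _
      have h1 : HasDerivAt (fun θ : ℝ => (θ : ℂ) * Complex.I) Complex.I θ := by
        simpa using (Complex.ofRealCLM.hasDerivAt (x := θ)).mul_const Complex.I
      exact ((hF' _).comp θ (h1.cexp.const_mul (R : ℂ))).hasDerivWithinAt
    refine norm_image_sub_le_of_norm_deriv_le_segment' hd (fun θ hθ' => ?_) θ₂ hm2
    rw [norm_mul, norm_mul, norm_mul, Complex.norm_I, Complex.norm_exp_ofReal_mul_I, mul_one,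
      mul_one, Complex.norm_real, Real.norm_of_nonneg hR.le, mul_comm]
    gcongr
    exact hb R hR θ ⟨hθ'.1, hθ'.2.le⟩
  exact (sub_eq_zero.1 (tendsto_nhds_unique hsub h0)).symm

theorem integrableOn_pow_mul_exp_neg (k : ℕ) {b : ℝ} (hb : 0 < b) :
    IntegrableOn (fun r : ℝ => r ^ k * Real.exp (-(b * r))) (Ioi 0) := by
  have h := integrableOn_rpow_mul_exp_neg_mul_rpow (s := k) (p := 1) (b := b)
    (by have : (0 : ℝ) ≤ k := k.cast_nonneg
        linarith) one_pos hb
  refine h.congr_fun (fun r hr => ?_) measurableSet_Ioi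
  simp

theorem tendsto_pow_mul_exp_neg (k : ℕ) {b : ℝ} (hb : 0 < b) :
    Tendsto (fun r : ℝ => r ^ k * Real.exp (-(b * r))) atTop (𝓝 0) := by
  have h := (Real.tendsto_pow_mul_exp_neg_atTop_nhds_zero k).comp
    (tendsto_id.const_mul_atTop hb)
  have h2 := h.const_mul ((b ^ k)⁻¹)
  rw [mul_zero] at h2
  refine h2.congr fun r => ?_
  simp only [Function.comp, id]
  rw [mul_pow]
  field_simp

/-- The integrand of the solution formula, without the transform of the datum, at `ξ = r ω`. -/
def rayKernel (m k : ℕ) (ω : ℂ) (x t r : ℝ) : ℂ :=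
  Complex.exp (Complex.I * (r * ω) * x + Complex.I * (r * ω) ^ m * t) * (Complex.I * (r * ω)) ^ k

theorem norm_rayKernel {m k : ℕ} {ω : ℂ} (hω : ‖ω‖ = 1) {ς : ℝ} (hς : ω ^ m = ς) (x t : ℝ) {r : ℝ}
    (hr : 0 ≤ r) : ‖rayKernel m k ω x t r‖ = r ^ k * Real.exp (-(x * ω.im * r)) := by
  rw [rayKernel, norm_mul, norm_pow, norm_mul, norm_mul, Complex.norm_I, hω, Complex.norm_real,
    Real.norm_of_nonneg hr, mul_one, one_mul, mul_comm, Complex.norm_exp, mul_pow, hς]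
  have e : (Complex.I * (r * ω) * x + Complex.I * ((r : ℂ) ^ m * ς) * t).re = -(x * ω.im * r) := by
    have e1 : Complex.I * (r * ω) * x + Complex.I * ((r : ℂ) ^ m * ς) * t =
        ((x * r : ℝ) : ℂ) * (Complex.I * ω) + ((r ^ m * ς * t : ℝ) : ℂ) * Complex.I := by
      push_cast; ring
    rw [e1, Complex.add_re, Complex.re_ofReal_mul, Complex.re_ofReal_mul, Complex.I_mul_re,
      Complex.I_re]
    ring
  rw [e]

theorem continuous_rayKernel (m k : ℕ) (ω : ℂ) (x t : ℝ) : Continuous (rayKernel m k ω x t) := by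
  unfold rayKernel; fun_prop

theorem rayKernel_mul_exp {m k : ℕ} {ω : ℂ} {ς : ℝ} (hς : ω ^ m = ς) (x t r η τ : ℝ) :
    rayKernel m k ω x t r * Complex.exp (-Complex.I * (ς * r ^ m - η : ℝ) * τ) =
      Complex.exp (Complex.I * η * τ) * rayKernel m k ω x (t - τ) r := by
  simp only [rayKernel, mul_pow (r : ℂ) ω m, hς]
  rw [mul_right_comm, ← mul_assoc (Complex.exp (Complex.I * η * τ)), ← Complex.exp_add,
    ← Complex.exp_add]
  congr 2
  push_cast
  ring

theorem integrableOn_rayKernel {m k : ℕ} {ω : ℂ} (hω : ‖ω‖ = 1) (him : 0 < ω.im) {ς : ℝ}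
    (hς : ω ^ m = ς) {x : ℝ} (hx : 0 < x) (t : ℝ) :
    IntegrableOn (rayKernel m k ω x t) (Ioi 0) := by
  refine Integrable.mono' (integrableOn_pow_mul_exp_neg k (mul_pos hx him))
    (continuous_rayKernel m k ω x t).aestronglyMeasurable ?_
  filter_upwards [ae_restrict_mem measurableSet_Ioi] with r hr
  exact (norm_rayKernel hω hς x t (le_of_lt hr)).le

theorem integrableOn_rayKernel_mul_pow {m k : ℕ} {ω : ℂ} (hω : ‖ω‖ = 1) (him : 0 < ω.im) {ς : ℝ}
    (hς : ω ^ m = ς) {x : ℝ} (hx : 0 < x) (t : ℝ) :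
    IntegrableOn (fun r => rayKernel m k ω x t r * ((1 + r ^ m : ℝ) : ℂ)) (Ioi 0) := by
  refine Integrable.mono' ((integrableOn_pow_mul_exp_neg k (mul_pos hx him)).add
    (integrableOn_pow_mul_exp_neg (k + m) (mul_pos hx him)))
    ((continuous_rayKernel m k ω x t).mul (by fun_prop)).aestronglyMeasurable ?_
  filter_upwards [ae_restrict_mem measurableSet_Ioi] with r hr
  have hr0 : 0 < r := hr
  rw [norm_mul, norm_rayKernel hω hς x t hr0.le, Complex.norm_real,
    Real.norm_of_nonneg (by positivity), Pi.add_apply]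
  refine le_of_eq ?_
  ring

theorem integral_rayKernel_mul_multiplier {m k : ℕ} {ω : ℂ} (hω : ‖ω‖ = 1) (him : 0 < ω.im) {ς : ℝ}
    (hς : ω ^ m = ς) (hς1 : |ς| = 1) {x : ℝ} (hx : 0 < x) (t : ℝ) {κ V : ℝ → ℂ} (hκ : Integrable κ)
    {B : ℝ} (hB : ∀ z, ‖hatKernel κ z‖ ≤ B * (1 + |z|)⁻¹) {σ : ℝ} (hσ : -(1 / 2) < σ)
    (hV : AEStronglyMeasurable V) (hj : jnorm σ V < ⊤) :
    ∫ r in Ioi (0 : ℝ), rayKernel m k ω x t r * multiplier κ V (ς * r ^ m) * ω =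
      (1 / (2 * Real.pi) : ℂ) * ∫ η, V η * ∫ τ, κ τ * Complex.exp (Complex.I * η * τ) *
        ∫ r in Ioi (0 : ℝ), rayKernel m k ω x (t - τ) r * ω := by
  have hB0 : 0 ≤ B := by
    have := (norm_nonneg _).trans (hB 0); simpa using this
  have hinner : ∀ η, ∫ r in Ioi (0 : ℝ), rayKernel m k ω x t r * hatKernel κ (ς * r ^ m - η) * ω =
      ∫ τ, κ τ * Complex.exp (Complex.I * η * τ) *
        ∫ r in Ioi (0 : ℝ), rayKernel m k ω x (t - τ) r * ω := by
    intro η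
    have hsw := integral_integral_swap (μ := volume.restrict (Ioi (0 : ℝ))) (ν := volume)
      (f := fun r τ : ℝ => rayKernel m k ω x t r *
        (κ τ * Complex.exp (-Complex.I * (ς * r ^ m - η : ℝ) * τ)) * ω) (by
        have hb := ((integrableOn_rayKernel (k := k) hω him hς hx t).mul_prod hκ)
        refine hb.mono ?_ (ae_of_all _ fun p => ?_)
        · exact (((continuous_rayKernel m k ω x t).comp continuous_fst).aestronglyMeasurable.mul
            (hκ.1.comp_snd.mul (by fun_prop : Continuous fun p : ℝ × ℝ =>
              Complex.exp (-Complex.I * (ς * p.1 ^ m - η : ℝ) * p.2)).aestronglyMeasurable)).mul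
                aestronglyMeasurable_const
        · simp only [Function.uncurry, norm_mul, norm_exp_neg_I_mul, hω, mul_one, le_refl])
    have e1 : ∀ r : ℝ, rayKernel m k ω x t r * hatKernel κ (ς * r ^ m - η) * ω =
        ∫ τ, rayKernel m k ω x t r *
        (κ τ * Complex.exp (-Complex.I * (ς * r ^ m - η : ℝ) * τ)) * ω := by
      intro r
      rw [hatKernel, integral_mul_const, integral_const_mul]
    simp only [e1]
    rw [hsw]
    refine integral_congr_ae (ae_of_all _ fun τ => ?_)
    simp only
    rw [← integral_const_mul]
    refine integral_congr_ae (ae_of_all _ fun r => ?_)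
    have := rayKernel_mul_exp (k := k) hς x t r η τ
    simp only
    linear_combination (κ τ * ω) * this
  have hsw := integral_integral_swap (μ := volume.restrict (Ioi (0 : ℝ))) (ν := volume)
    (f := fun r η : ℝ => rayKernel m k ω x t r *
      (V η * hatKernel κ (ς * r ^ m - η)) * ω) (by
      have hb := ((integrableOn_rayKernel_mul_pow (k := k) hω him hς hx t).mul_prod
        ((integrable_rpow_mul_of_jnorm (σ := σ) (ρ := -1) (by linarith) hV hj).const_mul (B : ℂ)))
      refine hb.mono ?_ ?_
      · exact (((continuous_rayKernel m k ω x t).comp continuous_fst).aestronglyMeasurable.mul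
          (hV.comp_snd.mul ((continuous_hatKernel hκ).comp (by fun_prop : Continuous
            fun p : ℝ × ℝ => ς * p.1 ^ m - p.2)).aestronglyMeasurable)).mul
              aestronglyMeasurable_const
      · have hpos : ∀ᵐ p : ℝ × ℝ ∂((volume.restrict (Ioi (0 : ℝ))).prod volume), 0 < p.1 :=
          Measure.quasiMeasurePreserving_fst.ae (ae_restrict_mem measurableSet_Ioi)
        filter_upwards [hpos] with p hp
        have hη := one_add_abs_pos p.2
        simp only [Function.uncurry, norm_mul, hω, mul_one, Complex.norm_real, Real.rpow_neg_one,
          Real.norm_of_nonneg hB0]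
        rw [Real.norm_of_nonneg (by positivity : (0 : ℝ) ≤ 1 + p.1 ^ m),
          Real.norm_of_nonneg (by positivity : (0 : ℝ) ≤ (1 + |p.2|)⁻¹), mul_assoc]
        gcongr ‖rayKernel m k ω x t p.1‖ * ?_
        have h1 := hB (ς * p.1 ^ m - p.2)
        have h2 := inv_one_add_abs_sub_le (ς * p.1 ^ m) p.2
        rw [abs_mul, hς1, one_mul, abs_of_pos (pow_pos hp m)] at h2
        calc ‖V p.2‖ * ‖hatKernel κ (ς * p.1 ^ m - p.2)‖
            ≤ ‖V p.2‖ * (B * ((1 + p.1 ^ m) * (1 + |p.2|)⁻¹)) := by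
              gcongr
              exact h1.trans (by gcongr)
          _ = _ := by ring)
  have e2 : ∀ r : ℝ, rayKernel m k ω x t r * multiplier κ V (ς * r ^ m) * ω =
      (1 / (2 * Real.pi) : ℂ) * ∫ η, rayKernel m k ω x t r *
        (V η * hatKernel κ (ς * r ^ m - η)) * ω := by
    intro r
    rw [multiplier, integral_mul_const, integral_const_mul]
    ring
  simp only [e2]
  rw [integral_const_mul, hsw]
  congr 1
  refine integral_congr_ae (ae_of_all _ fun η => ?_)
  simp only
  rw [← hinner, ← integral_const_mul]
  refine integral_congr_ae (ae_of_all _ fun r => ?_)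
  simp only
  ring

theorem rightDir_eq (j p : ℕ) :
    rightDir j p = Complex.exp (((2 * p - 1) * Real.pi / (2 * j + 1) : ℝ) * Complex.I) := by
  rw [rightDir, mul_comm]; push_cast; rfl

theorem leftDir_eq (j p : ℕ) :
    leftDir j p = Complex.exp ((2 * p * Real.pi / (2 * j + 1) : ℝ) * Complex.I) := by
  rw [leftDir, mul_comm]; push_cast; rfl

theorem norm_rightDir (j p : ℕ) : ‖rightDir j p‖ = 1 := by
  rw [rightDir_eq, Complex.norm_exp_ofReal_mul_I]

theorem norm_leftDir (j p : ℕ) : ‖leftDir j p‖ = 1 := by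
  rw [leftDir_eq, Complex.norm_exp_ofReal_mul_I]

theorem rightDir_pow (j p : ℕ) : rightDir j p ^ (2 * j + 1) = ((-1 : ℝ) : ℂ) := by
  rw [rightDir, ← Complex.exp_nat_mul]
  have h : (2 * j + 1 : ℂ) ≠ 0 := by exact_mod_cast (2 * j).succ_ne_zero
  have e : ((2 * j + 1 : ℕ) : ℂ) * (Complex.I * ((2 * p - 1) * Real.pi / (2 * j + 1))) =
      p * (2 * Real.pi * Complex.I) - Real.pi * Complex.I := by
    push_cast; field_simp
  rw [e, Complex.exp_sub, Complex.exp_nat_mul_two_pi_mul_I, Complex.exp_pi_mul_I]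
  norm_num

theorem leftDir_pow (j p : ℕ) : leftDir j p ^ (2 * j + 1) = ((1 : ℝ) : ℂ) := by
  rw [leftDir, ← Complex.exp_nat_mul]
  have h : (2 * j + 1 : ℂ) ≠ 0 := by exact_mod_cast (2 * j).succ_ne_zero
  have e : ((2 * j + 1 : ℕ) : ℂ) * (Complex.I * (2 * p * Real.pi / (2 * j + 1))) =
      p * (2 * Real.pi * Complex.I) := by
    push_cast; field_simp
  rw [e, Complex.exp_nat_mul_two_pi_mul_I]
  norm_num

theorem angle_bounds {j p : ℕ} (hp : 1 ≤ p) (hpj : p ≤ j) :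
    0 < (2 * p - 1) * Real.pi / (2 * j + 1) ∧
    (2 * p - 1) * Real.pi / (2 * j + 1) ≤ 2 * p * Real.pi / (2 * j + 1) ∧
    2 * p * Real.pi / (2 * j + 1) < Real.pi := by
  have h1 : (1 : ℝ) ≤ p := by exact_mod_cast hp
  have h2 : (p : ℝ) ≤ j := by exact_mod_cast hpj
  have hπ := Real.pi_pos
  refine ⟨?_, ?_, ?_⟩
  · have : (0 : ℝ) < 2 * p - 1 := by linarith
    positivity
  · gcongr; linarith
  · rw [div_lt_iff₀ (by positivity), mul_comm Real.pi]
    gcongr; linarith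

theorem rightDir_im_pos {j p : ℕ} (hp : 1 ≤ p) (hpj : p ≤ j) : 0 < (rightDir j p).im := by
  obtain ⟨h1, h2, h3⟩ := angle_bounds hp hpj
  rw [rightDir_eq, Complex.exp_ofReal_mul_I_im]
  exact Real.sin_pos_of_pos_of_lt_pi h1 (h2.trans_lt h3)

theorem leftDir_im_pos {j p : ℕ} (hp : 1 ≤ p) (hpj : p ≤ j) : 0 < (leftDir j p).im := by
  obtain ⟨h1, h2, h3⟩ := angle_bounds hp hpj
  rw [leftDir_eq, Complex.exp_ofReal_mul_I_im]
  exact Real.sin_pos_of_pos_of_lt_pi (h1.trans_le h2) h3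

theorem integral_rayKernel_rightDir_eq_leftDir {j p : ℕ} (hp : 1 ≤ p) (hpj : p ≤ j) (k : ℕ) {x : ℝ}
    (hx : 0 < x) {A : ℝ} (hA : A ≤ 0) :
    ∫ r in Ioi (0 : ℝ), rayKernel (2 * j + 1) k (rightDir j p) x A r * rightDir j p =
      ∫ r in Ioi (0 : ℝ), rayKernel (2 * j + 1) k (leftDir j p) x A r * leftDir j p := by
  obtain ⟨h1, h2, h3⟩ := angle_bounds hp hpj
  set θ₁ : ℝ := (2 * p - 1) * Real.pi / (2 * j + 1)
  set θ₂ : ℝ := 2 * p * Real.pi / (2 * j + 1)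
  set c := min (Real.sin θ₁) (Real.sin θ₂)
  have hc : 0 < c := lt_min (Real.sin_pos_of_pos_of_lt_pi h1 (h2.trans_lt h3))
    (Real.sin_pos_of_pos_of_lt_pi (h1.trans_le h2) h3)
  have hj : (0 : ℝ) < 2 * j + 1 := by positivity
  rw [rightDir_eq, leftDir_eq]
  refine integral_ray_eq_of_decay (f := fun ξ : ℂ => Complex.exp (Complex.I * ξ * x +
      Complex.I * ξ ^ (2 * j + 1) * A) * (Complex.I * ξ) ^ k)
    (g := fun r => r ^ k * Real.exp (-(x * c * r))) (by fun_prop) h2 (fun r hr θ hθ => ?_)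
    (integrableOn_pow_mul_exp_neg k (mul_pos hx hc)) ?_
  · have hs : c ≤ Real.sin θ := by
      have := strictConcaveOn_sin_Icc.concaveOn.min_le_of_mem_Icc
        (x := θ₁) (y := θ₂) (z := θ) ⟨h1.le, h2.trans h3.le⟩ ⟨h1.le.trans h2, h3.le⟩ hθ
      exact this
    have hms : Real.sin ((2 * j + 1) * θ) ≤ 0 := by
      have e : Real.sin ((2 * j + 1) * θ) =
          Real.sin ((2 * j + 1) * θ - p * (2 * Real.pi)) := (Real.sin_sub_nat_mul_two_pi _ _).symm
      rw [e]
      have e1 : (2 * j + 1) * θ₁ = (2 * p - 1) * Real.pi := by simp only [θ₁]; field_simp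
      have e2 : (2 * j + 1) * θ₂ = 2 * p * Real.pi := by simp only [θ₂]; field_simp
      have l1 := mul_le_mul_of_nonneg_left hθ.1 hj.le
      have l2 := mul_le_mul_of_nonneg_left hθ.2 hj.le
      exact Real.sin_nonpos_of_nonpos_of_neg_pi_le (by linarith) (by linarith)
    rw [norm_mul, norm_pow, norm_mul, norm_mul, Complex.norm_I, Complex.norm_exp_ofReal_mul_I,
      Complex.norm_real, Real.norm_of_nonneg hr.le, mul_one, one_mul, mul_comm, Complex.norm_exp]
    gcongr
    have e3 : ((r : ℂ) * Complex.exp (θ * Complex.I)) ^ (2 * j + 1) =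
        ((r ^ (2 * j + 1) : ℝ) : ℂ) * Complex.exp (((2 * j + 1) * θ : ℝ) * Complex.I) := by
      rw [mul_pow, ← Complex.exp_nat_mul]
      push_cast
      ring_nf
    rw [e3]
    have e4 : (Complex.I * (r * Complex.exp (θ * Complex.I)) * x + Complex.I *
        (((r ^ (2 * j + 1) : ℝ) : ℂ) * Complex.exp (((2 * j + 1) * θ : ℝ) * Complex.I)) * A).re =
        -(r * Real.sin θ * x) - r ^ (2 * j + 1) * Real.sin ((2 * j + 1) * θ) * A := by
      simp only [Complex.add_re, Complex.re_mul_ofReal, Complex.I_mul_re, Complex.im_ofReal_mul,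
        Complex.exp_ofReal_mul_I_im]
      ring
    rw [e4]
    have h5 : 0 ≤ r ^ (2 * j + 1) * Real.sin ((2 * j + 1) * θ) * A :=
      mul_nonneg_of_nonpos_of_nonpos (mul_nonpos_of_nonneg_of_nonpos (by positivity) hms) hA
    have h6 : x * c * r ≤ r * Real.sin θ * x := by
      calc x * c * r = r * c * x := by ring
        _ ≤ _ := by gcongr
    linarith
  · refine (tendsto_pow_mul_exp_neg (k + 1) (mul_pos hx hc)).congr fun r => ?_
    ring

/-- The part of the datum after time `T ≥ t` does not contribute to the solution formula. -/
theorem integral_rayKernel_mul_multiplier_rightDir_eq_leftDir {j p : ℕ} (hp : 1 ≤ p) (hpj : p ≤ j)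
    (k : ℕ) {x t T : ℝ} (hx : 0 < x) (ht : t ≤ T) {κ V : ℝ → ℂ} (hκ : Integrable κ)
    (hκT : ∀ τ ≤ T, κ τ = 0)
    {B : ℝ} (hB : ∀ z, ‖hatKernel κ z‖ ≤ B * (1 + |z|)⁻¹) {σ : ℝ} (hσ : -(1 / 2) < σ)
    (hV : AEStronglyMeasurable V) (hj : jnorm σ V < ⊤) :
    ∫ r in Ioi (0 : ℝ), rayKernel (2 * j + 1) k (rightDir j p) x t r *
        multiplier κ V (-1 * r ^ (2 * j + 1)) * rightDir j p =
      ∫ r in Ioi (0 : ℝ), rayKernel (2 * j + 1) k (leftDir j p) x t r *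
        multiplier κ V (1 * r ^ (2 * j + 1)) * leftDir j p := by
  rw [integral_rayKernel_mul_multiplier (norm_rightDir j p) (rightDir_im_pos hp hpj)
      (rightDir_pow j p) (by norm_num) hx t hκ hB hσ hV hj,
    integral_rayKernel_mul_multiplier (norm_leftDir j p) (leftDir_im_pos hp hpj)
      (leftDir_pow j p) (by norm_num) hx t hκ hB hσ hV hj]
  congr 2
  funext η
  congr 2
  funext τ
  rcases le_or_gt τ T with h | h
  · rw [hκT τ h, zero_mul, zero_mul, zero_mul]
  · rw [integral_rayKernel_rightDir_eq_leftDir hp hpj k hx (by linarith)]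

end Contour


/-! ### The solution formula along the rays -/

section Rays

theorem stronglyMeasurable_multiplier {κ V : ℝ → ℂ} (hκ : Integrable κ)
    (hV : AEStronglyMeasurable V) : StronglyMeasurable (multiplier κ V) := by
  have e : multiplier κ V = multiplier κ (hV.mk V) := by
    funext z
    rw [multiplier, multiplier]
    congr 1
    refine integral_congr_ae ?_
    filter_upwards [hV.ae_eq_mk] with η hη
    rw [hη]
  rw [e]
  refine StronglyMeasurable.const_mul ?_ _
  refine StronglyMeasurable.integral_prod_right' (f := fun p : ℝ × ℝ =>
    hV.mk V p.2 * hatKernel κ (p.1 - p.2)) ?_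
  exact (hV.stronglyMeasurable_mk.comp_measurable measurable_snd).mul
    ((continuous_hatKernel hκ).comp (continuous_fst.sub continuous_snd)).stronglyMeasurable

theorem enorm_multiplier_le {κ V : ℝ → ℂ} {B : ℝ} (hB0 : 0 ≤ B)
    (hB : ∀ z, ‖hatKernel κ z‖ ≤ B * (1 + |z|)⁻¹)
    (σ : ℝ) (hV : AEStronglyMeasurable V) (z : ℝ) :
    ‖multiplier κ V z‖ₑ ≤
      ENNReal.ofReal (B * (1 + |z|)) * (embeddingConst (σ + 1) * jnorm σ V) := by
  have hπ : ‖(1 / (2 * Real.pi) : ℂ)‖ₑ ≤ 1 := by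
    rw [show (1 / (2 * Real.pi) : ℂ) = ((1 / (2 * Real.pi) : ℝ) : ℂ) by push_cast; rfl,
      ← ofReal_norm, Complex.norm_real, Real.norm_of_nonneg (by positivity), ENNReal.ofReal_le_one,
      div_le_one (by positivity)]
    linarith [Real.pi_gt_three]
  have h := lintegral_enorm_le_jnorm (σ := σ) (-1) hV
  rw [sub_neg_eq_add] at h
  rw [multiplier, enorm_mul]
  calc _ ≤ 1 * ∫⁻ η, ‖V η * hatKernel κ (z - η)‖ₑ := mul_le_mul' hπ (enorm_integral_le_lintegral_enorm _)
    _ ≤ ∫⁻ η, ENNReal.ofReal (B * (1 + |z|)) * (ENNReal.ofReal ((1 + |η|) ^ (-1 : ℝ)) * ‖V η‖ₑ) := by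
      rw [one_mul]
      refine lintegral_mono fun η => ?_
      rw [← mul_assoc, ← ENNReal.ofReal_mul (mul_nonneg hB0 (one_add_abs_pos z).le), enorm_mul, mul_comm]
      gcongr
      rw [← ofReal_norm]
      refine ENNReal.ofReal_le_ofReal ((hB _).trans ?_)
      rw [mul_assoc, Real.rpow_neg_one]
      gcongr
      exact inv_one_add_abs_sub_le z η
    _ = ENNReal.ofReal (B * (1 + |z|)) * ∫⁻ η, ENNReal.ofReal ((1 + |η|) ^ (-1 : ℝ)) * ‖V η‖ₑ :=
      lintegral_const_mul' _ _ ENNReal.ofReal_ne_top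
    _ ≤ _ := by gcongr

theorem norm_multiplier_le {κ V : ℝ → ℂ} {B : ℝ} (hB0 : 0 ≤ B)
    (hB : ∀ z, ‖hatKernel κ z‖ ≤ B * (1 + |z|)⁻¹)
    {σ : ℝ} (hσ : -(1 / 2) < σ) (hV : AEStronglyMeasurable V) (hj : jnorm σ V < ⊤) (z : ℝ) :
    ‖multiplier κ V z‖ ≤ B * (embeddingConst (σ + 1) * jnorm σ V).toReal * (1 + |z|) := by
  have hfin : embeddingConst (σ + 1) * jnorm σ V ≠ ⊤ :=
    (ENNReal.mul_lt_top (embeddingConst_lt_top (by linarith)) hj).ne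
  have h := ENNReal.toReal_mono (ENNReal.mul_ne_top ENNReal.ofReal_ne_top hfin)
    (enorm_multiplier_le hB0 hB σ hV z)
  rw [ENNReal.toReal_mul, ENNReal.toReal_ofReal (mul_nonneg hB0 (one_add_abs_pos z).le),
    toReal_enorm] at h
  linarith

/-- The contribution of one ray to the solution formula. -/
def rayIntegral (m k : ℕ) (ω : ℂ) (ς : ℝ) (H : ℝ → ℂ) (x t : ℝ) : ℂ :=
  ∫ r in Ioi (0 : ℝ), rayKernel m k ω x t r * H (ς * r ^ m) * ω

theorem integrableOn_rayKernel_mul {m k : ℕ} {ω : ℂ} (hω : ‖ω‖ = 1) (him : 0 < ω.im) {ς : ℝ}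
    (hς : ω ^ m = ς) (hς1 : |ς| = 1) {x : ℝ} (hx : 0 < x) (t : ℝ) {H : ℝ → ℂ}
    (hH : StronglyMeasurable H) {B : ℝ} (hB : ∀ z, ‖H z‖ ≤ B * (1 + |z|)) :
    IntegrableOn (fun r => rayKernel m k ω x t r * H (ς * r ^ m) * ω) (Ioi 0) := by
  refine Integrable.mono ((integrableOn_rayKernel_mul_pow (k := k) hω him hς hx t).const_mul (B : ℂ))
    ?_ ?_
  · exact (((continuous_rayKernel m k ω x t).stronglyMeasurable.mul
      (hH.comp_measurable (by fun_prop))).mul stronglyMeasurable_const).aestronglyMeasurable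
  · filter_upwards [ae_restrict_mem measurableSet_Ioi] with r hr
    have hr0 : 0 < r := hr
    have hB0 : 0 ≤ B := by have := (norm_nonneg _).trans (hB 0); simpa using this
    have h := hB (ς * r ^ m)
    rw [abs_mul, hς1, one_mul, abs_of_pos (pow_pos hr0 m)] at h
    rw [norm_mul, norm_mul, hω, mul_one, norm_mul, norm_mul, Complex.norm_real, Complex.norm_real,
      Real.norm_of_nonneg hB0, Real.norm_of_nonneg (by positivity : (0 : ℝ) ≤ 1 + r ^ m),
      mul_left_comm]
    gcongr

theorem hatKernel_add {κ κ' : ℝ → ℂ} (h : Integrable κ) (h' : Integrable κ') (z : ℝ) :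
    hatKernel (κ + κ') z = hatKernel κ z + hatKernel κ' z := by
  have i1 := integrable_mul_exp (s := univ) h.integrableOn z
  have i2 := integrable_mul_exp (s := univ) h'.integrableOn z
  rw [integrableOn_univ] at i1 i2
  rw [hatKernel, hatKernel, hatKernel, ← integral_add i1 i2]
  simp only [Pi.add_apply, add_mul]

theorem IsCutoff.sub {A A' : ℝ} {κ κ' : ℝ → ℂ} (h : IsCutoff A κ) (h' : IsCutoff A' κ') :
    IsCutoff (A + A') (κ - κ') where
  integrable := h.integrable.sub h'.integrable
  bound τ := (norm_sub_le _ _).trans (add_le_add (h.bound τ) (h'.bound τ))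
  decay z := by
    have e : hatKernel κ z = hatKernel (κ - κ') z + hatKernel κ' z := by
      rw [← hatKernel_add (h.integrable.sub h'.integrable) h'.integrable, sub_add_cancel]
    rw [eq_sub_of_add_eq e.symm]
    calc _ ≤ |z| * (‖hatKernel κ z‖ + ‖hatKernel κ' z‖) := by gcongr; exact norm_sub_le _ _
      _ ≤ _ := by rw [mul_add]; exact add_le_add (h.decay z) (h'.decay z)

theorem multiplier_add {A A' : ℝ} {κ κ' V : ℝ → ℂ} (h : IsCutoff A κ) (h' : IsCutoff A' κ') {σ : ℝ}
    (hσ : -(1 / 2) < σ) (hV : AEStronglyMeasurable V) (hj : jnorm σ V < ⊤) (z : ℝ) :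
    multiplier (κ + κ') V z = multiplier κ V z + multiplier κ' V z := by
  rw [multiplier, multiplier, multiplier, ← mul_add,
    ← integral_add (h.integrable_mul hσ hV hj z) (h'.integrable_mul hσ hV hj z)]
  simp only [hatKernel_add h.integrable h'.integrable, mul_add]

theorem exists_norm_multiplier_le {A : ℝ} {κ V : ℝ → ℂ} (h : IsCutoff A κ) {σ : ℝ}
    (hσ : -(1 / 2) < σ) (hV : AEStronglyMeasurable V) (hj : jnorm σ V < ⊤) :
    ∃ B, ∀ z, ‖multiplier κ V z‖ ≤ B * (1 + |z|) :=
  ⟨_, norm_multiplier_le (add_nonneg h.nonneg (integral_nonneg fun _ => norm_nonneg _))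
    h.norm_hatKernel_le hσ hV hj⟩

theorem rayIntegral_sub_eq_halfCutoff {j p : ℕ} (hp : 1 ≤ p) (hpj : p ≤ j) (k : ℕ) {x t T S : ℝ}
    (hx : 0 < x) (ht : t ≤ T) (hT : 0 < T) (hTS : T ≤ S) {a : 𝓢(ℝ, ℂ)}
    (ha : ∀ y ∈ Icc (0 : ℝ) 1, a y = 1) {V : ℝ → ℂ} {σ : ℝ} (hσ : -(1 / 2) < σ)
    (hV : AEStronglyMeasurable V) (hj : jnorm σ V < ⊤) :
    rayIntegral (2 * j + 1) k (rightDir j p) (-1) (multiplier (intervalCutoff 0 T) V) x t -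
      rayIntegral (2 * j + 1) k (leftDir j p) 1 (multiplier (intervalCutoff 0 T) V) x t =
    rayIntegral (2 * j + 1) k (rightDir j p) (-1) (multiplier (halfCutoff a S) V) x t -
      rayIntegral (2 * j + 1) k (leftDir j p) 1 (multiplier (halfCutoff a S) V) x t := by
  have hS : 0 < S := hT.trans_le hTS
  obtain ⟨A, hA⟩ := exists_isCutoff_halfCutoff a
  have c1 := isCutoff_intervalCutoff hT.le
  have c2 := (hA S hS).sub c1
  set κ := halfCutoff a S - intervalCutoff 0 T with hκ
  have e : ∀ z, multiplier (halfCutoff a S) V z =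
      multiplier (intervalCutoff 0 T) V z + multiplier κ V z := fun z => by
    rw [← multiplier_add c1 c2 hσ hV hj, hκ, add_sub_cancel]
  have hκT : ∀ τ ≤ T, κ τ = 0 := by
    intro τ hτ
    rw [hκ, Pi.sub_apply, halfCutoff, intervalCutoff]
    rcases le_or_gt τ 0 with h | h
    · rw [indicator_of_notMem (by simpa using h), indicator_of_notMem (by simp [h]), sub_zero]
    · rw [indicator_of_mem (mem_Ioi.2 h), indicator_of_mem (mem_Ioc.2 ⟨h, hτ⟩), ha, sub_self]
      exact ⟨by positivity, (div_le_one hS).2 (hτ.trans hTS)⟩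
  obtain ⟨B1, hB1⟩ := exists_norm_multiplier_le c1 hσ hV hj
  obtain ⟨B2, hB2⟩ := exists_norm_multiplier_le c2 hσ hV hj
  have m1 := stronglyMeasurable_multiplier c1.integrable hV
  have m2 := stronglyMeasurable_multiplier c2.integrable hV
  have key : rayIntegral (2 * j + 1) k (rightDir j p) (-1) (multiplier κ V) x t =
      rayIntegral (2 * j + 1) k (leftDir j p) 1 (multiplier κ V) x t :=
    integral_rayKernel_mul_multiplier_rightDir_eq_leftDir hp hpj k hx ht c2.integrable hκT
    c2.norm_hatKernel_le hσ hV hj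
  have split : ∀ {ω : ℂ} {ς : ℝ}, ‖ω‖ = 1 → 0 < ω.im → ω ^ (2 * j + 1) = ς → |ς| = 1 →
      rayIntegral (2 * j + 1) k ω ς (multiplier (halfCutoff a S) V) x t =
      rayIntegral (2 * j + 1) k ω ς (multiplier (intervalCutoff 0 T) V) x t +
      rayIntegral (2 * j + 1) k ω ς (multiplier κ V) x t := by
    intro ω ς hω him hς hς1
    rw [rayIntegral, rayIntegral, rayIntegral,
      ← integral_add (integrableOn_rayKernel_mul hω him hς hς1 hx t m1 hB1)
        (integrableOn_rayKernel_mul hω him hς hς1 hx t m2 hB2)]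
    simp only [e, mul_add, add_mul]
  rw [split (norm_rightDir j p) (rightDir_im_pos hp hpj) (rightDir_pow j p) (by norm_num),
    split (norm_leftDir j p) (leftDir_im_pos hp hpj) (leftDir_pow j p) (by norm_num),
    key]
  ring

theorem pureSolution_eq {j : ℕ} {T : ℝ} (hT : 0 < T) {g v : Fin j → 𝓢'(ℝ, ℂ)}
    {G V : Fin j → ℝ → ℂ} {μ : Fin j → ℝ} (hμ : ∀ ℓ, -(1 / 2) < μ ℓ)
    (hG : ∀ ℓ, HasFourierFunction (g ℓ) (G ℓ)) (hV : ∀ ℓ, HasFourierFunction (v ℓ) (V ℓ))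
    (hjG : ∀ ℓ, jnorm (μ ℓ) (G ℓ) < ⊤) (hjV : ∀ ℓ, jnorm (μ ℓ) (V ℓ) < ⊤)
    (hvg : ∀ ℓ, AgreeOn (Ioo 0 T) (v ℓ) (g ℓ)) (x t : ℝ) :
    pureSolution j T g x t = ∑ p : Fin j, ∑ ℓ : Fin j, fokasConst j p ℓ *
      (rayIntegral (2 * j + 1) (2 * j - ℓ) (rightDir j (p + 1)) (-1)
          (multiplier (intervalCutoff 0 T) (V ℓ)) x t -
        rayIntegral (2 * j + 1) (2 * j - ℓ) (leftDir j (p + 1)) 1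
          (multiplier (intervalCutoff 0 T) (V ℓ)) x t) := by
  have hH : ∀ ℓ (z : ℝ), timeTransform (g ℓ) T z = multiplier (intervalCutoff 0 T) (V ℓ) z := by
    intro ℓ z
    rw [timeTransform_ofReal _ hT.le, multiplier_eq_of_agreeOn (hV ℓ) (hG ℓ) (hμ ℓ) (hjV ℓ) (hjG ℓ)
      hT (hvg ℓ), multiplier, multiplier]
    congr 1
    refine integral_congr_ae ?_
    filter_upwards [(hG ℓ).fourierFunction.ae_unique (hG ℓ)] with η hη
    rw [hη]
  have hray : ∀ (ω : ℂ) (ς r : ℝ), ω ^ (2 * j + 1) = ς →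
      ((r : ℂ) * ω) ^ (2 * j + 1) = ((ς * r ^ (2 * j + 1) : ℝ) : ℂ) := by
    intro ω ς r h
    rw [mul_pow, h]; push_cast; ring
  rw [pureSolution]
  refine Finset.sum_congr rfl fun p _ => Finset.sum_congr rfl fun ℓ _ => ?_
  rw [sectorIntegral, rayIntegral, rayIntegral]
  simp only [hray _ _ _ (rightDir_pow j (p + 1)), hray _ _ _ (leftDir_pow j (p + 1)), hH, rayKernel]

end Rays


/-! ### Schwartz extensions of decaying exponentials -/

section HalfExponential

open Filter Topology

theorem abs_pow_mul_exp_neg_le (k : ℕ) {c y : ℝ} (hc : 0 < c) (hy : -1 ≤ y) :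
    |y| ^ k * Real.exp (-(c * y)) ≤ Real.exp c + (k.factorial : ℝ) / c ^ k := by
  rcases le_or_gt y 0 with h | h
  · have h1 : |y| ^ k ≤ 1 := pow_le_one₀ (abs_nonneg y) (abs_le.2 ⟨hy, by linarith⟩)
    have h2 : Real.exp (-(c * y)) ≤ Real.exp c := Real.exp_le_exp.2 (by nlinarith)
    have h3 : 0 ≤ (k.factorial : ℝ) / c ^ k := by positivity
    nlinarith [Real.exp_pos (-(c * y))]
  · have h1 := Real.pow_div_factorial_le_exp (c * y) (by positivity) k
    have hf : (0 : ℝ) < k.factorial := by exact_mod_cast k.factorial_pos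
    rw [div_le_iff₀ hf, mul_pow] at h1
    refine le_add_of_nonneg_of_le (Real.exp_pos c).le ?_
    rw [abs_of_pos h, le_div_iff₀ (by positivity), Real.exp_neg, mul_right_comm,
      ← div_eq_mul_inv, div_le_iff₀ (Real.exp_pos _)]
    linarith

theorem iteratedDeriv_cexp_mul_ofReal (c : ℂ) (n : ℕ) :
    iteratedDeriv n (fun y : ℝ => Complex.exp (c * y)) = fun y : ℝ => c ^ n * Complex.exp (c * y) := by
  induction n with
  | zero => simp
  | succ n ih =>
    rw [iteratedDeriv_succ, ih]
    funext y
    have h1 : HasDerivAt (fun y : ℝ => c * (y : ℂ)) c y := by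
      simpa using (Complex.ofRealCLM.hasDerivAt (x := y)).const_mul c
    rw [(h1.cexp.const_mul (c ^ n)).deriv]
    ring

theorem exists_norm_iteratedFDeriv_le_of_eventually_const {f : ℝ → ℂ} (hf : ContDiff ℝ (⊤ : ℕ∞) f) {R : ℝ}
    {a b : ℂ} (ha : ∀ y, R < y → f y = a) (hb : ∀ y, y < -R → f y = b) (n : ℕ) :
    ∃ C, ∀ y, ‖iteratedFDeriv ℝ n f y‖ ≤ C := by
  have hc : Continuous fun y => ‖iteratedFDeriv ℝ n f y‖ :=
    (hf.continuous_iteratedFDeriv (by exact_mod_cast le_top)).norm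
  obtain ⟨C, hC⟩ := (isCompact_Icc (a := -R) (b := R)).exists_bound_of_continuousOn hc.continuousOn
  have hconst : ∀ (d : ℂ) (y : ℝ), ‖iteratedFDeriv ℝ n (fun _ : ℝ => d) y‖ ≤ ‖d‖ := by
    intro d y
    rcases Nat.eq_zero_or_pos n with rfl | hn
    · simp
    · rw [iteratedFDeriv_const_of_ne hn.ne']; simp
  refine ⟨max C (max ‖a‖ ‖b‖), fun y => ?_⟩
  by_cases h1 : R < y
  · have e : f =ᶠ[𝓝 y] fun _ => a := by
      filter_upwards [lt_mem_nhds h1] with z hz using ha z hz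
    rw [(e.iteratedFDeriv ℝ n).eq_of_nhds]
    exact (hconst a y).trans ((le_max_left _ _).trans (le_max_right _ _))
  by_cases h2 : y < -R
  · have e : f =ᶠ[𝓝 y] fun _ => b := by
      filter_upwards [gt_mem_nhds h2] with z hz using hb z hz
    rw [(e.iteratedFDeriv ℝ n).eq_of_nhds]
    exact (hconst b y).trans ((le_max_right _ _).trans (le_max_right _ _))
  · have := hC y ⟨not_lt.1 h2, not_lt.1 h1⟩
    rw [norm_norm] at this
    exact this.trans (le_max_left _ _)

theorem exists_schwartzMap_eq_exp {ω : ℂ} (hω : 0 < ω.im) :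
    ∃ Ψ : 𝓢(ℝ, ℂ), ∀ y : ℝ, 0 < y → Ψ y = Complex.exp (Complex.I * ω * y) := by
  set ρ : ℝ → ℂ := fun y => (Real.smoothTransition (y + 1) : ℂ) with hρ
  set e : ℝ → ℂ := fun y => Complex.exp (Complex.I * ω * y) with he
  have hρs : ContDiff ℝ (⊤ : ℕ∞) ρ := Complex.ofRealCLM.contDiff.comp
    (Real.smoothTransition.contDiff.comp (contDiff_id.add contDiff_const))
  have hes : ContDiff ℝ (⊤ : ℕ∞) e := (contDiff_const.mul Complex.ofRealCLM.contDiff).cexp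
  have hρ0 : ∀ y, y < -1 → ρ y = 0 := fun y hy => by
    simp [hρ, Real.smoothTransition.zero_of_nonpos (by linarith : y + 1 ≤ 0)]
  have hρ1 : ∀ y, 0 < y → ρ y = 1 := fun y hy => by
    simp [hρ, Real.smoothTransition.one_of_one_le (by linarith : 1 ≤ y + 1)]
  have hdec : ∀ k n : ℕ, ∃ C : ℝ, ∀ y, ‖y‖ ^ k * ‖iteratedFDeriv ℝ n (fun y => ρ y * e y) y‖ ≤ C := by
    intro k n
    choose C hC using exists_norm_iteratedFDeriv_le_of_eventually_const hρs (R := 1) (a := 1) (b := 0)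
      (fun y hy => hρ1 y (by linarith)) hρ0
    set D := Real.exp ω.im + (k.factorial : ℝ) / ω.im ^ k
    have hD : 0 ≤ D := by positivity
    have hCn : ∀ i, 0 ≤ C i := fun i => (norm_nonneg _).trans (hC i 0)
    refine ⟨∑ i ∈ Finset.range (n + 1), (n.choose i : ℝ) * C i * (‖ω‖ ^ (n - i) * D), fun y => ?_⟩
    by_cases hy : y < -1
    · have h0 : (fun y => ρ y * e y) =ᶠ[𝓝 y] fun _ => 0 := by
        filter_upwards [gt_mem_nhds hy] with z hz
        rw [hρ0 z hz, zero_mul]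
      rw [(h0.iteratedFDeriv ℝ n).eq_of_nhds]
      simp only [iteratedFDeriv_fun_zero, Pi.zero_apply, norm_zero, mul_zero]
      exact Finset.sum_nonneg fun i _ => mul_nonneg (mul_nonneg (Nat.cast_nonneg _) (hCn i))
        (mul_nonneg (by positivity) hD)
    · have hE : ∀ i, ‖y‖ ^ k * ‖iteratedFDeriv ℝ i e y‖ ≤ ‖ω‖ ^ i * D := by
        intro i
        rw [norm_iteratedFDeriv_eq_norm_iteratedDeriv, he, iteratedDeriv_cexp_mul_ofReal, norm_mul,
          norm_pow, norm_mul, Complex.norm_I, one_mul, Complex.norm_exp, mul_left_comm]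
        have : (Complex.I * ω * y).re = -(ω.im * y) := by simp
        rw [this, Real.norm_eq_abs]
        gcongr
        exact abs_pow_mul_exp_neg_le k hω (not_lt.1 hy)
      calc _ ≤ ‖y‖ ^ k * ∑ i ∈ Finset.range (n + 1),
            (n.choose i : ℝ) * ‖iteratedFDeriv ℝ i ρ y‖ * ‖iteratedFDeriv ℝ (n - i) e y‖ := by
            gcongr
            exact norm_iteratedFDeriv_mul_le hρs hes y (by exact_mod_cast le_top)
        _ = ∑ i ∈ Finset.range (n + 1), (n.choose i : ℝ) * ‖iteratedFDeriv ℝ i ρ y‖ *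
            (‖y‖ ^ k * ‖iteratedFDeriv ℝ (n - i) e y‖) := by
            rw [Finset.mul_sum]
            exact Finset.sum_congr rfl fun i _ => by ring
        _ ≤ _ := by
            refine Finset.sum_le_sum fun i _ => ?_
            have := hCn i
            refine mul_le_mul ?_ (hE _) (by positivity) (by positivity)
            gcongr
            exact hC i y
  refine ⟨⟨fun y => ρ y * e y, hρs.mul hes, fun k n => hdec k n⟩, fun y hy => ?_⟩
  change ρ y * e y = _
  rw [hρ1 y hy, one_mul]

/-- A Schwartz function which is an exponential on the half-line and whose Fourier transform vanishes
to high order at the origin. -/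
theorem exists_schwartzMap_eq_exp_fourier_eq_pow_mul {ω : ℂ} (hω : 0 < ω.im) (N : ℕ) :
    ∃ Ψ Φ : 𝓢(ℝ, ℂ), (∀ y : ℝ, 0 < y → Ψ y = Complex.exp (Complex.I * ω * y)) ∧
      ∀ z : ℝ, (𝓕 Ψ) z = (z : ℂ) ^ N * (𝓕 Φ) z := by
  have hω0 : Complex.I * ω ≠ 0 := by
    refine mul_ne_zero Complex.I_ne_zero fun h => ?_
    simp [h] at hω
  induction N with
  | zero =>
    obtain ⟨Ψ, h⟩ := exists_schwartzMap_eq_exp hω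
    exact ⟨Ψ, Ψ, h, by simp⟩
  | succ N ih =>
    obtain ⟨Ψ, Φ, h1, h2⟩ := ih
    refine ⟨(Complex.I * ω)⁻¹ • SchwartzMap.derivCLM ℂ ℂ Ψ,
      ((Complex.I * ω)⁻¹ * (2 * Real.pi * Complex.I)) • Φ, fun y hy => ?_, fun z => ?_⟩
    · rw [smul_apply, SchwartzMap.derivCLM_apply]
      have e : (Ψ : ℝ → ℂ) =ᶠ[𝓝 y] fun y : ℝ => Complex.exp (Complex.I * ω * y) := by
        filter_upwards [lt_mem_nhds hy] with z hz using h1 z hz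
      rw [e.deriv_eq, ← iteratedDeriv_one, iteratedDeriv_cexp_mul_ofReal, pow_one, smul_eq_mul,
        inv_mul_cancel_left₀ hω0]
    · have hd : 𝓕 (SchwartzMap.derivCLM ℂ ℂ Ψ) z = (2 * Real.pi * Complex.I * z) * (𝓕 Ψ) z := by
        have := congrFun (Real.fourier_deriv Ψ.integrable Ψ.differentiable
          (SchwartzMap.derivCLM ℂ ℂ Ψ).integrable) z
        rw [SchwartzMap.fourier_coe, SchwartzMap.fourier_coe]
        exact this
      rw [FourierTransform.fourier_smul, FourierTransform.fourier_smul, smul_apply,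
        smul_apply, hd, h2, smul_eq_mul, smul_eq_mul]
      ring

end HalfExponential


/-! ### Extensions to the whole space -/

section Extension

variable {V : Type*} [NormedAddCommGroup V] [InnerProductSpace ℝ V] [FiniteDimensional ℝ V]
  [MeasurableSpace V] [BorelSpace V]

theorem HasFourierFunction.add {f g : 𝓢'(V, ℂ)} {F G : V → ℂ} (hF : HasFourierFunction f F)
    (hG : HasFourierFunction g G) : HasFourierFunction (f + g) (F + G) := by
  intro φ
  obtain ⟨i1, e1⟩ := hF φ
  obtain ⟨i2, e2⟩ := hG φ
  rw [TemperedDistribution.fourier_apply] at e1 e2 ⊢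
  have e : (f + g) (𝓕 φ) = f (𝓕 φ) + g (𝓕 φ) := rfl
  simp only [Pi.add_apply, add_mul]
  exact ⟨i1.add i2, by rw [e, e1, e2, integral_add i1 i2]⟩

theorem HasFourierFunction.const_smul {f : 𝓢'(V, ℂ)} {F : V → ℂ} (hF : HasFourierFunction f F)
    (c : ℂ) : HasFourierFunction (c • f) (fun ζ => c * F ζ) := by
  intro φ
  obtain ⟨i1, e1⟩ := hF φ
  rw [TemperedDistribution.fourier_apply] at e1 ⊢
  have e : (c • f) (𝓕 φ) = c * f (𝓕 φ) := rfl
  simp only [mul_assoc]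
  exact ⟨i1.const_mul c, by rw [e, e1, integral_const_mul]⟩

theorem fourierInv_eq_integral (φ : 𝓢(V, ℂ)) (η : V) :
    (𝓕⁻ φ) η = ∫ z, φ z * Complex.exp (Complex.I * inner ℝ z ((2 * Real.pi) • η)) := by
  rw [SchwartzMap.fourierInv_coe, Real.fourierInv_eq']
  refine integral_congr_ae (ae_of_all _ fun z => ?_)
  simp only [smul_eq_mul, real_inner_smul_right]
  rw [mul_comm]
  congr 2
  push_cast
  ring

theorem HasFourierFunction.integrable_mul_integral {f : 𝓢'(V, ℂ)} {F : V → ℂ}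
    (hF : HasFourierFunction f F) (φ : 𝓢(V, ℂ)) :
    Integrable fun ζ => F ζ * ∫ z, φ z * Complex.exp (Complex.I * inner ℝ z ζ) := by
  have h := (hF.apply_eq φ).1
  simp only [fourierInv_eq_integral] at h
  exact (integrable_comp_smul_iff volume
    (fun ζ => F ζ * ∫ z, φ z * Complex.exp (Complex.I * inner ℝ z ζ)) two_pi_ne_zero').1 h

theorem HasFourierFunction.apply_eq_integral {f : 𝓢'(V, ℂ)} {F : V → ℂ}
    (hF : HasFourierFunction f F) (φ : 𝓢(V, ℂ)) :
    f φ = (((2 * Real.pi) ^ Module.finrank ℝ V)⁻¹ : ℝ) •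
      ∫ ζ, F ζ * ∫ z, φ z * Complex.exp (Complex.I * inner ℝ z ζ) := by
  have h := Measure.integral_comp_smul (volume : Measure V)
    (fun ζ => F ζ * ∫ z, φ z * Complex.exp (Complex.I * inner ℝ z ζ)) (2 * Real.pi)
  rw [abs_of_pos (by positivity)] at h
  rw [← h, (hF.apply_eq φ).2]
  simp only [fourierInv_eq_integral]

/-- `u` has an extension from `Ω` to the whole space whose weighted norm is at most `C`. -/
def HasExtension (Ω : Set V) (w : V → ℝ) (u : V → ℂ) (C : ℝ≥0∞) : Prop :=
  (∀ φ : 𝓢(V, ℂ), HasCompactSupport φ → tsupport φ ⊆ Ω → IntegrableOn (fun z => u z * φ z) Ω) ∧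
    ∃ (v : 𝓢'(V, ℂ)) (F : V → ℂ), HasFourierFunction v F ∧ AgreeOn Ω v (functional Ω u) ∧
      eLpNorm (fun ζ => (√(w ζ) : ℂ) * F ζ) 2 ≤ C

theorem HasExtension.restrictionNorm_le {Ω : Set V} {w : V → ℝ} {u : V → ℂ} {C : ℝ≥0∞}
    (h : HasExtension Ω w u C) (hw : ∀ ζ, 0 ≤ w ζ) :
    restrictionNorm Ω w (functional Ω u) ≤ C := by
  obtain ⟨-, v, F, hF, hv, hC⟩ := h
  refine (iInf₂_le v hv).trans ?_
  rwa [hF.weightedNorm_eq hw]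

theorem HasExtension.mono {Ω : Set V} {w : V → ℝ} {u : V → ℂ} {C D : ℝ≥0∞}
    (h : HasExtension Ω w u C) (hCD : C ≤ D) : HasExtension Ω w u D := by
  obtain ⟨h1, v, F, hF, hv, hC⟩ := h
  exact ⟨h1, v, F, hF, hv, hC.trans hCD⟩

theorem HasExtension.congr {Ω : Set V} (hΩ : MeasurableSet Ω) {w : V → ℝ} {u u' : V → ℂ} {C : ℝ≥0∞}
    (h : HasExtension Ω w u C) (huu' : EqOn u u' Ω) : HasExtension Ω w u' C := by
  obtain ⟨h1, v, F, hF, hv, hC⟩ := h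
  refine ⟨fun φ hφ hs => (h1 φ hφ hs).congr_fun (fun z hz => by simp only [huu' hz]) hΩ, v, F, hF,
    fun φ hφ hs => (hv φ hφ hs).trans ?_, hC⟩
  exact setIntegral_congr_fun hΩ fun z hz => by simp only [huu' hz]

theorem HasExtension.zero (Ω : Set V) (w : V → ℝ) : HasExtension Ω w 0 0 := by
  refine ⟨fun φ _ _ => by simp, 0, 0, fun φ => ⟨by simp, ?_⟩, fun φ _ _ => ?_, by simp⟩
  · rw [TemperedDistribution.fourier_apply]
    simp
  · simp [functional]

theorem HasExtension.add {Ω : Set V} {w : V → ℝ} (hw : Measurable w) {u u' : V → ℂ} {C C' : ℝ≥0∞}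
    (h : HasExtension Ω w u C) (h' : HasExtension Ω w u' C') :
    HasExtension Ω w (fun z => u z + u' z) (C + C') := by
  obtain ⟨h1, v, F, hF, hv, hC⟩ := h
  obtain ⟨h1', v', F', hF', hv', hC'⟩ := h'
  refine ⟨fun φ hφ hs => ?_, v + v', F + F', hF.add hF', fun φ hφ hs => ?_, ?_⟩
  · simp only [add_mul]
    exact (h1 φ hφ hs).add (h1' φ hφ hs)
  · have e : (v + v') φ = v φ + v' φ := rfl
    rw [e, hv φ hφ hs, hv' φ hφ hs, functional, functional, functional,
      ← integral_add (h1 φ hφ hs) (h1' φ hφ hs)]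
    simp only [add_mul]
  · have hm : ∀ {f : 𝓢'(V, ℂ)} {G : V → ℂ}, HasFourierFunction f G →
        AEStronglyMeasurable (fun ζ => (√(w ζ) : ℂ) * G ζ) := fun hG =>
      (Complex.measurable_ofReal.comp hw.sqrt).aestronglyMeasurable.mul hG.aestronglyMeasurable
    refine le_trans (le_of_eq ?_) ((eLpNorm_add_le (hm hF) (hm hF') (by norm_num)).trans
      (add_le_add hC hC'))
    congr 1
    funext ζ
    simp only [Pi.add_apply]
    ring

theorem HasExtension.const_mul {Ω : Set V} {w : V → ℝ} {u : V → ℂ} {C : ℝ≥0∞}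
    (h : HasExtension Ω w u C) (c : ℂ) :
    HasExtension Ω w (fun z => c * u z) (‖c‖ₑ * C) := by
  obtain ⟨h1, v, F, hF, hv, hC⟩ := h
  refine ⟨fun φ hφ hs => ?_, c • v, _, hF.const_smul c, fun φ hφ hs => ?_, ?_⟩
  · simp only [mul_assoc]
    exact (h1 φ hφ hs).const_mul c
  · have e : (c • v) φ = c * v φ := rfl
    rw [e, hv φ hφ hs, functional, functional, ← integral_const_mul]
    simp only [mul_assoc]
  · have e : (fun ζ => (√(w ζ) : ℂ) * (c * F ζ)) = c • fun ζ => (√(w ζ) : ℂ) * F ζ := by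
      funext ζ
      simp only [Pi.smul_apply, smul_eq_mul]
      ring
    rw [e, eLpNorm_const_smul]
    gcongr

theorem HasExtension.sum {ι : Type*} (t : Finset ι) {Ω : Set V} {w : V → ℝ} (hw : Measurable w)
    {u : ι → V → ℂ} {C : ι → ℝ≥0∞} (h : ∀ i ∈ t, HasExtension Ω w (u i) (C i)) :
    HasExtension Ω w (fun z => ∑ i ∈ t, u i z) (∑ i ∈ t, C i) := by
  classical
  induction t using Finset.induction_on with
  | empty =>
    simp only [Finset.sum_empty]
    exact HasExtension.zero Ω w
  | insert i t hi ih =>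
    simp only [Finset.sum_insert hi]
    exact (h i (Finset.mem_insert_self i t)).add hw
      (ih fun k hk => h k (Finset.mem_insert_of_mem hk))

end Extension

section RayExtension

theorem exists_norm_hatKernel_schwartz_pow_le (Φ : 𝓢(ℝ, ℂ)) (k : ℕ) :
    ∃ C : ℝ, 0 ≤ C ∧ ∀ z, ‖hatKernel Φ z‖ ≤ C * ((1 + |z|) ^ k)⁻¹ := by
  obtain ⟨C, hC⟩ : ∃ C : ℝ, ∀ x, (1 + ‖x‖) ^ k * ‖(𝓕 Φ) x‖ ≤ C :=
    ⟨_, fun x => by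
      simpa using SchwartzMap.one_add_le_sup_seminorm_apply (𝕜 := ℂ) (m := (k, 0)) le_rfl le_rfl
        (𝓕 Φ) x⟩
  have hC0 : 0 ≤ C := by
    refine le_trans ?_ (hC 0)
    positivity
  refine ⟨(2 * Real.pi) ^ k * C, by positivity, fun z => ?_⟩
  have h1 := hC ((2 * Real.pi)⁻¹ * z)
  rw [SchwartzMap.fourier_coe, fourier_eq_hatKernel, mul_inv_cancel_left₀ two_pi_ne_zero',
    Real.norm_eq_abs, abs_mul, abs_of_pos (by positivity)] at h1
  rw [← div_eq_mul_inv, le_div_iff₀ (pow_pos (one_add_abs_pos z) k), mul_comm]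
  have h2 : 1 + |z| ≤ 2 * Real.pi * (1 + (2 * Real.pi)⁻¹ * |z|) := by
    rw [mul_add, mul_inv_cancel_left₀ two_pi_ne_zero']
    linarith [Real.pi_gt_three]
  calc (1 + |z|) ^ k * ‖hatKernel Φ z‖
      ≤ (2 * Real.pi * (1 + (2 * Real.pi)⁻¹ * |z|)) ^ k * ‖hatKernel Φ z‖ := by gcongr
    _ = (2 * Real.pi) ^ k * ((1 + (2 * Real.pi)⁻¹ * |z|) ^ k * ‖hatKernel Φ z‖) := by
      rw [mul_pow]; ring
    _ ≤ _ := by gcongr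

theorem integrable_hatKernel_schwartz (Φ : 𝓢(ℝ, ℂ)) : Integrable (hatKernel Φ) := by
  have h := (𝓕 Φ).integrable (μ := (volume : Measure ℝ)).comp_mul_left'
    (inv_ne_zero two_pi_ne_zero')
  refine h.congr (ae_of_all _ fun z => ?_)
  simp only
  rw [SchwartzMap.fourier_coe, fourier_eq_hatKernel, mul_inv_cancel_left₀ two_pi_ne_zero']

theorem integral_hatKernel_div_mul_exp (Φ : 𝓢(ℝ, ℂ)) {r : ℝ} (hr : 0 < r) (x : ℝ) :
    ∫ ξ : ℝ, hatKernel Φ (ξ / r) * Complex.exp (Complex.I * ξ * x) =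
      2 * Real.pi * r * Φ (r * x) := by
  have h := Measure.integral_comp_mul_left
    (fun ξ : ℝ => hatKernel Φ (ξ / r) * Complex.exp (Complex.I * ξ * x)) (2 * Real.pi * r)
  have hp : 0 < 2 * Real.pi * r := by positivity
  have hinv : (𝓕⁻ (𝓕 Φ)) (r * x) = Φ (r * x) := by rw [FourierTransform.fourierInv_fourier_eq]
  rw [abs_of_pos (inv_pos.2 hp), eq_inv_smul_iff₀ hp.ne'] at h
  rw [← h, ← hinv, SchwartzMap.fourierInv_coe, Real.fourierInv_eq', Complex.real_smul]
  push_cast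
  congr 1
  refine integral_congr_ae (ae_of_all _ fun u => ?_)
  simp only
  rw [SchwartzMap.fourier_coe, fourier_eq_hatKernel, smul_eq_mul, mul_comm,
    show 2 * Real.pi * r * u / r = 2 * Real.pi * u by field_simp]
  congr 2
  simp
  ring

theorem integral_hatKernel_div_mul_integral {Z : Type*} [MeasurableSpace Z] {ν : Measure Z}
    [SFinite ν] (Φ : 𝓢(ℝ, ℂ)) {r : ℝ} (hr : 0 < r) {g : Z → ℂ} (hg : Integrable g ν) {X : Z → ℝ}
    (hX : Measurable X) :
    ∫ ξ : ℝ, hatKernel Φ (ξ / r) * ∫ z, g z * Complex.exp (Complex.I * ξ * X z) ∂ν =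
      2 * Real.pi * r * ∫ z, Φ (r * X z) * g z ∂ν := by
  have hsw := integral_integral_swap (μ := (volume : Measure ℝ)) (ν := ν)
    (f := fun ξ z => hatKernel Φ (ξ / r) * (g z * Complex.exp (Complex.I * ξ * X z))) (by
      have hb := ((integrable_hatKernel_schwartz Φ).comp_div hr.ne').mul_prod hg
      refine hb.mono ?_ (ae_of_all _ fun p => ?_)
      · have hm : Measurable fun p : ℝ × Z => Complex.exp (Complex.I * p.1 * X p.2) := by fun_prop
        exact hb.1.mul hm.aestronglyMeasurable |>.congr (ae_of_all _ fun p => by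
          simp only [Pi.mul_apply, Function.uncurry]; ring)
      · have e : Complex.I * p.1 * X p.2 = ((p.1 * X p.2 : ℝ) : ℂ) * Complex.I := by push_cast; ring
        simp only [Function.uncurry, norm_mul, e, Complex.norm_exp_ofReal_mul_I, mul_one, le_refl])
  simp only [← integral_const_mul]
  rw [hsw]
  refine integral_congr_ae (ae_of_all _ fun z => ?_)
  simp only
  rw [← mul_assoc, ← integral_hatKernel_div_mul_exp Φ hr (X z), ← integral_mul_const]
  refine integral_congr_ae (ae_of_all _ fun ξ => ?_)
  simp only
  ring

theorem integrable_ray_mul {Z : Type*} [MeasurableSpace Z] {ν : Measure Z} [SFinite ν] {ω : ℂ}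
    (hω : 0 < ω.im) {δ : ℝ} {f : ℝ → ℂ} (hf : AEStronglyMeasurable f (volume.restrict (Ioi 0)))
    (hfi : IntegrableOn (fun r => f r * Real.exp (-(ω.im * δ * r))) (Ioi 0)) {E : ℝ × Z → ℂ}
    (hE : Measurable E) (hE1 : ∀ p, ‖E p‖ ≤ 1) {X : Z → ℝ} (hX : Measurable X) {φ : Z → ℂ}
    (hφ : Integrable φ ν) (hδ : ∀ z, φ z ≠ 0 → δ ≤ X z) :
    Integrable (fun p : ℝ × Z => Complex.exp (Complex.I * ω * (p.1 * X p.2 : ℝ)) * f p.1 * E p * φ p.2)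
      ((volume.restrict (Ioi (0 : ℝ))).prod ν) := by
  refine (hfi.mul_prod hφ).mono ?_ ?_
  · have hm : Measurable fun p : ℝ × Z => Complex.exp (Complex.I * ω * (p.1 * X p.2 : ℝ)) := by
      fun_prop
    exact ((hm.aestronglyMeasurable.mul hf.comp_fst).mul hE.aestronglyMeasurable).mul hφ.1.comp_snd
  · have hpos : ∀ᵐ p : ℝ × Z ∂((volume.restrict (Ioi (0 : ℝ))).prod ν), 0 < p.1 :=
      Measure.quasiMeasurePreserving_fst.ae (ae_restrict_mem measurableSet_Ioi)
    filter_upwards [hpos] with p hp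
    by_cases h0 : φ p.2 = 0
    · simp [h0]
    have h1 := hδ _ h0
    have e : (Complex.I * ω * (p.1 * X p.2 : ℝ)).re = -(ω.im * (p.1 * X p.2)) := by
      rw [Complex.re_mul_ofReal, Complex.I_mul_re]; ring
    rw [norm_mul, norm_mul, norm_mul, norm_mul, norm_mul, Complex.norm_exp, e, Complex.norm_real,
      Real.norm_of_nonneg (Real.exp_pos _).le]
    calc _ ≤ Real.exp (-(ω.im * δ * p.1)) * ‖f p.1‖ * 1 * ‖φ p.2‖ := by
          have h2 : -(ω.im * (p.1 * X p.2)) ≤ -(ω.im * δ * p.1) := by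
            nlinarith [mul_le_mul_of_nonneg_left h1 (mul_pos hω hp).le]
          have h3 := Real.exp_le_exp.2 h2
          have h4 := hE1 p
          gcongr
      _ = _ := by ring

end RayExtension


section HalfLineExtension

open Filter Topology

theorem lintegral_div_abs_add_mul_rpow_le {ξ : ℝ} (hξ : 0 < |ξ|) :
    ∫⁻ r in Ioi (0 : ℝ), ENNReal.ofReal (|ξ| + r)⁻¹ * ENNReal.ofReal (r ^ (-(1 / 2) : ℝ)) ≤
      4 * ENNReal.ofReal (|ξ| ^ (-(1 / 2) : ℝ)) := by
  have h := lintegral_Ioi_rpow_div_add_le (γ := 1 / 2) (by norm_num) (by norm_num) hξ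
  rw [ENNReal.ofReal_mul (by norm_num), show (1 / (1 - 1 / 2) + 1 / (1 / 2) : ℝ) = 4 by norm_num,
    ENNReal.ofReal_ofNat] at h
  refine le_trans (le_of_eq ?_) h
  refine setLIntegral_congr_fun measurableSet_Ioi fun r hr => ?_
  have hr0 : 0 < r := hr
  rw [← ENNReal.ofReal_mul (inv_nonneg.2 (by positivity)), div_eq_inv_mul (r ^ _)]

/-- **Hilbert's inequality**, between the line and the half-line. -/
theorem lintegral_sq_lintegral_div_abs_add_le {f : ℝ → ℝ≥0∞}
    (hf : AEMeasurable f (volume.restrict (Ioi 0))) :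
    ∫⁻ ξ : ℝ, (∫⁻ r in Ioi (0 : ℝ), ENNReal.ofReal (|ξ| + r)⁻¹ * f r) ^ 2 ≤
      32 * ∫⁻ r in Ioi (0 : ℝ), f r ^ 2 := by
  have h := lintegral_sq_lintegral_le (μ := (volume : Measure ℝ)) (ν := volume.restrict (Ioi (0 : ℝ)))
    (k := fun ξ r => ENNReal.ofReal (|ξ| + r)⁻¹) (A := 4) (B := 8)
    (p := fun ξ => ENNReal.ofReal (|ξ| ^ (-(1 / 2) : ℝ)))
    (q := fun r => ENNReal.ofReal (r ^ (-(1 / 2) : ℝ))) (by fun_prop) (by fun_prop) (by fun_prop)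
    ?_ ?_ ?_ hf
  · exact h.trans (le_of_eq (by norm_num))
  · filter_upwards [ae_restrict_mem measurableSet_Ioi] with r hr
    have hr0 : 0 < r := hr
    exact ⟨(ENNReal.ofReal_pos.2 (by positivity)).ne', ENNReal.ofReal_ne_top⟩
  · filter_upwards [compl_mem_ae_iff.2 (measure_singleton (0 : ℝ))] with ξ hξ
    exact lintegral_div_abs_add_mul_rpow_le (abs_pos.2 hξ)
  · filter_upwards [ae_restrict_mem measurableSet_Ioi] with r hr
    have hr0 : 0 < r := hr
    rw [lintegral_abs_eq fun x => ENNReal.ofReal (x + r)⁻¹ * ENNReal.ofReal (x ^ (-(1 / 2) : ℝ))]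
    have h1 := lintegral_div_abs_add_mul_rpow_le (abs_pos.2 hr0.ne')
    rw [abs_of_pos hr0] at h1
    simp only [add_comm _ r]
    calc _ ≤ 2 * (4 * ENNReal.ofReal (r ^ (-(1 / 2) : ℝ))) := by gcongr
      _ = _ := by rw [← mul_assoc]; norm_num

theorem one_add_abs_le_mul {ξ r : ℝ} (hr : 0 < r) : 1 + |ξ| ≤ (1 + r) * (1 + |ξ / r|) := by
  have e : |ξ| = r * |ξ / r| := by
    rw [abs_div, abs_of_pos hr]; field_simp
  have := abs_nonneg (ξ / r)
  nlinarith [mul_pos hr hr]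

theorem lintegral_sq_hatKernel_neg_lt_top (φ : 𝓢(ℝ, ℂ)) :
    ∫⁻ ζ, ‖hatKernel φ (-ζ)‖ₑ ^ 2 < ⊤ := by
  obtain ⟨C, hC0, hC⟩ := exists_norm_hatKernel_schwartz_le φ
  have h : MemLp (fun ζ => hatKernel φ (-ζ)) 2 := by
    refine ((memLp_one_add_abs_rpow (r := 1) (by norm_num)).const_mul (C : ℂ)).of_le
      ((continuous_hatKernel φ.integrable).comp continuous_neg).aestronglyMeasurable
      (ae_of_all _ fun ζ => ?_)
    have h1 := hC (-ζ)
    rw [abs_neg] at h1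
    rw [norm_mul, Complex.norm_real, Complex.norm_real, Real.norm_of_nonneg hC0, Real.rpow_neg_one,
      Real.norm_of_nonneg (by positivity)]
    exact h1
  have := h.eLpNorm_lt_top
  rw [eLpNorm_lt_top_iff_lintegral_rpow_enorm_lt_top two_ne_zero ENNReal.ofNat_ne_top] at this
  simpa using this

/-- The kernel that maps the amplitudes along a ray to the Fourier transform of an extension. -/
def rayTransform (Ψ : 𝓢(ℝ, ℂ)) (f : ℝ → ℂ) (ξ : ℝ) : ℂ :=
  ∫ r in Ioi (0 : ℝ), (r : ℂ)⁻¹ * hatKernel Ψ (ξ / r) * f r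

theorem exists_norm_rayKernel_le (Ψ : 𝓢(ℝ, ℂ)) {s : ℝ} (hs : 0 ≤ s) :
    ∃ D : ℝ, 0 ≤ D ∧ ∀ ξ r : ℝ, 0 < r →
      √(sobolevWeight s ξ) * ‖(r : ℂ)⁻¹ * hatKernel Ψ (ξ / r)‖ ≤ D * (|ξ| + r)⁻¹ * (1 + r) ^ s := by
  obtain ⟨D, hD0, hD⟩ := exists_norm_hatKernel_schwartz_pow_le Ψ (⌈s⌉₊ + 1)
  refine ⟨D, hD0, fun ξ r hr => ?_⟩
  set y := |ξ / r| with hy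
  have hy0 : 0 ≤ y := abs_nonneg _
  have h1 : √(sobolevWeight s ξ) ≤ (1 + |ξ|) ^ s := by
    rw [sobolevWeight]
    refine Real.sqrt_le_iff.2 ⟨by positivity, ?_⟩
    rw [← Real.rpow_mul_natCast (by positivity), mul_comm s, Real.rpow_natCast_mul (by positivity)]
    refine Real.rpow_le_rpow (by positivity) ?_ hs
    rw [← sq_abs]
    nlinarith [abs_nonneg ξ]
  have h2 : (1 + |ξ|) ^ s ≤ (1 + r) ^ s * (1 + y) ^ (⌈s⌉₊) := by
    calc (1 + |ξ|) ^ s ≤ ((1 + r) * (1 + y)) ^ s :=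
          Real.rpow_le_rpow (by positivity) (one_add_abs_le_mul hr) hs
      _ = (1 + r) ^ s * (1 + y) ^ s := Real.mul_rpow (by positivity) (by positivity)
      _ ≤ (1 + r) ^ s * (1 + y) ^ (⌈s⌉₊ : ℝ) := by
          gcongr
          · linarith
          · exact Nat.le_ceil s
      _ = _ := by rw [Real.rpow_natCast]
  have h3 : (|ξ| + r)⁻¹ = r⁻¹ * (1 + y)⁻¹ := by
    rw [hy, abs_div, abs_of_pos hr]; field_simp; ring
  rw [norm_mul, norm_inv, Complex.norm_real, Real.norm_of_nonneg hr.le, h3]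
  calc _ ≤ (1 + r) ^ s * (1 + y) ^ (⌈s⌉₊) * (r⁻¹ * (D * ((1 + y) ^ (⌈s⌉₊ + 1))⁻¹)) := by
        gcongr
        · exact h1.trans h2
        · exact hD _
    _ = _ := by
        rw [pow_succ]
        field_simp

theorem exists_hasExtension_halfLine {ω : ℂ} (hω : 0 < ω.im) {s : ℝ} (hs : 0 ≤ s) :
    ∃ C : ℝ≥0, ∀ f : ℝ → ℂ, StronglyMeasurable f →
      ∫⁻ r in Ioi (0 : ℝ), (ENNReal.ofReal ((1 + r) ^ s) * ‖f r‖ₑ) ^ 2 < ⊤ →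
      HasExtension (Ioi 0) (sobolevWeight s)
        (fun x => ∫ r in Ioi (0 : ℝ), Complex.exp (Complex.I * ω * (r * x : ℝ)) * f r)
        (C * (∫⁻ r in Ioi (0 : ℝ), (ENNReal.ofReal ((1 + r) ^ s) * ‖f r‖ₑ) ^ 2) ^ (1 / 2 : ℝ)) := by
  obtain ⟨Ψ, hΨ⟩ := exists_schwartzMap_eq_exp hω
  obtain ⟨D, hD0, hD⟩ := exists_norm_rayKernel_le Ψ hs
  refine ⟨(√32 * D).toNNReal, fun f hf hN => ?_⟩
  set N := ∫⁻ r in Ioi (0 : ℝ), (ENNReal.ofReal ((1 + r) ^ s) * ‖f r‖ₑ) ^ 2 with hNdef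
  have hw1 : ∀ ξ, 1 ≤ √(sobolevWeight s ξ) := fun ξ =>
    Real.one_le_sqrt.2 (Real.one_le_rpow (by nlinarith [sq_nonneg ξ]) hs)
  have hKm : StronglyMeasurable fun p : ℝ × ℝ => (p.2 : ℂ)⁻¹ * hatKernel Ψ (p.1 / p.2) * f p.2 :=
    ((by fun_prop : Measurable fun p : ℝ × ℝ => (p.2 : ℂ)⁻¹).stronglyMeasurable.mul
      ((continuous_hatKernel Ψ.integrable).stronglyMeasurable.comp_measurable (by fun_prop))).mul
      (hf.comp_measurable measurable_snd)
  -- the absolute kernel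
  set g : ℝ → ℝ≥0∞ := fun ξ => ENNReal.ofReal (√(sobolevWeight s ξ)) *
    ∫⁻ r in Ioi (0 : ℝ), ‖(r : ℂ)⁻¹ * hatKernel Ψ (ξ / r) * f r‖ₑ with hg
  have hg2 : ∫⁻ ξ, g ξ ^ 2 ≤ ENNReal.ofReal D ^ 2 * (32 * N) := by
    have hb : ∀ ξ, g ξ ≤ ENNReal.ofReal D * ∫⁻ r in Ioi (0 : ℝ), ENNReal.ofReal (|ξ| + r)⁻¹ *
        (ENNReal.ofReal ((1 + r) ^ s) * ‖f r‖ₑ) := by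
      intro ξ
      rw [hg]
      simp only
      rw [← lintegral_const_mul' _ _ ENNReal.ofReal_ne_top,
        ← lintegral_const_mul' _ _ ENNReal.ofReal_ne_top]
      refine setLIntegral_mono' measurableSet_Ioi fun r hr => ?_
      have hr0 : 0 < r := hr
      rw [enorm_mul, ← mul_assoc, ← mul_assoc, ← mul_assoc, ← ENNReal.ofReal_mul hD0,
        ← ENNReal.ofReal_mul (by positivity), ← ofReal_norm ((r : ℂ)⁻¹ * hatKernel Ψ (ξ / r)),
        ← ENNReal.ofReal_mul (Real.sqrt_nonneg _)]
      exact mul_le_mul_left (ENNReal.ofReal_le_ofReal (hD ξ r hr0)) _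
    calc _ ≤ ∫⁻ ξ : ℝ, ENNReal.ofReal D ^ 2 * (∫⁻ r in Ioi (0 : ℝ), ENNReal.ofReal (|ξ| + r)⁻¹ *
        (ENNReal.ofReal ((1 + r) ^ s) * ‖f r‖ₑ)) ^ 2 := by
          refine lintegral_mono fun ξ => ?_
          rw [← mul_pow]
          gcongr
          exact hb ξ
      _ = ENNReal.ofReal D ^ 2 * ∫⁻ ξ : ℝ, (∫⁻ r in Ioi (0 : ℝ), ENNReal.ofReal (|ξ| + r)⁻¹ *
        (ENNReal.ofReal ((1 + r) ^ s) * ‖f r‖ₑ)) ^ 2 :=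
          lintegral_const_mul' _ _ (by finiteness)
      _ ≤ _ := by
          gcongr
          exact lintegral_sq_lintegral_div_abs_add_le
            (((by fun_prop : Measurable fun r : ℝ => ENNReal.ofReal ((1 + r) ^ s)).mul
              hf.measurable.enorm).aemeasurable)
  have hwm : Measurable (sobolevWeight s) := by unfold sobolevWeight; fun_prop
  have hgm : Measurable g := hwm.sqrt.ennreal_ofReal.mul hKm.measurable.enorm.lintegral_prod_right'
  have hgfin : ∫⁻ ξ, g ξ ^ 2 < ⊤ := hg2.trans_lt (by finiteness)
  set F := rayTransform Ψ f with hF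
  have hFm : StronglyMeasurable F := hKm.integral_prod_right'
  have hFg : ∀ ξ, ‖(√(sobolevWeight s ξ) : ℂ) * F ξ‖ₑ ≤ g ξ := by
    intro ξ
    rw [enorm_mul, ← ofReal_norm (√(sobolevWeight s ξ) : ℂ), Complex.norm_real,
      Real.norm_of_nonneg (Real.sqrt_nonneg _)]
    exact mul_le_mul_right (enorm_integral_le_lintegral_enorm _) _
  have hwFm : AEStronglyMeasurable fun ξ => (√(sobolevWeight s ξ) : ℂ) * F ξ :=
    ((Complex.measurable_ofReal.comp hwm.sqrt).stronglyMeasurable.mul hFm).aestronglyMeasurable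
  have hnorm : eLpNorm (fun ξ => (√(sobolevWeight s ξ) : ℂ) * F ξ) 2 ≤
      (∫⁻ ξ, g ξ ^ 2) ^ (1 / 2 : ℝ) := by
    rw [eLpNorm_eq_lintegral_rpow_enorm_toReal two_ne_zero ENNReal.ofNat_ne_top]
    simp only [ENNReal.toReal_ofNat, ENNReal.rpow_two]
    refine ENNReal.rpow_le_rpow (lintegral_mono fun ξ => ?_) (by norm_num)
    exact pow_le_pow_left' (hFg ξ) 2
  have hwF2 : MemLp (fun ξ => (√(sobolevWeight s ξ) : ℂ) * F ξ) 2 :=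
    ⟨hwFm, hnorm.trans_lt (ENNReal.rpow_lt_top_of_nonneg (by norm_num) hgfin.ne)⟩
  obtain ⟨v, hv⟩ := exists_hasFourierFunction (F := F) (r := 0) (hwF2.of_le (by
    simpa using hFm.aestronglyMeasurable) (ae_of_all _ fun ξ => by
      simp only [neg_zero, Real.rpow_zero, Complex.ofReal_one, one_mul, norm_mul, Complex.norm_real,
        Real.norm_of_nonneg (Real.sqrt_nonneg _)]
      exact le_mul_of_one_le_left (norm_nonneg _) (hw1 ξ)))
  -- the amplitudes are square integrable
  have hf2 : MemLp f 2 (volume.restrict (Ioi 0)) := by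
    refine ⟨hf.aestronglyMeasurable, ?_⟩
    rw [eLpNorm_eq_lintegral_rpow_enorm_toReal two_ne_zero ENNReal.ofNat_ne_top]
    simp only [ENNReal.toReal_ofNat, ENNReal.rpow_two]
    refine ENNReal.rpow_lt_top_of_nonneg (by norm_num) (ne_of_lt (lt_of_le_of_lt ?_ hN))
    refine setLIntegral_mono' measurableSet_Ioi fun r hr => ?_
    have hr0 : 0 < r := hr
    gcongr
    refine le_mul_of_one_le_left' ?_
    rw [ENNReal.one_le_ofReal]
    exact Real.one_le_rpow (by linarith) hs
  have hprod : ∀ φ : 𝓢(ℝ, ℂ), HasCompactSupport φ → tsupport φ ⊆ Ioi 0 →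
      Integrable (fun p : ℝ × ℝ => Complex.exp (Complex.I * ω * (p.1 * p.2 : ℝ)) * f p.1 * φ p.2)
        ((volume.restrict (Ioi (0 : ℝ))).prod volume) := by
    intro φ hφ hs'
    obtain ⟨δ, hδ0, hδ⟩ : ∃ δ : ℝ, 0 < δ ∧ ∀ z ∈ tsupport φ, δ ≤ z := by
      rcases (tsupport φ).eq_empty_or_nonempty with h | h
      · exact ⟨1, one_pos, by simp [h]⟩
      · obtain ⟨x, hx, hxm⟩ := hφ.isCompact.exists_isMinOn h continuousOn_id
        exact ⟨x, hs' hx, fun z hz => hxm hz⟩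
    have hexp : MemLp (fun r : ℝ => (Real.exp (-(ω.im * δ * r)) : ℂ)) 2
        (volume.restrict (Ioi 0)) := by
      refine MemLp.ofReal (K := ℂ) (f := fun r : ℝ => Real.exp (-(ω.im * δ * r)))
        ((memLp_two_iff_integrable_sq (by fun_prop)).2 ?_)
      have := integrableOn_pow_mul_exp_neg 0 (b := 2 * (ω.im * δ)) (by positivity)
      refine this.congr (ae_of_all _ fun r => ?_)
      simp only [pow_zero, one_mul]
      rw [← Real.exp_nat_mul]
      congr 1
      push_cast
      ring
    have := integrable_ray_mul hω hf.aestronglyMeasurable (hf2.integrable_mul hexp)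
      (ν := (volume : Measure ℝ)) (E := fun _ => 1) measurable_const (by simp) measurable_id
      (φ := φ) φ.integrable (fun z hz => hδ z (subset_tsupport φ hz))
    simpa using this
  refine ⟨fun φ hφ hs' => ?_, v, F, hv, fun φ hφ hs' => ?_, ?_⟩
  · have := (hprod φ hφ hs').integral_prod_right
    simp only [integral_mul_const] at this
    exact this.integrableOn
  · have hi := hprod φ hφ hs'
    have hz : ∀ z, φ z ≠ 0 → 0 < z := fun z h => hs' (subset_tsupport φ h)
    have hP : ∀ ζ : ℝ, ∫ z, φ z * Complex.exp (Complex.I * inner ℝ z ζ) = hatKernel φ (-ζ) := by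
      intro ζ
      rw [hatKernel]
      refine integral_congr_ae (ae_of_all _ fun z => ?_)
      simp only
      congr 2
      simp
      ring
    have hPm : Continuous fun ζ => hatKernel φ (-ζ) :=
      (continuous_hatKernel φ.integrable).comp continuous_neg
    have hsw := integral_integral_swap (μ := (volume : Measure ℝ))
      (ν := volume.restrict (Ioi (0 : ℝ)))
      (f := fun ζ r => (r : ℂ)⁻¹ * hatKernel Ψ (ζ / r) * f r * hatKernel φ (-ζ)) (by
        refine ⟨(hKm.mul (hPm.comp continuous_fst).stronglyMeasurable).aestronglyMeasurable, ?_⟩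
        rw [hasFiniteIntegral_iff_enorm, lintegral_prod _ (by
          exact (hKm.mul (hPm.comp continuous_fst).stronglyMeasurable).measurable.enorm.aemeasurable)]
        have hle : ∫⁻ ζ, ∫⁻ r in Ioi (0 : ℝ),
            ‖(r : ℂ)⁻¹ * hatKernel Ψ (ζ / r) * f r * hatKernel φ (-ζ)‖ₑ ≤
            ∫⁻ ζ, g ζ * ‖hatKernel φ (-ζ)‖ₑ := by
          refine lintegral_mono fun ζ => ?_
          simp only [enorm_mul _ (hatKernel φ (-ζ))]
          rw [lintegral_mul_const' _ _ enorm_ne_top]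
          refine mul_le_mul_left (le_mul_of_one_le_left' ?_) _
          rw [ENNReal.one_le_ofReal]
          exact hw1 ζ
        refine hle.trans_lt ?_
        have h2 := sq_lintegral_mul_le (volume : Measure ℝ) (f := g)
          (g := fun ζ => ‖hatKernel φ (-ζ)‖ₑ) hgm.aemeasurable hPm.measurable.enorm.aemeasurable
        have h3 := h2.trans_lt (ENNReal.mul_lt_top hgfin (lintegral_sq_hatKernel_neg_lt_top φ))
        exact (ENNReal.pow_lt_top_iff.1 h3).resolve_right two_ne_zero)
    have e1 : ∀ ζ : ℝ, F ζ * ∫ z, φ z * Complex.exp (Complex.I * inner ℝ z ζ) =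
        ∫ r in Ioi (0 : ℝ), (r : ℂ)⁻¹ * hatKernel Ψ (ζ / r) * f r * hatKernel φ (-ζ) := fun ζ => by
      rw [hP, hF, rayTransform, integral_mul_const]
    have e2 : ∀ r ∈ Ioi (0 : ℝ),
        ∫ ζ : ℝ, (r : ℂ)⁻¹ * hatKernel Ψ (ζ / r) * f r * hatKernel φ (-ζ) =
        2 * Real.pi * ∫ z, Complex.exp (Complex.I * ω * (r * z : ℝ)) * f r * φ z := by
      intro r hr
      have hr0 : (r : ℂ) ≠ 0 := Complex.ofReal_ne_zero.2 (ne_of_gt hr)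
      have h4 := integral_hatKernel_div_mul_integral Ψ hr
        (φ.integrable (μ := (volume : Measure ℝ))) (measurable_id (α := ℝ))
      have h5 : ∀ ζ : ℝ, ∫ z, φ z * Complex.exp (Complex.I * ζ * (id z : ℝ)) = hatKernel φ (-ζ) := by
        intro ζ
        rw [hatKernel]
        refine integral_congr_ae (ae_of_all _ fun z => ?_)
        simp
      simp only [h5] at h4
      have h6 : ∫ z, Complex.exp (Complex.I * ω * (r * z : ℝ)) * f r * φ z =
          f r * ∫ z, Ψ (r * id z) * φ z := by
        rw [← integral_const_mul]
        refine integral_congr_ae (ae_of_all _ fun z => ?_)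
        simp only [id]
        by_cases h0 : φ z = 0
        · simp [h0]
        · rw [hΨ _ (mul_pos hr (hz z h0))]; ring
      rw [h6, mul_left_comm, ← mul_right_inj' hr0, ← mul_assoc, ← mul_assoc, ← mul_assoc]
      calc _ = f r * ∫ ζ : ℝ, hatKernel Ψ (ζ / r) * hatKernel φ (-ζ) := by
            rw [← integral_const_mul, ← integral_const_mul]
            refine integral_congr_ae (ae_of_all _ fun ζ => ?_)
            simp only
            field_simp
        _ = _ := by rw [h4]; ring
    rw [hv.apply_eq_integral, functional,
      setIntegral_eq_integral_of_forall_compl_eq_zero (fun z hz' => by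
        rw [show φ z = 0 from by_contra fun h => hz' (hz z h), mul_zero])]
    simp only [e1]
    rw [hsw, setIntegral_congr_fun measurableSet_Ioi e2, integral_const_mul,
      integral_integral_swap hi]
    simp only [integral_mul_const, Module.finrank_self, pow_one, Complex.real_smul]
    push_cast
    rw [inv_mul_cancel_left₀ (mul_ne_zero two_ne_zero (Complex.ofReal_ne_zero.2 Real.pi_ne_zero))]
  · refine hnorm.trans ((ENNReal.rpow_le_rpow hg2 (by norm_num)).trans (le_of_eq ?_))
    rw [← mul_assoc, ENNReal.mul_rpow_of_nonneg _ _ (by norm_num)]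
    congr 1
    rw [← ENNReal.ofReal_ofNat, ← ENNReal.ofReal_pow hD0, ← ENNReal.ofReal_mul (by positivity),
      ENNReal.ofReal_rpow_of_nonneg (by positivity) (by norm_num), ← Real.sqrt_eq_rpow,
      Real.sqrt_mul (by positivity), Real.sqrt_sq hD0, mul_comm]
    rfl

end HalfLineExtension


/-! ### Bourgain weights along the characteristic curve -/

section BourgainWeight

theorem one_add_pow_le {r : ℝ} (hr : 0 ≤ r) {m : ℕ} (hm : m ≠ 0) : 1 + r ^ m ≤ (1 + r) ^ m := by
  have := pow_add_pow_le zero_le_one hr hm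
  simpa using this

theorem one_add_pow_le_two_pow_mul {r : ℝ} (hr : 0 ≤ r) (m : ℕ) :
    (1 + r) ^ m ≤ 2 ^ m * (1 + r ^ m) := by
  rcases le_total r 1 with h | h
  · calc (1 + r) ^ m ≤ 2 ^ m := by gcongr; linarith
      _ ≤ _ := le_mul_of_one_le_right (by positivity) (by linarith [pow_nonneg hr m])
  · calc (1 + r) ^ m ≤ (2 * r) ^ m := by gcongr; linarith
      _ = 2 ^ m * r ^ m := mul_pow _ _ _
      _ ≤ _ := by gcongr; linarith

theorem bourgainWeight_nonneg (m : ℕ) (s b α ξ τ : ℝ) : 0 ≤ bourgainWeight m s b α ξ τ := by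
  unfold bourgainWeight
  split_ifs <;> positivity

theorem rpow_one_add_mul_le {r y P s : ℝ} (hr : 0 < r) (hy : 0 < y) (h1 : 1 + y ≤ P)
    (h2 : 1 + y⁻¹ ≤ P) : (1 + r * y) ^ (2 * s) ≤ (1 + r) ^ (2 * s) * P ^ (2 * |s|) := by
  have hP : 0 < P := by linarith
  rcases le_total 0 s with h | h
  · rw [abs_of_nonneg h, ← Real.mul_rpow (by positivity) hP.le]
    refine Real.rpow_le_rpow (by positivity) ?_ (by positivity)
    nlinarith
  · have h3 : (1 + r) * P⁻¹ ≤ 1 + r * y := by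
      rw [← div_eq_mul_inv, div_le_iff₀ hP]
      have : (1 + r * y) * (1 + y⁻¹) ≤ (1 + r * y) * P := by gcongr
      have e : (1 + r * y) * (1 + y⁻¹) = 1 + r + r * y + y⁻¹ := by field_simp; ring
      have : 0 < y⁻¹ := by positivity
      nlinarith [mul_pos hr hy]
    calc (1 + r * y) ^ (2 * s) ≤ ((1 + r) * P⁻¹) ^ (2 * s) :=
          Real.rpow_le_rpow_of_nonpos (by positivity) h3 (by linarith)
      _ = _ := by
          rw [Real.mul_rpow (by positivity) (by positivity), Real.inv_rpow hP.le,
            ← Real.rpow_neg hP.le, abs_of_nonpos h, mul_neg]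

theorem bourgainWeight_le {m : ℕ} (hm : m ≠ 0) {s b α : ℝ} (hb : b < 1 / 2)
    (hα : 0 < α) {L : ℕ} (hL1 : 2 * |s| ≤ L) (hL2 : 2 * α * m - (2 * s + m) ≤ L) {ς : ℝ}
    (hς : |ς| = 1) {r y : ℝ} (hr : 0 < r) (hy : y ≠ 0) :
    bourgainWeight m s b α (r * y) (ς * r ^ m) ≤
      2 * (1 + r) ^ (2 * s + m) * ((1 + |y|) ^ 2 / |y|) ^ L * (1 + |y|) ^ m := by
  have ha : 0 < |y| := abs_pos.2 hy
  set a := |y| with hadef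
  set P := (1 + a) ^ 2 / a with hP
  have hP1 : 1 + a ≤ P := by rw [hP, le_div_iff₀ ha]; nlinarith
  have hP2 : 1 + a⁻¹ ≤ P := by
    rw [hP, le_div_iff₀ ha, add_mul, inv_mul_cancel₀ ha.ne']; nlinarith
  have hP3 : 1 ≤ P := by linarith
  have hr1 : 1 ≤ 1 + r := by linarith
  have hPL : ∀ x : ℝ, x ≤ L → P ^ x ≤ P ^ L := fun x hx => by
    rw [← Real.rpow_natCast]
    exact Real.rpow_le_rpow_of_exponent_le hP3 hx
  have t1 : (1 + |r * y|) ^ (2 * s) * (1 + |ς * r ^ m - (r * y) ^ m|) ^ (2 * b) ≤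
      (1 + r) ^ (2 * s + m) * P ^ L * (1 + a) ^ m := by
    have e1 : (1 + |r * y|) ^ (2 * s) ≤ (1 + r) ^ (2 * s) * P ^ L := by
      rw [abs_mul, abs_of_pos hr]
      refine (rpow_one_add_mul_le hr ha hP1 hP2).trans ?_
      gcongr
      exact hPL _ hL1
    have e2 : (1 + |ς * r ^ m - (r * y) ^ m|) ^ (2 * b) ≤ (1 + r) ^ m * (1 + a) ^ m := by
      calc _ ≤ (1 + |ς * r ^ m - (r * y) ^ m|) ^ (1 : ℝ) :=
            Real.rpow_le_rpow_of_exponent_le (by linarith [abs_nonneg (ς * r ^ m - (r * y) ^ m)])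
              (by linarith)
        _ ≤ 1 + (r ^ m + r ^ m * a ^ m) := by
            rw [Real.rpow_one]
            gcongr
            refine (abs_sub _ _).trans (le_of_eq ?_)
            rw [abs_mul, hς, one_mul, abs_pow, abs_pow, abs_mul, abs_of_pos hr, mul_pow]
        _ ≤ (1 + r ^ m) * (1 + a ^ m) := by nlinarith [pow_pos ha m]
        _ ≤ _ := by
            gcongr
            · exact one_add_pow_le hr.le hm
            · exact one_add_pow_le ha.le hm
    calc _ ≤ (1 + r) ^ (2 * s) * P ^ L * ((1 + r) ^ m * (1 + a) ^ m) := by gcongr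
      _ = _ := by rw [Real.rpow_add (by positivity), Real.rpow_natCast]; ring
  have t2 : (if |r * y| ≤ 1 then (1 + |ς * r ^ m|) ^ (2 * α) else 0) ≤
      (1 + r) ^ (2 * s + m) * P ^ L * (1 + a) ^ m := by
    split_ifs with h
    · rw [abs_mul, abs_of_pos hr] at h
      have hrP : 1 + r ≤ P := by
        have : r ≤ a⁻¹ := by rw [← one_div, le_div_iff₀ ha]; exact h
        linarith
      rw [abs_mul, hς, one_mul, abs_of_pos (pow_pos hr m)]
      calc (1 + r ^ m) ^ (2 * α) ≤ ((1 + r) ^ m) ^ (2 * α) :=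
            Real.rpow_le_rpow (by positivity) (one_add_pow_le hr.le hm) (by positivity)
        _ = (1 + r) ^ (2 * s + m) * (1 + r) ^ (2 * α * m - (2 * s + m)) := by
            rw [← Real.rpow_natCast, ← Real.rpow_mul (by positivity), ← Real.rpow_add (by positivity)]
            congr 1; ring
        _ ≤ (1 + r) ^ (2 * s + m) * (1 + r) ^ (L : ℝ) := by
            gcongr
        _ ≤ (1 + r) ^ (2 * s + m) * P ^ L * 1 := by
            rw [Real.rpow_natCast, mul_one]; gcongr
        _ ≤ _ := by
            gcongr
            exact one_le_pow₀ (by linarith)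
    · positivity
  unfold bourgainWeight
  linarith

theorem exists_schwartzMap_eq_exp_bourgainWeight_le {m : ℕ} (hm : m ≠ 0) {s b α : ℝ}
    (hb : b < 1 / 2) (hα : 0 < α) {ω : ℂ} (hω : 0 < ω.im) :
    ∃ Ψ : 𝓢(ℝ, ℂ), (∀ y : ℝ, 0 < y → Ψ y = Complex.exp (Complex.I * ω * y)) ∧
      ∃ D : ℝ, 0 ≤ D ∧ ∀ ς : ℝ, |ς| = 1 → ∀ r : ℝ, 0 < r → ∀ y : ℝ,
        bourgainWeight m s b α (r * y) (ς * r ^ m) * ‖hatKernel Ψ y‖ ^ 2 ≤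
          D * (1 + r) ^ (2 * s + m) * (1 + y ^ 2)⁻¹ := by
  obtain ⟨L, hL⟩ := exists_nat_ge (max (2 * |s|) (max (2 * α * m - (2 * s + m)) 1))
  have hL1 : 2 * |s| ≤ L := (le_max_left _ _).trans hL
  have hL2 : 2 * α * m - (2 * s + m) ≤ L := (le_max_left _ _).trans ((le_max_right _ _).trans hL)
  have hL3 : (1 : ℝ) ≤ L := (le_max_right _ _).trans ((le_max_right _ _).trans hL)
  have hL0 : L ≠ 0 := by rintro rfl; norm_num at hL3
  obtain ⟨Ψ, Φ, h1, h2⟩ := exists_schwartzMap_eq_exp_fourier_eq_pow_mul hω L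
  obtain ⟨C, hC0, hC⟩ := exists_norm_hatKernel_schwartz_pow_le Φ (2 * L + m + 1)
  refine ⟨Ψ, h1, 2 * C ^ 2, by positivity, fun ς hς r hr y => ?_⟩
  have hΨ : ‖hatKernel Ψ y‖ ≤ |y| ^ L * (C * ((1 + |y|) ^ (2 * L + m + 1))⁻¹) := by
    have h3 := h2 ((2 * Real.pi)⁻¹ * y)
    rw [SchwartzMap.fourier_coe, SchwartzMap.fourier_coe, fourier_eq_hatKernel, fourier_eq_hatKernel,
      mul_inv_cancel_left₀ two_pi_ne_zero'] at h3
    rw [h3, norm_mul, norm_pow, Complex.norm_real, Real.norm_eq_abs, abs_mul,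
      abs_of_pos (by positivity : 0 < (2 * Real.pi)⁻¹)]
    refine mul_le_mul (pow_le_pow_left₀ (by positivity) ?_ L) (hC y) (norm_nonneg _) (by positivity)
    refine mul_le_of_le_one_left (abs_nonneg y) (inv_le_one_of_one_le₀ ?_)
    linarith [Real.pi_gt_three]
  rcases eq_or_ne y 0 with rfl | hy
  · rw [abs_zero, zero_pow hL0, zero_mul] at hΨ
    rw [le_antisymm hΨ (norm_nonneg _)]
    simp only [ne_eq, OfNat.ofNat_ne_zero, not_false_eq_true, zero_pow, mul_zero]
    positivity
  have ha : 0 < |y| := abs_pos.2 hy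
  have hw := bourgainWeight_le hm hb hα hL1 hL2 hς hr hy
  calc _ ≤ 2 * (1 + r) ^ (2 * s + m) * ((1 + |y|) ^ 2 / |y|) ^ L * (1 + |y|) ^ m *
        (|y| ^ L * (C * ((1 + |y|) ^ (2 * L + m + 1))⁻¹)) ^ 2 := by gcongr
    _ = 2 * C ^ 2 * (1 + r) ^ (2 * s + m) *
        (|y| ^ L * ((1 + |y|) ^ (2 * L + m + 2))⁻¹) := by
        rw [div_pow, ← pow_mul]
        field_simp
        ring
    _ ≤ _ := by
        gcongr
        rw [← div_eq_mul_inv, ← one_div, div_le_div_iff₀ (by positivity) (by positivity), one_mul]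
        calc |y| ^ L * (1 + y ^ 2) ≤ (1 + |y|) ^ L * (1 + |y|) ^ 2 := by
              gcongr
              · linarith
              · rw [← sq_abs]; nlinarith
          _ = (1 + |y|) ^ (L + 2) := by rw [pow_add]
          _ ≤ _ := pow_le_pow_right₀ (by linarith) (by lia)

/-- The modulus of the frequency `ξ` with `|ξ|^m = |τ|`. -/
def radius (m : ℕ) (τ : ℝ) : ℝ := |τ| ^ ((m : ℝ)⁻¹)

theorem radius_pow {m : ℕ} (hm : m ≠ 0) (τ : ℝ) : radius m τ ^ m = |τ| :=
  Real.rpow_inv_natCast_pow (abs_nonneg τ) hm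

theorem radius_mul_pow {m : ℕ} (hm : m ≠ 0) {ς r : ℝ} (hς : |ς| = 1) (hr : 0 < r) :
    radius m (ς * r ^ m) = r := by
  rw [radius, abs_mul, hς, one_mul, abs_of_pos (pow_pos hr m), Real.pow_rpow_inv_natCast hr.le hm]

theorem radius_pos {m : ℕ} {τ : ℝ} (hτ : τ ≠ 0) : 0 < radius m τ :=
  Real.rpow_pos_of_pos (abs_pos.2 hτ) _

theorem rpow_one_add_radius_le {m : ℕ} (hm : m ≠ 0) (μ τ : ℝ) :
    (1 + radius m τ) ^ (m * (2 * μ)) ≤ (2 ^ m) ^ (2 * |μ|) * (1 + |τ|) ^ (2 * μ) := by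
  have hr : 0 ≤ radius m τ := Real.rpow_nonneg (abs_nonneg τ) _
  rw [← radius_pow hm τ, Real.rpow_mul (by positivity), Real.rpow_natCast]
  rcases le_total 0 μ with h | h
  · rw [abs_of_nonneg h, ← Real.mul_rpow (by positivity) (by positivity)]
    exact Real.rpow_le_rpow (by positivity) (one_add_pow_le_two_pow_mul hr m) (by positivity)
  · calc _ ≤ (1 + radius m τ ^ m) ^ (2 * μ) :=
          Real.rpow_le_rpow_of_nonpos (by positivity) (one_add_pow_le hr hm) (by linarith)
      _ ≤ _ := le_mul_of_one_le_left (by positivity)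
          (Real.one_le_rpow (one_le_pow₀ (by norm_num)) (by positivity))

theorem exists_lintegral_radius_le {j ℓ : ℕ} (hℓ : ℓ < j) (s : ℝ) :
    ∃ C : ℝ≥0, ∀ (H : ℝ → ℂ) (B : ℝ), StronglyMeasurable H → 0 ≤ B →
      (∀ z, ‖H z‖ ≤ B * (1 + |z|)) →
      ∫⁻ τ, ENNReal.ofReal ((radius (2 * j + 1) τ)⁻¹ ^ (2 * ℓ + 1) *
        (1 + radius (2 * j + 1) τ) ^ (2 * s + (2 * j + 1 : ℕ))) * ‖H τ‖ₑ ^ 2 ≤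
        C * (jnorm ((s + j - ℓ) / (2 * j + 1)) H + ENNReal.ofReal B) ^ 2 := by
  set m := 2 * j + 1 with hm
  set μ : ℝ := (s + j - ℓ) / (2 * j + 1) with hμ
  have hm0 : m ≠ 0 := by lia
  have hmR : (m : ℝ) = 2 * j + 1 := by push_cast [hm]; ring
  have hmpos : (0 : ℝ) < m := by rw [hmR]; positivity
  set γ : ℝ := (2 * ℓ + 1) / m with hγ
  have hγ1 : -1 < -γ := by
    have : (ℓ : ℝ) + 1 ≤ j := by exact_mod_cast hℓ
    rw [neg_lt_neg_iff, hγ, div_lt_one hmpos, hmR]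
    linarith
  set K : ℝ := 2 ^ (2 * ℓ + 1) * (2 ^ m) ^ (2 * |μ|) with hK
  set K' : ℝ := 4 * 2 ^ |2 * s + m| with hK'
  set J : ℝ≥0∞ := ∫⁻ τ in Ioo (-1 : ℝ) 1, ENNReal.ofReal (|τ| ^ (-γ)) with hJ
  have hJfin : J < ⊤ := by
    have h0 : IntegrableOn (fun τ : ℝ => τ ^ (-γ)) (Ioo 0 1) :=
      (intervalIntegral.integrableOn_Ioo_rpow_iff one_pos).2 hγ1
    have e : J = ∫⁻ τ : ℝ, (Iio (1 : ℝ)).indicator (fun τ => ENNReal.ofReal (τ ^ (-γ))) |τ| := by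
      rw [hJ, ← lintegral_indicator measurableSet_Ioo]
      refine lintegral_congr fun τ => ?_
      simp only [indicator, mem_Ioo, mem_Iio, abs_lt]
    rw [e, lintegral_abs_eq]
    refine ENNReal.mul_lt_top (by simp) ?_
    rw [setLIntegral_indicator measurableSet_Iio, inter_comm, Ioi_inter_Iio]
    exact h0.setLIntegral_lt_top
  have hpt : ∀ (H : ℝ → ℂ) (B : ℝ), 0 ≤ B → (∀ z, ‖H z‖ ≤ B * (1 + |z|)) → ∀ τ, τ ≠ 0 →
      ENNReal.ofReal ((radius m τ)⁻¹ ^ (2 * ℓ + 1) * (1 + radius m τ) ^ (2 * s + m)) * ‖H τ‖ₑ ^ 2 ≤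
      ENNReal.ofReal K * ‖(((1 + |τ|) ^ μ : ℝ) : ℂ) * H τ‖ₑ ^ 2 +
        ENNReal.ofReal (K' * B ^ 2) *
          (Ioo (-1 : ℝ) 1).indicator (fun τ => ENNReal.ofReal (|τ| ^ (-γ))) τ := by
    intro H B hB0 hB τ hτ
    have hr : 0 < radius m τ := radius_pos hτ
    have hrm := radius_pow hm0 τ
    set r := radius m τ
    rcases lt_or_ge |τ| 1 with h | h
    · refine le_add_of_nonneg_of_le bot_le ?_
      rw [indicator_of_mem (mem_Ioo.2 (abs_lt.1 h)), ← ofReal_norm, ← ENNReal.ofReal_pow (norm_nonneg _),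
        ← ENNReal.ofReal_mul (by positivity), ← ENNReal.ofReal_mul (by positivity)]
      refine ENNReal.ofReal_le_ofReal ?_
      have hr1 : r ≤ 1 := by
        by_contra hc
        have := one_lt_pow₀ (not_le.1 hc) hm0
        linarith
      have e1 : r⁻¹ ^ (2 * ℓ + 1) = |τ| ^ (-γ) := by
        rw [← hrm, ← Real.rpow_natCast_mul hr.le, inv_pow, ← Real.rpow_natCast r,
          ← Real.rpow_neg hr.le]
        congr 1
        rw [hγ]; push_cast; field_simp
      have e2 : (1 + r) ^ (2 * s + m) ≤ 2 ^ |2 * s + (m : ℝ)| := by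
        calc (1 + r) ^ (2 * s + m) ≤ (1 + r) ^ |2 * s + (m : ℝ)| :=
              Real.rpow_le_rpow_of_exponent_le (by linarith) (le_abs_self _)
          _ ≤ _ := Real.rpow_le_rpow (by positivity) (by linarith) (abs_nonneg _)
      have e3 : ‖H τ‖ ≤ 2 * B := (hB τ).trans (by nlinarith)
      rw [e1]
      calc _ ≤ |τ| ^ (-γ) * 2 ^ |2 * s + (m : ℝ)| * (2 * B) ^ 2 := by gcongr
        _ = _ := by rw [hK']; ring
    · refine le_add_of_le_of_nonneg ?_ bot_le
      have hr1 : 1 ≤ r := by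
        by_contra hc
        have := pow_lt_one₀ hr.le (not_le.1 hc) hm0
        linarith
      rw [enorm_mul, ← ofReal_norm (((1 + |τ|) ^ μ : ℝ) : ℂ), Complex.norm_real,
        Real.norm_of_nonneg (by positivity), mul_pow, ← ENNReal.ofReal_pow (by positivity),
        ← mul_assoc, ← ENNReal.ofReal_mul (by positivity)]
      refine mul_le_mul_left (ENNReal.ofReal_le_ofReal ?_) _
      have e1 : r⁻¹ ^ (2 * ℓ + 1) ≤ 2 ^ (2 * ℓ + 1) * ((1 + r) ^ (2 * ℓ + 1))⁻¹ := by
        rw [← inv_pow, ← mul_pow]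
        gcongr
        rw [← div_eq_mul_inv, le_div_iff₀ (by positivity), inv_mul_le_iff₀ hr]
        linarith
      have e2 : ((1 + r) ^ (2 * ℓ + 1))⁻¹ * (1 + r) ^ (2 * s + m) = (1 + r) ^ (m * (2 * μ)) := by
        rw [← Real.rpow_natCast, ← Real.rpow_neg (by positivity), ← Real.rpow_add (by positivity)]
        congr 1
        rw [hμ, hmR]; push_cast; field_simp; ring
      calc _ ≤ 2 ^ (2 * ℓ + 1) * ((1 + r) ^ (2 * ℓ + 1))⁻¹ * (1 + r) ^ (2 * s + m) := by gcongr
        _ = 2 ^ (2 * ℓ + 1) * (1 + r) ^ (m * (2 * μ)) := by rw [mul_assoc, e2]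
        _ ≤ 2 ^ (2 * ℓ + 1) * ((2 ^ m) ^ (2 * |μ|) * (1 + |τ|) ^ (2 * μ)) := by
            gcongr
            exact rpow_one_add_radius_le hm0 μ τ
        _ = K * ((1 + |τ|) ^ μ) ^ 2 := by
            rw [hK, ← Real.rpow_mul_natCast (by positivity)]
            push_cast
            ring_nf
  refine ⟨(ENNReal.ofReal K + ENNReal.ofReal K' * J).toNNReal, fun H B hH hB0 hB => ?_⟩
  rw [ENNReal.coe_toNNReal (by finiteness)]
  have hj : ∫⁻ τ, ‖(((1 + |τ|) ^ μ : ℝ) : ℂ) * H τ‖ₑ ^ 2 = jnorm μ H ^ 2 := by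
    rw [jnorm, eLpNorm_eq_lintegral_rpow_enorm_toReal two_ne_zero ENNReal.ofNat_ne_top,
      ← ENNReal.rpow_two, ← ENNReal.rpow_mul]
    simp
  calc _ ≤ ∫⁻ τ, (ENNReal.ofReal K * ‖(((1 + |τ|) ^ μ : ℝ) : ℂ) * H τ‖ₑ ^ 2 +
        ENNReal.ofReal (K' * B ^ 2) *
          (Ioo (-1 : ℝ) 1).indicator (fun τ => ENNReal.ofReal (|τ| ^ (-γ))) τ) := by
        refine lintegral_mono_ae ?_
        filter_upwards [compl_mem_ae_iff.2 (measure_singleton (0 : ℝ))] with τ hτ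
        exact hpt H B hB0 hB τ hτ
    _ = ENNReal.ofReal K * jnorm μ H ^ 2 + ENNReal.ofReal K' * J * ENNReal.ofReal B ^ 2 := by
        rw [lintegral_add_left' ?_, lintegral_const_mul' _ _ ENNReal.ofReal_ne_top,
          lintegral_const_mul' _ _ ENNReal.ofReal_ne_top, hj,
          lintegral_indicator measurableSet_Ioo, ← hJ, ENNReal.ofReal_mul (q := B ^ 2) (by positivity),
          ENNReal.ofReal_pow hB0, mul_right_comm]
        exact (((Complex.continuous_ofReal.comp
          (continuous_one_add_abs_rpow μ)).measurable.mul hH.measurable).enorm.pow_const 2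
            |>.const_mul _).aemeasurable
    _ ≤ _ := by
        rw [add_mul]
        gcongr
        · exact le_self_add
        · exact le_add_self

end BourgainWeight


section StripExtension

open Filter Topology

/-- The two coordinates of a point of the plane. -/
def planeEquiv : EuclideanSpace ℝ (Fin 2) ≃ᵐ ℝ × ℝ :=
  (MeasurableEquiv.toLp 2 (Fin 2 → ℝ)).symm.trans MeasurableEquiv.finTwoArrow

theorem planeEquiv_apply (z : EuclideanSpace ℝ (Fin 2)) : planeEquiv z = (z 0, z 1) := rfl

theorem measurePreserving_planeEquiv : MeasurePreserving planeEquiv :=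
  (volume_preserving_finTwoArrow ℝ).comp
    (EuclideanSpace.volume_preserving_symm_measurableEquiv_toLp (Fin 2))

theorem integral_ite_pos_mul_eq {m : ℕ} (hm : m ≠ 0) {ς : ℝ} (hς : |ς| = 1) (Θ : ℝ → ℂ) :
    ∫ τ, (if 0 < ς * τ then Θ τ else 0) =
      ∫ r in Ioi (0 : ℝ), ((m * r ^ (m - 1) : ℝ) : ℂ) * Θ (ς * r ^ m) := by
  have hςς : ς * ς = 1 := by rw [← abs_mul_abs_self, hς, one_mul]
  have h1 := Measure.integral_comp_mul_left (fun τ => if 0 < ς * τ then Θ τ else 0) ς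
  rw [abs_inv, hς, inv_one, one_smul] at h1
  have h2 : ∫ τ, (if 0 < ς * (ς * τ) then Θ (ς * τ) else 0) = ∫ τ in Ioi (0 : ℝ), Θ (ς * τ) := by
    rw [← integral_indicator measurableSet_Ioi]
    refine integral_congr_ae (ae_of_all _ fun τ => ?_)
    simp only [← mul_assoc, hςς, one_mul, indicator, mem_Ioi]
  have hm0 : (0 : ℝ) < m := by exact_mod_cast Nat.pos_of_ne_zero hm
  rw [← h1, h2, ← integral_comp_rpow_Ioi_of_pos (g := fun τ => Θ (ς * τ)) hm0]
  refine setIntegral_congr_fun measurableSet_Ioi fun r hr => ?_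
  have e : r ^ ((m : ℝ) - 1) = r ^ (m - 1) := by
    rw [← Nat.cast_pred (Nat.pos_of_ne_zero hm), Real.rpow_natCast]
  simp only [Real.rpow_natCast, Complex.real_smul, e]

/-- The Fourier transform of the extension of the contribution of one ray. -/
def stripTransform (m ℓ : ℕ) (ς : ℝ) (Ψ : 𝓢(ℝ, ℂ)) (H : ℝ → ℂ) (p : ℝ × ℝ) : ℂ :=
  if 0 < ς * p.2 then (2 * Real.pi / m : ℂ) * ((radius m p.2 : ℂ)⁻¹ ^ (ℓ + 1) *
    hatKernel Ψ (p.1 / radius m p.2) * H p.2) else 0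

theorem measurable_radius (m : ℕ) : Measurable (radius m) := by
  unfold radius; fun_prop

theorem measurable_stripTransform (m ℓ : ℕ) (ς : ℝ) (Ψ : 𝓢(ℝ, ℂ)) {H : ℝ → ℂ}
    (hH : StronglyMeasurable H) : Measurable (stripTransform m ℓ ς Ψ H) := by
  have hr : Measurable fun p : ℝ × ℝ => radius m p.2 := (measurable_radius m).comp measurable_snd
  refine Measurable.ite (measurableSet_lt measurable_const (by fun_prop)) ?_ measurable_const
  refine measurable_const.mul ((Measurable.mul ?_ ?_).mul (hH.measurable.comp measurable_snd))
  · exact (Complex.measurable_ofReal.comp hr).inv.pow_const _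
  · exact (continuous_hatKernel Ψ.integrable).measurable.comp (measurable_fst.div hr)

theorem eq_mul_radius_pow {m : ℕ} (hm : m ≠ 0) {ς τ : ℝ} (hς : |ς| = 1) (h : 0 < ς * τ) :
    τ = ς * radius m τ ^ m := by
  have e : |τ| = ς * τ := by rw [← abs_of_pos h, abs_mul, hς, one_mul]
  have hςς : ς * ς = 1 := by rw [← abs_mul_abs_self, hς, one_mul]
  rw [radius_pow hm, e, ← mul_assoc, hςς, one_mul]

theorem lintegral_inv_one_add_div_sq {r : ℝ} (hr : 0 < r) :
    ∫⁻ ξ : ℝ, ENNReal.ofReal (1 + (ξ / r) ^ 2)⁻¹ = ENNReal.ofReal (r * Real.pi) := by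
  have hi : Integrable fun ξ : ℝ => (1 + (ξ / r) ^ 2)⁻¹ :=
    (integrable_inv_one_add_sq).comp_div hr.ne'
  rw [← ofReal_integral_eq_lintegral_ofReal hi (ae_of_all _ fun ξ => by positivity),
    Measure.integral_comp_div (fun y : ℝ => (1 + y ^ 2)⁻¹), integral_univ_inv_one_add_sq,
    abs_of_pos hr, smul_eq_mul]

theorem lintegral_weight_mul_stripTransform_le {m : ℕ} (hm : m ≠ 0) (ℓ : ℕ) {ς : ℝ}
    (hς : |ς| = 1) {s b α D : ℝ} (hD0 : 0 ≤ D) {Ψ : 𝓢(ℝ, ℂ)}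
    (hD : ∀ r : ℝ, 0 < r → ∀ y : ℝ,
        bourgainWeight m s b α (r * y) (ς * r ^ m) * ‖hatKernel Ψ y‖ ^ 2 ≤
          D * (1 + r) ^ (2 * s + m) * (1 + y ^ 2)⁻¹)
    {H : ℝ → ℂ} (hH : StronglyMeasurable H) :
    ∫⁻ p : ℝ × ℝ, ENNReal.ofReal (bourgainWeight m s b α p.1 p.2) *
        ‖stripTransform m ℓ ς Ψ H p‖ₑ ^ 2 ≤
      ENNReal.ofReal ((2 * Real.pi / m) ^ 2 * D * Real.pi) *
        ∫⁻ τ, ENNReal.ofReal ((radius m τ)⁻¹ ^ (2 * ℓ + 1) * (1 + radius m τ) ^ (2 * s + m)) *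
          ‖H τ‖ₑ ^ 2 := by
  have hwm : Measurable fun p : ℝ × ℝ => bourgainWeight m s b α p.1 p.2 := by
    unfold bourgainWeight
    refine Measurable.add (by fun_prop) (Measurable.ite ?_ (by fun_prop) measurable_const)
    exact measurableSet_le (by fun_prop) measurable_const
  have hFm := measurable_stripTransform m ℓ ς Ψ hH
  rw [Measure.volume_eq_prod, lintegral_prod_symm _ (by
      exact (hwm.ennreal_ofReal.mul (hFm.enorm.pow_const 2)).aemeasurable), ← lintegral_const_mul' _ _ ENNReal.ofReal_ne_top]
  refine lintegral_mono fun τ => ?_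
  by_cases h : 0 < ς * τ
  swap
  · simp [stripTransform, h]
  have hτ0 : τ ≠ 0 := by rintro rfl; simp at h
  have hr : 0 < radius m τ := radius_pos hτ0
  have hτ := eq_mul_radius_pow hm hς h
  set r := radius m τ with hrdef
  have hpt : ∀ ξ : ℝ, ENNReal.ofReal (bourgainWeight m s b α ξ τ) *
      ‖stripTransform m ℓ ς Ψ H (ξ, τ)‖ₑ ^ 2 ≤
      ENNReal.ofReal ((2 * Real.pi / m) ^ 2 * D * r⁻¹ ^ (2 * ℓ + 2) * (1 + r) ^ (2 * s + m)) *
        ‖H τ‖ₑ ^ 2 * ENNReal.ofReal (1 + (ξ / r) ^ 2)⁻¹ := by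
    intro ξ
    have e : ‖stripTransform m ℓ ς Ψ H (ξ, τ)‖ =
        2 * Real.pi / m * (r⁻¹ ^ (ℓ + 1) * ‖hatKernel Ψ (ξ / r)‖ * ‖H τ‖) := by
      rw [stripTransform, if_pos h, ← hrdef]
      simp only [norm_mul, norm_pow, norm_inv, norm_div, Complex.norm_real, Complex.norm_natCast,
        Complex.norm_ofNat, Real.norm_of_nonneg hr.le, Real.norm_of_nonneg Real.pi_pos.le]
    have hw := hD r hr (ξ / r)
    rw [mul_div_cancel₀ _ hr.ne', ← hτ] at hw
    rw [← ofReal_norm, ← ofReal_norm, ← ENNReal.ofReal_pow (norm_nonneg _),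
      ← ENNReal.ofReal_pow (norm_nonneg _), ← ENNReal.ofReal_mul (bourgainWeight_nonneg _ _ _ _ _ _),
      ← ENNReal.ofReal_mul (by positivity), ← ENNReal.ofReal_mul (by positivity), e]
    refine ENNReal.ofReal_le_ofReal ?_
    calc _ = (2 * Real.pi / m) ^ 2 * r⁻¹ ^ (2 * ℓ + 2) * ‖H τ‖ ^ 2 *
          (bourgainWeight m s b α ξ τ * ‖hatKernel Ψ (ξ / r)‖ ^ 2) := by ring
      _ ≤ (2 * Real.pi / m) ^ 2 * r⁻¹ ^ (2 * ℓ + 2) * ‖H τ‖ ^ 2 *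
          (D * (1 + r) ^ (2 * s + m) * (1 + (ξ / r) ^ 2)⁻¹) := by gcongr
      _ = _ := by ring
  calc _ ≤ ∫⁻ ξ : ℝ, ENNReal.ofReal ((2 * Real.pi / m) ^ 2 * D * r⁻¹ ^ (2 * ℓ + 2) *
        (1 + r) ^ (2 * s + m)) * ‖H τ‖ₑ ^ 2 * ENNReal.ofReal (1 + (ξ / r) ^ 2)⁻¹ :=
        lintegral_mono hpt
    _ = ENNReal.ofReal ((2 * Real.pi / m) ^ 2 * D * r⁻¹ ^ (2 * ℓ + 2) *
        (1 + r) ^ (2 * s + m)) * ‖H τ‖ₑ ^ 2 * ENNReal.ofReal (r * Real.pi) := by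
        rw [lintegral_const_mul' _ _ (ENNReal.mul_ne_top ENNReal.ofReal_ne_top (by finiteness)),
          lintegral_inv_one_add_div_sq hr]
    _ = _ := by
        rw [mul_right_comm, ← ENNReal.ofReal_mul (by positivity),
          ← mul_assoc (ENNReal.ofReal _) (ENNReal.ofReal _), ← ENNReal.ofReal_mul (by positivity)]
        congr 2
        rw [pow_succ r⁻¹ (2 * ℓ + 1)]
        field_simp

theorem integral_stripTransform_mul_eq {m ℓ : ℕ} {ς : ℝ} {Ψ : 𝓢(ℝ, ℂ)} {H : ℝ → ℂ}
    (φ : 𝓢(EuclideanSpace ℝ (Fin 2), ℂ)) {τ : ℝ} (h : 0 < ς * τ) :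
    ∫ ξ : ℝ, stripTransform m ℓ ς Ψ H (ξ, τ) *
        ∫ z, φ z * Complex.exp (Complex.I * (z 0 * ξ + z 1 * τ : ℝ)) =
      (2 * Real.pi) ^ 2 / m * ((radius m τ : ℂ)⁻¹ ^ ℓ * H τ *
        ∫ z, Ψ (radius m τ * z 0) * (φ z * Complex.exp (Complex.I * (τ * z 1 : ℝ)))) := by
  have hτ0 : τ ≠ 0 := by rintro rfl; simp at h
  have hr : 0 < radius m τ := radius_pos hτ0
  set r := radius m τ with hrdef
  have hr0 : (r : ℂ) ≠ 0 := Complex.ofReal_ne_zero.2 hr.ne'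
  have hg : Integrable fun z : EuclideanSpace ℝ (Fin 2) =>
      φ z * Complex.exp (Complex.I * (τ * z 1 : ℝ)) := by
    refine (φ.integrable (μ := volume)).mono
      (φ.continuous.aestronglyMeasurable.mul (by fun_prop)) (ae_of_all _ fun z => ?_)
    rw [norm_mul, mul_comm Complex.I, Complex.norm_exp_ofReal_mul_I, mul_one]
  have h1 := integral_hatKernel_div_mul_integral Ψ hr hg (X := fun z => z 0) (by fun_prop)
  have h2 : ∀ ξ : ℝ, ∫ z : EuclideanSpace ℝ (Fin 2),
      φ z * Complex.exp (Complex.I * (τ * z 1 : ℝ)) * Complex.exp (Complex.I * ξ * (z 0 : ℝ)) =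
      ∫ z, φ z * Complex.exp (Complex.I * (z 0 * ξ + z 1 * τ : ℝ)) := by
    intro ξ
    refine integral_congr_ae (ae_of_all _ fun z => ?_)
    simp only
    rw [mul_assoc, ← Complex.exp_add]
    congr 2
    push_cast
    ring
  simp only [h2] at h1
  calc _ = ∫ ξ : ℝ, (2 * Real.pi / m : ℂ) * ((r : ℂ)⁻¹ ^ (ℓ + 1) * H τ) * (hatKernel Ψ (ξ / r) *
        ∫ z, φ z * Complex.exp (Complex.I * (z 0 * ξ + z 1 * τ : ℝ))) := by
        refine integral_congr_ae (ae_of_all _ fun ξ => ?_)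
        simp only [stripTransform, if_pos h, ← hrdef]
        ring
    _ = _ := by
        rw [integral_const_mul, h1, pow_succ]
        field_simp

theorem rpow_neg_abs_le_sqrt_bourgainWeight {m : ℕ} {s b α : ℝ} (hb : 0 ≤ b)
    (ζ : EuclideanSpace ℝ (Fin 2)) :
    (1 + ‖ζ‖ ^ 2) ^ (-|s|) ≤ 2 ^ |s| * √(bourgainWeight m s b α (ζ 0) (ζ 1)) := by
  have h0 : 0 < 1 + |ζ 0| := one_add_abs_pos _
  have hw : ((1 + |ζ 0|) ^ s) ^ 2 ≤ bourgainWeight m s b α (ζ 0) (ζ 1) := by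
    rw [← Real.rpow_mul_natCast h0.le, mul_comm, Nat.cast_ofNat]
    have h1 : (1 : ℝ) ≤ (1 + |ζ 1 - ζ 0 ^ m|) ^ (2 * b) :=
      Real.one_le_rpow (by linarith [abs_nonneg (ζ 1 - ζ 0 ^ m)]) (by positivity)
    unfold bourgainWeight
    refine le_add_of_le_of_nonneg (le_mul_of_one_le_right (by positivity) h1) ?_
    split_ifs <;> positivity
  have h2 : (1 + |ζ 0|) ^ s ≤ √(bourgainWeight m s b α (ζ 0) (ζ 1)) := Real.le_sqrt_of_sq_le hw
  have h3 : 1 + |ζ 0| ≤ 2 * (1 + ‖ζ‖ ^ 2) := by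
    have h4 : |ζ 0| ≤ ‖ζ‖ := PiLp.norm_apply_le ζ 0
    nlinarith [sq_nonneg (‖ζ‖ - 1)]
  calc (1 + ‖ζ‖ ^ 2) ^ (-|s|) = 2 ^ |s| * (2 * (1 + ‖ζ‖ ^ 2)) ^ (-|s|) := by
        rw [Real.mul_rpow (by norm_num) (by positivity), ← mul_assoc, ← Real.rpow_add (by norm_num),
          add_neg_cancel, Real.rpow_zero, one_mul]
    _ ≤ 2 ^ |s| * (1 + |ζ 0|) ^ (-|s|) := by
        refine mul_le_mul_of_nonneg_left ?_ (by positivity)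
        exact Real.rpow_le_rpow_of_nonpos h0 h3 (neg_nonpos.2 (abs_nonneg s))
    _ ≤ 2 ^ |s| * (1 + |ζ 0|) ^ s := by
        refine mul_le_mul_of_nonneg_left ?_ (by positivity)
        exact Real.rpow_le_rpow_of_exponent_le (by linarith [abs_nonneg (ζ 0)]) (neg_abs_le s)
    _ ≤ _ := by gcongr

theorem exists_hasExtension_halfStrip {j ℓ : ℕ} (hℓ : ℓ < j) {s b α : ℝ} (hb0 : 0 ≤ b)
    (hb : b < 1 / 2) (hα : 0 < α) {ω : ℂ} (hω : 0 < ω.im) {ς : ℝ} (hς : |ς| = 1) :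
    ∃ C : ℝ≥0, ∀ (H : ℝ → ℂ) (B : ℝ), StronglyMeasurable H → 0 ≤ B →
      (∀ z, ‖H z‖ ≤ B * (1 + |z|)) → jnorm ((s + j - ℓ) / (2 * j + 1)) H < ⊤ → ∀ T : ℝ,
      HasExtension (halfStrip T) (fun ζ => bourgainWeight (2 * j + 1) s b α (ζ 0) (ζ 1))
        (fun z => ∫ r in Ioi (0 : ℝ), Complex.exp (Complex.I * ω * (r * z 0 : ℝ)) *
          (r ^ (2 * j - ℓ) * H (ς * r ^ (2 * j + 1))) *
            Complex.exp (Complex.I * (ς * r ^ (2 * j + 1) * z 1 : ℝ)))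
        (C * (jnorm ((s + j - ℓ) / (2 * j + 1)) H + ENNReal.ofReal B)) := by
  have hm : 2 * j + 1 ≠ 0 := by lia
  obtain ⟨Ψ, hΨ, D, hD0, hD⟩ := exists_schwartzMap_eq_exp_bourgainWeight_le (s := s) hm hb hα hω
  obtain ⟨C, hC⟩ := exists_lintegral_radius_le hℓ s
  set m := 2 * j + 1 with hmdef
  set K : ℝ := (2 * Real.pi / m) ^ 2 * D * Real.pi with hK
  refine ⟨((ENNReal.ofReal K * C) ^ (1 / 2 : ℝ)).toNNReal, fun H B hH hB0 hB hj T => ?_⟩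
  rw [ENNReal.coe_toNNReal (by finiteness)]
  set N := jnorm ((s + j - ℓ) / (2 * j + 1)) H + ENNReal.ofReal B with hN
  have hNfin : N < ⊤ := ENNReal.add_lt_top.2 ⟨hj, ENNReal.ofReal_lt_top⟩
  set w : EuclideanSpace ℝ (Fin 2) → ℝ := fun ζ => bourgainWeight m s b α (ζ 0) (ζ 1) with hw
  set F : EuclideanSpace ℝ (Fin 2) → ℂ := fun ζ => stripTransform m ℓ ς Ψ H (ζ 0, ζ 1) with hF
  have hFm : Measurable F := (measurable_stripTransform m ℓ ς Ψ hH).comp planeEquiv.measurable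
  have hnorm : eLpNorm (fun ζ => (√(w ζ) : ℂ) * F ζ) 2 ≤ (ENNReal.ofReal K * C) ^ (1 / 2 : ℝ) * N := by
    have h1 := lintegral_weight_mul_stripTransform_le hm ℓ hς hD0 (hD ς hς) hH
    have h2 := h1.trans (mul_le_mul_right (hC H B hH hB0 hB) _)
    rw [← measurePreserving_planeEquiv.lintegral_comp_emb planeEquiv.measurableEmbedding] at h2
    rw [eLpNorm_eq_lintegral_rpow_enorm_toReal two_ne_zero ENNReal.ofNat_ne_top]
    simp only [ENNReal.toReal_ofNat, ENNReal.rpow_two]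
    calc _ ≤ (ENNReal.ofReal K * (C * N ^ 2)) ^ (1 / 2 : ℝ) := by
          refine ENNReal.rpow_le_rpow (le_trans (le_of_eq ?_) h2) (by norm_num)
          refine lintegral_congr fun ζ => ?_
          rw [enorm_mul, mul_pow, ← ofReal_norm (√(w ζ) : ℂ), Complex.norm_real,
            Real.norm_of_nonneg (Real.sqrt_nonneg _), ← ENNReal.ofReal_pow (Real.sqrt_nonneg _),
            Real.sq_sqrt (bourgainWeight_nonneg _ _ _ _ _ _)]
          rfl
      _ = _ := by
          rw [← mul_assoc, ENNReal.mul_rpow_of_nonneg _ _ (by norm_num), ← ENNReal.rpow_two,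
            ← ENNReal.rpow_mul]
          norm_num
  have hwm : Measurable w := by
    rw [hw]
    unfold bourgainWeight
    refine Measurable.add (by fun_prop) (Measurable.ite ?_ (by fun_prop) measurable_const)
    exact measurableSet_le (by fun_prop) measurable_const
  have hwF2 : MemLp (fun ζ => (√(w ζ) : ℂ) * F ζ) 2 :=
    ⟨((Complex.measurable_ofReal.comp hwm.sqrt).mul hFm).aestronglyMeasurable,
      hnorm.trans_lt (by finiteness)⟩
  obtain ⟨v, hv⟩ := exists_hasFourierFunction (F := F) (r := |s|)
    ((hwF2.const_mul ((2 ^ |s| : ℝ) : ℂ)).of_le (by fun_prop) (ae_of_all _ fun ζ => by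
      have h1 := rpow_neg_abs_le_sqrt_bourgainWeight (m := m) (s := s) (α := α) hb0 ζ
      rw [norm_mul, norm_mul, norm_mul, Complex.norm_real, Complex.norm_real, Complex.norm_real,
        Real.norm_of_nonneg (by positivity), Real.norm_of_nonneg (by positivity),
        Real.norm_of_nonneg (Real.sqrt_nonneg _), ← mul_assoc]
      gcongr))
  set f : ℝ → ℂ := fun r => r ^ (2 * j - ℓ) * H (ς * r ^ m) with hf
  have hfm : StronglyMeasurable f :=
    (by fun_prop : Continuous fun r : ℝ => (r : ℂ) ^ (2 * j - ℓ)).stronglyMeasurable.mul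
      (hH.comp_measurable (by fun_prop))
  have hpos : ∀ φ : 𝓢(EuclideanSpace ℝ (Fin 2), ℂ), tsupport φ ⊆ halfStrip T →
      ∀ z, φ z ≠ 0 → z ∈ halfStrip T := fun φ hs z h => hs (subset_tsupport φ h)
  have hprod : ∀ φ : 𝓢(EuclideanSpace ℝ (Fin 2), ℂ), HasCompactSupport φ →
      tsupport φ ⊆ halfStrip T →
      Integrable (fun p : ℝ × EuclideanSpace ℝ (Fin 2) =>
        Complex.exp (Complex.I * ω * (p.1 * p.2 0 : ℝ)) * f p.1 *
          Complex.exp (Complex.I * (ς * p.1 ^ m * p.2 1 : ℝ)) * φ p.2)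
        ((volume.restrict (Ioi (0 : ℝ))).prod volume) := by
    intro φ hφ hs'
    obtain ⟨δ, hδ0, hδ⟩ : ∃ δ : ℝ, 0 < δ ∧ ∀ z ∈ tsupport φ, δ ≤ z 0 := by
      rcases (tsupport φ).eq_empty_or_nonempty with h | h
      · exact ⟨1, one_pos, by simp [h]⟩
      · obtain ⟨x, hx, hxm⟩ := hφ.isCompact.exists_isMinOn h
          (f := fun z : EuclideanSpace ℝ (Fin 2) => z 0) (by fun_prop)
        exact ⟨x 0, (hs' hx).1, fun z hz => hxm hz⟩
    have hδω : 0 < ω.im * δ := mul_pos hω hδ0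
    refine integrable_ray_mul hω hfm.aestronglyMeasurable ?_
      (ν := (volume : Measure (EuclideanSpace ℝ (Fin 2))))
      (E := fun p => Complex.exp (Complex.I * (ς * p.1 ^ m * p.2 1 : ℝ))) (by fun_prop)
      (fun p => by rw [mul_comm, Complex.norm_exp_ofReal_mul_I]) (X := fun z => z 0) (by fun_prop)
      φ.integrable (fun z hz => hδ z (subset_tsupport φ hz))
    refine Integrable.mono' (((integrableOn_pow_mul_exp_neg (2 * j - ℓ) hδω).add
      (integrableOn_pow_mul_exp_neg (2 * j - ℓ + m) hδω)).const_mul B)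
      (hfm.aestronglyMeasurable.mul (by fun_prop)) ?_
    filter_upwards [ae_restrict_mem measurableSet_Ioi] with r hr
    have hr0 : 0 < r := hr
    have h1 := hB (ς * r ^ m)
    rw [abs_mul, hς, one_mul, abs_of_pos (pow_pos hr0 m)] at h1
    rw [hf, norm_mul, norm_mul, norm_pow, Complex.norm_real, Complex.norm_real,
      Real.norm_of_nonneg hr0.le, Real.norm_of_nonneg (Real.exp_pos _).le, Pi.add_apply]
    calc _ ≤ r ^ (2 * j - ℓ) * (B * (1 + r ^ m)) * Real.exp (-(ω.im * δ * r)) := by gcongr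
      _ = _ := by rw [pow_add]; ring
  refine ⟨fun φ hφ hs' => ?_, v, F, hv, fun φ hφ hs' => ?_, hnorm⟩
  · have := (hprod φ hφ hs').integral_prod_right
    simp only [integral_mul_const] at this
    exact this.integrableOn
  · have hi := hprod φ hφ hs'
    have hz := hpos φ hs'
    set P : ℝ × ℝ → ℂ := fun p => ∫ z, φ z * Complex.exp (Complex.I * (z 0 * p.1 + z 1 * p.2 : ℝ))
      with hP
    have hFP : (fun ζ => F ζ * ∫ z, φ z * Complex.exp (Complex.I * inner ℝ z ζ)) =
        (fun p => stripTransform m ℓ ς Ψ H p * P p) ∘ planeEquiv := by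
      funext ζ
      simp only [hF, hP, Function.comp, planeEquiv_apply]
      congr 1
      refine integral_congr_ae (ae_of_all _ fun z => ?_)
      simp only [PiLp.inner_apply, Fin.sum_univ_two]
      congr 3
      simp
      ring
    have hint := hv.integrable_mul_integral φ
    rw [hFP, measurePreserving_planeEquiv.integrable_comp_emb planeEquiv.measurableEmbedding] at hint
    have hgoal : ∫ ζ, F ζ * ∫ z, φ z * Complex.exp (Complex.I * inner ℝ z ζ) =
        ∫ τ : ℝ, ∫ ξ : ℝ, stripTransform m ℓ ς Ψ H (ξ, τ) * P (ξ, τ) := by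
      rw [hFP]
      refine (measurePreserving_planeEquiv.integral_comp'
        (g := fun p => stripTransform m ℓ ς Ψ H p * P p)).trans ?_
      rw [Measure.volume_eq_prod] at hint ⊢
      exact integral_prod_symm _ hint
    have hinner : ∀ τ : ℝ, ∫ ξ : ℝ, stripTransform m ℓ ς Ψ H (ξ, τ) * P (ξ, τ) =
        if 0 < ς * τ then (2 * Real.pi) ^ 2 / m * ((radius m τ : ℂ)⁻¹ ^ ℓ * H τ *
          ∫ z, Ψ (radius m τ * z 0) * (φ z * Complex.exp (Complex.I * (τ * z 1 : ℝ)))) else 0 := by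
      intro τ
      split_ifs with h
      · exact integral_stripTransform_mul_eq φ h
      · simp [stripTransform, h]
    have hray : ∀ r ∈ Ioi (0 : ℝ), ((m * r ^ (m - 1) : ℝ) : ℂ) *
        ((2 * Real.pi) ^ 2 / m * ((radius m (ς * r ^ m) : ℂ)⁻¹ ^ ℓ * H (ς * r ^ m) *
          ∫ z, Ψ (radius m (ς * r ^ m) * z 0) *
            (φ z * Complex.exp (Complex.I * (ς * r ^ m * z 1 : ℝ))))) =
        (2 * Real.pi) ^ 2 * ∫ z, Complex.exp (Complex.I * ω * (r * z 0 : ℝ)) * f r *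
          Complex.exp (Complex.I * (ς * r ^ m * z 1 : ℝ)) * φ z := by
      intro r hr
      have hr0 : (r : ℂ) ≠ 0 := Complex.ofReal_ne_zero.2 (ne_of_gt hr)
      have hm0 : (m : ℂ) ≠ 0 := Nat.cast_ne_zero.2 hm
      have h6 : ∫ z, Complex.exp (Complex.I * ω * (r * z 0 : ℝ)) * f r *
          Complex.exp (Complex.I * (ς * r ^ m * z 1 : ℝ)) * φ z =
          f r * ∫ z, Ψ (r * z 0) *
            (φ z * Complex.exp (Complex.I * (ς * r ^ m * z 1 : ℝ))) := by
        rw [← integral_const_mul]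
        refine integral_congr_ae (ae_of_all _ fun z => ?_)
        simp only
        by_cases h0 : φ z = 0
        · simp [h0]
        · rw [hΨ _ (mul_pos hr (hz z h0).1)]; ring
      rw [radius_mul_pow hm hς hr, h6, hf]
      have hpow : (r : ℂ) ^ (m - 1) = r ^ (2 * j - ℓ) * r ^ ℓ := by
        rw [← pow_add]; congr 1; lia
      push_cast
      rw [hpow, inv_pow]
      field_simp
    rw [hv.apply_eq_integral, functional,
      setIntegral_eq_integral_of_forall_compl_eq_zero (fun z hz' => by
        rw [show φ z = 0 from by_contra fun h => hz' (hz z h), mul_zero]), hgoal]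
    simp only [hinner]
    rw [integral_ite_pos_mul_eq hm hς, setIntegral_congr_fun measurableSet_Ioi hray,
      integral_const_mul, integral_integral_swap hi]
    simp only [integral_mul_const, finrank_euclideanSpace, Fintype.card_fin, Complex.real_smul]
    push_cast
    rw [inv_mul_cancel_left₀ (pow_ne_zero 2 (mul_ne_zero two_ne_zero
      (Complex.ofReal_ne_zero.2 Real.pi_ne_zero)))]

end StripExtension


/-! ### The estimates for the solution formula -/

section Estimates

theorem HasExtension.sum_mul_sub {V : Type*} [NormedAddCommGroup V] [InnerProductSpace ℝ V]
    [FiniteDimensional ℝ V] [MeasurableSpace V] [BorelSpace V] {ι : Type*} [Fintype ι] {Ω : Set V}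
    {w : V → ℝ} (hw : Measurable w) (c : ι → ι → ℂ) {u u' : ι → ι → V → ℂ} {C C' : ι → ι → ℝ≥0}
    {N : ι → ℝ≥0∞} (h : ∀ p ℓ, HasExtension Ω w (u p ℓ) (C p ℓ * N ℓ))
    (h' : ∀ p ℓ, HasExtension Ω w (u' p ℓ) (C' p ℓ * N ℓ)) :
    HasExtension Ω w (fun z => ∑ p, ∑ ℓ, c p ℓ * (u p ℓ z - u' p ℓ z))
      ((∑ p, ∑ ℓ, ‖c p ℓ‖₊ * (C p ℓ + C' p ℓ) : ℝ≥0) * ∑ ℓ, N ℓ) := by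
  have h1 : ∀ p ℓ, HasExtension Ω w (fun z => c p ℓ * (u p ℓ z - u' p ℓ z))
      (‖c p ℓ‖ₑ * ((C p ℓ + C' p ℓ : ℝ≥0) * N ℓ)) := by
    intro p ℓ
    have h2 := ((h p ℓ).add hw ((h' p ℓ).const_mul (-1))).const_mul (c p ℓ)
    simp only [neg_one_mul, ← sub_eq_add_neg, enorm_neg, enorm_one, one_mul] at h2
    refine h2.mono (le_of_eq ?_)
    push_cast
    rw [add_mul]
  refine (HasExtension.sum Finset.univ hw fun p _ =>
    HasExtension.sum Finset.univ hw fun ℓ _ => h1 p ℓ).mono ?_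
  push_cast
  rw [Finset.sum_mul]
  refine Finset.sum_le_sum fun p _ => ?_
  rw [Finset.sum_mul]
  refine Finset.sum_le_sum fun ℓ _ => ?_
  rw [← mul_assoc]
  refine mul_le_mul' le_rfl ?_
  exact Finset.single_le_sum (f := N) (fun _ _ => bot_le) (Finset.mem_univ ℓ)

theorem jnorm_le_sobolevNorm (μ : ℝ) {v : 𝓢'(ℝ, ℂ)} {F : ℝ → ℂ} (hF : HasFourierFunction v F) :
    jnorm μ F ≤ ENNReal.ofReal (2 ^ |μ|) * sobolevNorm μ v := by
  have hpt : ∀ η : ℝ, (1 + |η|) ^ μ ≤ 2 ^ |μ| * √(sobolevWeight μ η) := by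
    intro η
    have h0 : 0 < 1 + |η| := one_add_abs_pos η
    have h1 : (0 : ℝ) < 1 + η ^ 2 := by positivity
    have e : (1 + |η|) ^ μ = √(((1 + |η|) ^ 2) ^ μ) := by
      rw [← Real.rpow_natCast_mul h0.le, mul_comm, Real.rpow_mul_natCast h0.le,
        Real.sqrt_sq (by positivity)]
    have e2 : (2 : ℝ) ^ |μ| = √((2 ^ |μ|) ^ 2) := (Real.sqrt_sq (by positivity)).symm
    rw [e, e2, ← Real.sqrt_mul (by positivity), sobolevWeight]
    refine Real.sqrt_le_sqrt ?_
    rcases le_total 0 μ with h | h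
    · calc ((1 + |η|) ^ 2) ^ μ ≤ (2 * (1 + η ^ 2)) ^ μ := by
            refine Real.rpow_le_rpow (by positivity) ?_ h
            rw [← sq_abs η]; nlinarith [sq_nonneg (|η| - 1)]
        _ = 2 ^ |μ| * (1 + η ^ 2) ^ μ := by
            rw [Real.mul_rpow (by norm_num) h1.le, abs_of_nonneg h]
        _ ≤ _ := by
            gcongr
            exact le_self_pow₀ (Real.one_le_rpow (by norm_num) (abs_nonneg μ)) two_ne_zero
    · calc ((1 + |η|) ^ 2) ^ μ ≤ (1 + η ^ 2) ^ μ := by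
            refine Real.rpow_le_rpow_of_nonpos h1 ?_ h
            rw [← sq_abs η]; nlinarith [abs_nonneg η]
        _ ≤ _ := le_mul_of_one_le_left (by positivity)
            (one_le_pow₀ (Real.one_le_rpow (by norm_num) (abs_nonneg μ)))
  rw [sobolevNorm, hF.weightedNorm_eq fun ζ => by unfold sobolevWeight; positivity, jnorm]
  refine eLpNorm_le_mul_eLpNorm_of_ae_le_mul (ae_of_all _ fun η => ?_) 2
  rw [norm_mul, norm_mul, Complex.norm_real, Complex.norm_real,
    Real.norm_of_nonneg (by positivity), Real.norm_of_nonneg (Real.sqrt_nonneg _), ← mul_assoc]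
  gcongr
  exact hpt η

theorem lintegral_Ioi_comp_pow {m : ℕ} (hm : m ≠ 0) (g : ℝ → ℝ≥0∞) :
    ∫⁻ r in Ioi (0 : ℝ), ENNReal.ofReal (m * r ^ (m - 1)) * g (r ^ m) = ∫⁻ z in Ioi (0 : ℝ), g z := by
  have himg : (fun r : ℝ => r ^ m) '' Ioi 0 = Ioi 0 := by
    ext z
    constructor
    · rintro ⟨r, hr, rfl⟩; exact pow_pos (mem_Ioi.1 hr) m
    · exact fun hz => ⟨z ^ ((m : ℝ)⁻¹), Real.rpow_pos_of_pos hz _,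
        Real.rpow_inv_natCast_pow (le_of_lt hz) hm⟩
  have h := lintegral_image_eq_lintegral_abs_deriv_mul (f := fun r : ℝ => r ^ m)
    (f' := fun r => m * r ^ (m - 1)) measurableSet_Ioi
    (fun r _ => (hasDerivAt_pow m r).hasDerivWithinAt)
    (fun a ha b hb hab => (pow_left_inj₀ (le_of_lt ha) (le_of_lt hb) hm).1 hab) g
  rw [himg] at h
  rw [h]
  refine setLIntegral_congr_fun measurableSet_Ioi fun r hr => ?_
  have hr0 : 0 < r := hr
  rw [abs_of_nonneg (by positivity)]

theorem lintegral_comp_sign_mul {ς : ℝ} (hς : |ς| = 1) (g : ℝ → ℝ≥0∞) :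
    ∫⁻ z, g (ς * z) = ∫⁻ z, g z := by
  rcases eq_or_eq_neg_of_abs_eq hς with rfl | rfl
  · simp
  · simpa using (Measure.measurePreserving_neg (volume : Measure ℝ)).lintegral_comp_emb
      (MeasurableEquiv.neg ℝ).measurableEmbedding g

theorem lintegral_sq_ray_le {j ℓ : ℕ} (hℓ : ℓ < j) (s : ℝ) {ς : ℝ} (hς : |ς| = 1) (H : ℝ → ℂ) :
    ∫⁻ r in Ioi (0 : ℝ), (ENNReal.ofReal ((1 + r) ^ s) *
        (ENNReal.ofReal (r ^ (2 * j - ℓ)) * ‖H (ς * r ^ (2 * j + 1))‖ₑ)) ^ 2 ≤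
      ENNReal.ofReal ((2 ^ (2 * j + 1)) ^ (2 * |(s + j - ℓ) / (2 * j + 1)|)) *
        jnorm ((s + j - ℓ) / (2 * j + 1)) H ^ 2 := by
  set m := 2 * j + 1 with hm
  set μ : ℝ := (s + j - ℓ) / (2 * j + 1) with hμ
  have hm0 : m ≠ 0 := by lia
  have hm1 : (1 : ℝ) ≤ m := by exact_mod_cast Nat.one_le_iff_ne_zero.2 hm0
  have hmR : (m : ℝ) = 2 * j + 1 := by push_cast [hm]; ring
  set K : ℝ := (2 ^ m) ^ (2 * |μ|) with hK
  have hpt : ∀ r ∈ Ioi (0 : ℝ), (ENNReal.ofReal ((1 + r) ^ s) *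
      (ENNReal.ofReal (r ^ (2 * j - ℓ)) * ‖H (ς * r ^ m)‖ₑ)) ^ 2 ≤
      ENNReal.ofReal (m * r ^ (m - 1)) * (ENNReal.ofReal K *
        ‖(((1 + |ς * r ^ m|) ^ μ : ℝ) : ℂ) * H (ς * r ^ m)‖ₑ ^ 2) := by
    intro r hr
    have hr0 : 0 < r := hr
    have h1 := rpow_one_add_radius_le hm0 μ (r ^ m)
    have h2 := radius_mul_pow (m := m) hm0 (abs_one (α := ℝ)) hr0
    rw [one_mul] at h2
    rw [h2, abs_of_pos (pow_pos hr0 m)] at h1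
    have e3 : (1 + r) ^ (m * (2 * μ)) = ((1 + r) ^ s) ^ 2 * ((1 + r) ^ (j - ℓ)) ^ 2 := by
      rw [← Real.rpow_mul_natCast (by positivity), ← Real.rpow_natCast (1 + r) (j - ℓ),
        ← Real.rpow_mul_natCast (by positivity), ← Real.rpow_add (by positivity)]
      congr 1
      rw [hμ, hmR, Nat.cast_sub hℓ.le]; push_cast; field_simp; ring
    rw [enorm_mul, abs_mul, hς, one_mul, abs_of_pos (pow_pos hr0 m), ← ofReal_norm (Complex.ofReal _),
      Complex.norm_real, Real.norm_of_nonneg (by positivity), ← mul_assoc, mul_pow, mul_pow, mul_pow,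
      ← ENNReal.ofReal_pow (by positivity), ← ENNReal.ofReal_pow (by positivity),
      ← ENNReal.ofReal_pow (by positivity), ← ENNReal.ofReal_mul (by positivity), ← mul_assoc,
      ← mul_assoc, ← ENNReal.ofReal_mul (by positivity), ← ENNReal.ofReal_mul (by positivity)]
    refine mul_le_mul_left (ENNReal.ofReal_le_ofReal ?_) _
    have hpow : r ^ (2 * j - ℓ) = r ^ j * r ^ (j - ℓ) := by
      rw [← pow_add]; congr 1; lia
    have e4 : ((1 + r ^ m) ^ μ) ^ 2 = (1 + r ^ m) ^ (2 * μ) := by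
      rw [← Real.rpow_mul_natCast (by positivity), mul_comm]; norm_num
    have hpow2 : r ^ (m - 1) = (r ^ j) ^ 2 := by
      rw [← pow_mul]; congr 1; lia
    rw [hpow, hpow2, e4]
    have h5 : ((1 + r) ^ s) ^ 2 * (r ^ (j - ℓ)) ^ 2 ≤ K * (1 + r ^ m) ^ (2 * μ) := by
      refine le_trans ?_ (e3 ▸ h1)
      gcongr
      linarith
    calc _ = (r ^ j) ^ 2 * (((1 + r) ^ s) ^ 2 * (r ^ (j - ℓ)) ^ 2) := by ring
      _ ≤ (r ^ j) ^ 2 * (K * (1 + r ^ m) ^ (2 * μ)) := by gcongr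
      _ ≤ m * ((r ^ j) ^ 2 * (K * (1 + r ^ m) ^ (2 * μ))) :=
          le_mul_of_one_le_left (by positivity) hm1
      _ = _ := by ring
  have hj : ∫⁻ τ, ‖(((1 + |τ|) ^ μ : ℝ) : ℂ) * H τ‖ₑ ^ 2 = jnorm μ H ^ 2 := by
    rw [jnorm, eLpNorm_eq_lintegral_rpow_enorm_toReal two_ne_zero ENNReal.ofNat_ne_top,
      ← ENNReal.rpow_two, ← ENNReal.rpow_mul]
    simp
  refine (setLIntegral_mono' measurableSet_Ioi hpt).trans ?_
  rw [lintegral_Ioi_comp_pow hm0 (fun z => ENNReal.ofReal K *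
    ‖(((1 + |ς * z|) ^ μ : ℝ) : ℂ) * H (ς * z)‖ₑ ^ 2), lintegral_const_mul' _ _ ENNReal.ofReal_ne_top,
    ← hj, ← lintegral_comp_sign_mul hς]
  exact mul_le_mul_right (setLIntegral_le_lintegral _ _) _

theorem exists_hasExtension_rayIntegral_halfLine {j ℓ : ℕ} (hℓ : ℓ < j) {s : ℝ} (hs : 0 ≤ s) {ω : ℂ}
    (hω1 : ‖ω‖ = 1) (hω : 0 < ω.im) {ς : ℝ} (hως : ω ^ (2 * j + 1) = ς) (hς : |ς| = 1) :
    ∃ C : ℝ≥0, ∀ H : ℝ → ℂ, StronglyMeasurable H →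
      jnorm ((s + j - ℓ) / (2 * j + 1)) H < ⊤ → ∀ t : ℝ,
      HasExtension (Ioi 0) (sobolevWeight s)
        (fun x => rayIntegral (2 * j + 1) (2 * j - ℓ) ω ς H x t)
        (C * jnorm ((s + j - ℓ) / (2 * j + 1)) H) := by
  obtain ⟨C, hC⟩ := exists_hasExtension_halfLine hω hs
  set μ : ℝ := (s + j - ℓ) / (2 * j + 1) with hμ
  set K : ℝ := (2 ^ (2 * j + 1)) ^ (2 * |μ|) with hK
  refine ⟨C * (√K).toNNReal, fun H hH hj t => ?_⟩
  set f : ℝ → ℂ := fun r => Complex.exp (Complex.I * (ς * r ^ (2 * j + 1) * t : ℝ)) *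
    (Complex.I * (r * ω)) ^ (2 * j - ℓ) * H (ς * r ^ (2 * j + 1)) * ω with hf
  have hfm : StronglyMeasurable f :=
    ((by fun_prop : Continuous fun r : ℝ => Complex.exp (Complex.I * (ς * r ^ (2 * j + 1) * t : ℝ)) *
      (Complex.I * (r * ω)) ^ (2 * j - ℓ)).stronglyMeasurable.mul
      (hH.comp_measurable (by fun_prop))).mul stronglyMeasurable_const
  have hN : ∫⁻ r in Ioi (0 : ℝ), (ENNReal.ofReal ((1 + r) ^ s) * ‖f r‖ₑ) ^ 2 ≤
      ENNReal.ofReal K * jnorm μ H ^ 2 := by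
    refine le_trans (le_of_eq ?_) (lintegral_sq_ray_le hℓ s hς H)
    refine setLIntegral_congr_fun measurableSet_Ioi fun r hr => ?_
    have hr0 : 0 < r := hr
    have e : ‖f r‖ = r ^ (2 * j - ℓ) * ‖H (ς * r ^ (2 * j + 1))‖ := by
      simp only [hf, norm_mul, norm_pow, hω1, mul_comm Complex.I (Complex.ofReal _),
        Complex.norm_exp_ofReal_mul_I, Complex.norm_I, Complex.norm_real,
        Real.norm_of_nonneg hr0.le, one_mul, mul_one]
    rw [← ofReal_norm (f r), e, ENNReal.ofReal_mul (by positivity), ofReal_norm]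
  refine ((hC f hfm (hN.trans_lt (by finiteness))).congr measurableSet_Ioi fun x _ => ?_).mono ?_
  · simp only [rayIntegral, rayKernel]
    refine integral_congr_ae (ae_of_all _ fun r => ?_)
    simp only [hf]
    have e : Complex.exp (Complex.I * (r * ω) * x + Complex.I * (r * ω) ^ (2 * j + 1) * t) =
        Complex.exp (Complex.I * ω * (r * x : ℝ)) *
          Complex.exp (Complex.I * (ς * r ^ (2 * j + 1) * t : ℝ)) := by
      rw [← Complex.exp_add, mul_pow (r : ℂ) ω, hως]
      congr 1
      push_cast
      ring
    rw [e]
    ring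
  · push_cast
    rw [mul_assoc]
    gcongr
    calc _ ≤ (ENNReal.ofReal K * jnorm μ H ^ 2) ^ (1 / 2 : ℝ) :=
          ENNReal.rpow_le_rpow hN (by norm_num)
      _ = _ := by
          rw [ENNReal.mul_rpow_of_nonneg _ _ (by norm_num), ← ENNReal.rpow_two, ← ENNReal.rpow_mul,
            ENNReal.ofReal_rpow_of_nonneg (by positivity) (by norm_num), ← Real.sqrt_eq_rpow]
          norm_num
          rfl

theorem measurableSet_halfStrip (T : ℝ) : MeasurableSet (halfStrip T) := by
  have h : ∀ i, Measurable fun z : EuclideanSpace ℝ (Fin 2) => z i := fun i => by fun_prop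
  exact (measurableSet_lt measurable_const (h 0)).inter
    ((measurableSet_lt measurable_const (h 1)).inter (measurableSet_lt (h 1) measurable_const))

theorem exists_hasExtension_rayIntegral_halfStrip {j ℓ : ℕ} (hℓ : ℓ < j) {s b α : ℝ} (hb0 : 0 ≤ b)
    (hb : b < 1 / 2) (hα : 0 < α) {ω : ℂ} (hω1 : ‖ω‖ = 1) (hω : 0 < ω.im) {ς : ℝ}
    (hως : ω ^ (2 * j + 1) = ς) (hς : |ς| = 1) :
    ∃ C : ℝ≥0, ∀ (H : ℝ → ℂ) (B : ℝ), StronglyMeasurable H → 0 ≤ B →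
      (∀ z, ‖H z‖ ≤ B * (1 + |z|)) → jnorm ((s + j - ℓ) / (2 * j + 1)) H < ⊤ → ∀ T : ℝ,
      HasExtension (halfStrip T) (fun ζ => bourgainWeight (2 * j + 1) s b α (ζ 0) (ζ 1))
        (fun z => rayIntegral (2 * j + 1) (2 * j - ℓ) ω ς H (z 0) (z 1))
        (C * (jnorm ((s + j - ℓ) / (2 * j + 1)) H + ENNReal.ofReal B)) := by
  obtain ⟨C, hC⟩ := exists_hasExtension_halfStrip (s := s) hℓ hb0 hb hα hω hς
  refine ⟨C, fun H B hH hB0 hB hj T => ?_⟩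
  have h := (hC H B hH hB0 hB hj T).const_mul ((Complex.I * ω) ^ (2 * j - ℓ) * ω)
  have e1 : ‖(Complex.I * ω) ^ (2 * j - ℓ) * ω‖ₑ = 1 := by
    rw [← ofReal_norm]
    simp [hω1]
  rw [e1, one_mul] at h
  refine h.congr (measurableSet_halfStrip T) fun z _ => ?_
  simp only [rayIntegral, rayKernel]
  rw [← integral_const_mul]
  refine integral_congr_ae (ae_of_all _ fun r => ?_)
  simp only
  have e : Complex.exp (Complex.I * (r * ω) * z 0 + Complex.I * (r * ω) ^ (2 * j + 1) * z 1) =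
      Complex.exp (Complex.I * ω * (r * z 0 : ℝ)) *
        Complex.exp (Complex.I * (ς * r ^ (2 * j + 1) * z 1 : ℝ)) := by
    rw [← Complex.exp_add, mul_pow (r : ℂ) ω, hως]
    congr 1
    push_cast
    ring
  rw [e]
  ring

end Estimates


section Assembly

/-- The solution formula along the rays, with the transforms of the data replaced by `H`. -/
def raySolution (j : ℕ) (H : Fin j → ℝ → ℂ) (x t : ℝ) : ℂ :=
  ∑ p : Fin j, ∑ ℓ : Fin j, fokasConst j p ℓ *
    (rayIntegral (2 * j + 1) (2 * j - ℓ) (rightDir j (p + 1)) (-1) (H ℓ) x t -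
      rayIntegral (2 * j + 1) (2 * j - ℓ) (leftDir j (p + 1)) 1 (H ℓ) x t)

theorem exists_halfLine_raySolution_le (j : ℕ) {s : ℝ} (hs : 0 ≤ s) :
    ∃ C : ℝ≥0, ∀ H : Fin j → ℝ → ℂ, (∀ ℓ, StronglyMeasurable (H ℓ)) →
      (∀ ℓ, jnorm (dataOrder j s ℓ) (H ℓ) < ⊤) → ∀ t : ℝ,
      HasExtension (Ioi 0) (sobolevWeight s) (fun x => raySolution j H x t)
        (C * ∑ ℓ, jnorm (dataOrder j s ℓ) (H ℓ)) := by
  have hw : Measurable (sobolevWeight s) := by unfold sobolevWeight; fun_prop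
  have hR := fun p ℓ : Fin j => exists_hasExtension_rayIntegral_halfLine ℓ.2 hs
    (norm_rightDir j (p + 1)) (rightDir_im_pos (Nat.le_add_left 1 p) p.2) (rightDir_pow j (p + 1))
    (by norm_num)
  have hL := fun p ℓ : Fin j => exists_hasExtension_rayIntegral_halfLine ℓ.2 hs
    (norm_leftDir j (p + 1)) (leftDir_im_pos (Nat.le_add_left 1 p) p.2) (leftDir_pow j (p + 1))
    (by norm_num)
  choose CR hCR using hR
  choose CL hCL using hL
  exact ⟨_, fun H hH hj t => HasExtension.sum_mul_sub hw (fokasConst j)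
    (fun p ℓ => hCR p ℓ (H ℓ) (hH ℓ) (hj ℓ) t) (fun p ℓ => hCL p ℓ (H ℓ) (hH ℓ) (hj ℓ) t)⟩

theorem exists_halfStrip_raySolution_le (j : ℕ) {s b α : ℝ} (hb0 : 0 ≤ b) (hb : b < 1 / 2)
    (hα : 0 < α) :
    ∃ C : ℝ≥0, ∀ (H : Fin j → ℝ → ℂ) (B : Fin j → ℝ), (∀ ℓ, StronglyMeasurable (H ℓ)) →
      (∀ ℓ, 0 ≤ B ℓ) → (∀ ℓ z, ‖H ℓ z‖ ≤ B ℓ * (1 + |z|)) →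
      (∀ ℓ, jnorm (dataOrder j s ℓ) (H ℓ) < ⊤) → ∀ T : ℝ,
      HasExtension (halfStrip T) (fun ζ => bourgainWeight (2 * j + 1) s b α (ζ 0) (ζ 1))
        (fun z => raySolution j H (z 0) (z 1))
        (C * ∑ ℓ, (jnorm (dataOrder j s ℓ) (H ℓ) + ENNReal.ofReal (B ℓ))) := by
  have hw : Measurable fun ζ : EuclideanSpace ℝ (Fin 2) =>
      bourgainWeight (2 * j + 1) s b α (ζ 0) (ζ 1) := by
    have h : ∀ i, Measurable fun z : EuclideanSpace ℝ (Fin 2) => z i := fun i => by fun_prop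
    unfold bourgainWeight
    refine Measurable.add (by fun_prop) (Measurable.ite ?_ (by fun_prop) measurable_const)
    exact measurableSet_le (h 0).norm measurable_const
  have hR := fun p ℓ : Fin j => exists_hasExtension_rayIntegral_halfStrip (s := s) ℓ.2 hb0 hb hα
    (norm_rightDir j (p + 1)) (rightDir_im_pos (Nat.le_add_left 1 p) p.2) (rightDir_pow j (p + 1))
    (by norm_num)
  have hL := fun p ℓ : Fin j => exists_hasExtension_rayIntegral_halfStrip (s := s) ℓ.2 hb0 hb hα
    (norm_leftDir j (p + 1)) (leftDir_im_pos (Nat.le_add_left 1 p) p.2) (leftDir_pow j (p + 1))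
    (by norm_num)
  choose CR hCR using hR
  choose CL hCL using hL
  exact ⟨_, fun H B hH hB0 hB hj T => HasExtension.sum_mul_sub hw (fokasConst j)
    (fun p ℓ => hCR p ℓ (H ℓ) (B ℓ) (hH ℓ) (hB0 ℓ) (hB ℓ) (hj ℓ) T)
    (fun p ℓ => hCL p ℓ (H ℓ) (B ℓ) (hH ℓ) (hB0 ℓ) (hB ℓ) (hj ℓ) T)⟩

theorem exists_jnorm_halfCutoff_le_of_ne {μ : ℝ} (hμ : -(1 / 2) < μ)
    (hne : ∀ k : ℕ, μ ≠ k + 1 / 2) (a : 𝓢(ℝ, ℂ)) :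
    ∃ C : ℝ≥0, ∀ (S : ℝ) (V : ℝ → ℂ), 1 ≤ S → AEStronglyMeasurable V → jnorm μ V < ⊤ →
      (∀ k : ℕ, (k : ℝ) + 1 / 2 < μ → ∫ η : ℝ, (η : ℂ) ^ k * V η = 0) →
      jnorm μ (multiplier (halfCutoff a S) V) ≤ C * jnorm μ V := by
  set n := ⌊μ + 1 / 2⌋₊ with hn
  have h1 : (n : ℝ) ≤ μ + 1 / 2 := Nat.floor_le (by linarith)
  have h2 : μ + 1 / 2 < n + 1 := Nat.lt_floor_add_one _
  have h3 : (n : ℝ) - 1 / 2 < μ := by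
    refine lt_of_le_of_ne (by linarith) fun h => ?_
    rcases Nat.eq_zero_or_pos n with h0 | h0
    · rw [h0] at h; norm_num at h; linarith
    · refine hne (n - 1) ?_
      rw [Nat.cast_pred h0, ← h]; ring
  obtain ⟨C, hC⟩ := exists_jnorm_halfCutoff_le (σ := μ - n) (by linarith) (by linarith) n a
  rw [sub_add_cancel] at hC
  refine ⟨C, fun S V hS hV hj hk => hC S V hS hV hj fun k hkn => hk k ?_⟩
  have : (k : ℝ) + 1 ≤ n := by exact_mod_cast hkn
  linarith

theorem exists_schwartzMap_eq_one : ∃ a : 𝓢(ℝ, ℂ), ∀ y ∈ Icc (0 : ℝ) 1, a y = 1 := by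
  let f : ContDiffBump (0 : ℝ) := ⟨1, 2, one_pos, one_lt_two⟩
  obtain ⟨a, ha⟩ := exists_schwartzMap_eq_ofReal f.contDiff f.hasCompactSupport
  refine ⟨a, fun y hy => ?_⟩
  rw [ha, f.one_of_mem_closedBall, Complex.ofReal_one]
  rw [mem_closedBall_zero_iff, Real.norm_eq_abs, abs_of_nonneg hy.1]
  exact hy.2

theorem lt_dataOrder {j : ℕ} {s : ℝ} (hs : -(j : ℝ) - 1 / 2 < s) (ℓ : Fin j) :
    -(1 / 2) < dataOrder j s ℓ := by
  have h : ((ℓ : ℕ) : ℝ) + 1 ≤ j := by exact_mod_cast ℓ.2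
  rw [dataOrder, lt_div_iff₀ (by positivity)]
  linarith

theorem dataOrder_lt {j : ℕ} {s : ℝ} (hs : s < 1 / 2) (ℓ : Fin j) : dataOrder j s ℓ < 1 / 2 := by
  have h : (0 : ℝ) ≤ ((ℓ : ℕ) : ℝ) := Nat.cast_nonneg _
  rw [dataOrder, div_lt_iff₀ (by positivity)]
  linarith

theorem dataOrder_ne {j : ℕ} {s : ℝ} {ℓ : Fin j} {k : ℕ}
    (hs : s ≠ (ℓ : ℕ) + 1 / 2 + k * (2 * j + 1)) : dataOrder j s ℓ ≠ k + 1 / 2 := by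
  intro h
  rw [dataOrder, div_eq_iff (by positivity)] at h
  apply hs
  linarith

theorem le_sum_intervalSobolevNorm {j : ℕ} {s T : ℝ} {g : Fin j → 𝓢'(ℝ, ℂ)}
    (hg : IsBoundaryData j s T g) {X : ℝ≥0∞} {c : ℝ≥0}
    (h : ∀ v : Fin j → 𝓢'(ℝ, ℂ), (∀ ℓ, AgreeOn (Ioo 0 T) (v ℓ) (g ℓ)) →
      (∀ ℓ, sobolevNorm (dataOrder j s ℓ) (v ℓ) < ⊤) →
      X ≤ c * ∑ ℓ, sobolevNorm (dataOrder j s ℓ) (v ℓ)) :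
    X ≤ c * ∑ ℓ, intervalSobolevNorm T (dataOrder j s ℓ) (g ℓ) := by
  refine ENNReal.le_of_forall_pos_le_add fun ε hε _ => ?_
  have hδ : 0 < ε / (c * j + 1) := by positivity
  set δ : ℝ≥0 := ε / (c * j + 1) with hδdef
  have hex : ∀ ℓ, ∃ v : 𝓢'(ℝ, ℂ), AgreeOn (Ioo 0 T) v (g ℓ) ∧ sobolevNorm (dataOrder j s ℓ) v <
      intervalSobolevNorm T (dataOrder j s ℓ) (g ℓ) + δ := by
    intro ℓ
    have hfin : intervalSobolevNorm T (dataOrder j s ℓ) (g ℓ) ≠ ⊤ :=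
      ne_top_of_le_ne_top (hg.mem ℓ).ne (iInf₂_le (g ℓ) fun φ _ _ => rfl)
    have hlt : intervalSobolevNorm T (dataOrder j s ℓ) (g ℓ) <
        intervalSobolevNorm T (dataOrder j s ℓ) (g ℓ) + δ :=
      ENNReal.lt_add_right hfin (by exact_mod_cast hδ.ne')
    rw [intervalSobolevNorm, restrictionNorm] at hlt
    simp only [iInf_lt_iff] at hlt
    obtain ⟨v, hv, hlt⟩ := hlt
    exact ⟨v, hv, hlt⟩
  choose v hv hlt using hex
  calc X ≤ c * ∑ ℓ, sobolevNorm (dataOrder j s ℓ) (v ℓ) := h v hv fun ℓ => (hlt ℓ).trans_le le_top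
    _ ≤ c * ∑ ℓ, (intervalSobolevNorm T (dataOrder j s ℓ) (g ℓ) + δ) := by
        gcongr with ℓ
        exact (hlt ℓ).le
    _ = c * ∑ ℓ, intervalSobolevNorm T (dataOrder j s ℓ) (g ℓ) + (c * j * δ : ℝ≥0) := by
        rw [Finset.sum_add_distrib, mul_add]
        simp [mul_assoc]
    _ ≤ _ := by
        gcongr
        rw [hδdef, mul_div_assoc', div_le_iff₀ (by positivity), mul_comm]
        gcongr
        exact le_self_add

theorem hasFourierFunction_of_sobolevNorm {μ : ℝ} {v : 𝓢'(ℝ, ℂ)} (h : sobolevNorm μ v < ⊤) :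
    HasFourierFunction v (fourierFunction v) ∧ jnorm μ (fourierFunction v) < ⊤ := by
  have hF : HasFourierFunction v (fourierFunction v) := hasFourierFunction_of_weightedNorm_lt_top h
  exact ⟨hF, (jnorm_le_sobolevNorm μ hF).trans_lt (ENNReal.mul_lt_top ENNReal.ofReal_lt_top h)⟩

/-- The Fourier transforms of extensions of admissible boundary data. -/
structure IsDataExtension (j : ℕ) (s T : ℝ) (g v : Fin j → 𝓢'(ℝ, ℂ)) (V : Fin j → ℝ → ℂ) : Prop where
  hasFourierFunction : ∀ ℓ, HasFourierFunction (v ℓ) (V ℓ)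
  jnorm_lt_top : ∀ ℓ, jnorm (dataOrder j s ℓ) (V ℓ) < ⊤
  agreeOn : ∀ ℓ, AgreeOn (Ioo 0 T) (v ℓ) (g ℓ)

theorem IsDataExtension.aestronglyMeasurable {j : ℕ} {s T : ℝ} {g v : Fin j → 𝓢'(ℝ, ℂ)}
    {V : Fin j → ℝ → ℂ} (h : IsDataExtension j s T g v V) (ℓ : Fin j) :
    AEStronglyMeasurable (V ℓ) := (h.hasFourierFunction ℓ).aestronglyMeasurable

theorem IsDataExtension.pureSolution_eq_interval {j : ℕ} {s T : ℝ} {g v : Fin j → 𝓢'(ℝ, ℂ)}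
    {V : Fin j → ℝ → ℂ} (h : IsDataExtension j s T g v V) (hs : -(j : ℝ) - 1 / 2 < s) (hT : 0 < T)
    (hg : IsBoundaryData j s T g) (x t : ℝ) :
    pureSolution j T g x t =
      raySolution j (fun ℓ => multiplier (intervalCutoff 0 T) (V ℓ)) x t :=
  pureSolution_eq hT (lt_dataOrder hs) (fun ℓ => (hasFourierFunction_of_sobolevNorm (hg.mem ℓ)).1)
    h.hasFourierFunction (fun ℓ => (hasFourierFunction_of_sobolevNorm (hg.mem ℓ)).2)
    h.jnorm_lt_top h.agreeOn x t

theorem IsDataExtension.pureSolution_eq_halfCutoff {j : ℕ} {s T S : ℝ} {g v : Fin j → 𝓢'(ℝ, ℂ)}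
    {V : Fin j → ℝ → ℂ} (h : IsDataExtension j s T g v V) (hs : -(j : ℝ) - 1 / 2 < s) (hT : 0 < T)
    (hTS : T ≤ S) (hg : IsBoundaryData j s T g) {a : 𝓢(ℝ, ℂ)} (ha : ∀ y ∈ Icc (0 : ℝ) 1, a y = 1)
    {x t : ℝ} (hx : 0 < x) (ht : t ≤ T) :
    pureSolution j T g x t = raySolution j (fun ℓ => multiplier (halfCutoff a S) (V ℓ)) x t := by
  rw [h.pureSolution_eq_interval hs hT hg]
  refine Finset.sum_congr rfl fun p _ => Finset.sum_congr rfl fun ℓ _ => ?_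
  rw [rayIntegral_sub_eq_halfCutoff (Nat.le_add_left 1 p) p.2 _ hx ht hT hTS ha (lt_dataOrder hs ℓ)
    (h.aestronglyMeasurable ℓ) (h.jnorm_lt_top ℓ)]

theorem IsDataExtension.integral_pow_mul_eq_zero {j : ℕ} {s T : ℝ} {g v : Fin j → 𝓢'(ℝ, ℂ)}
    {V : Fin j → ℝ → ℂ} (h : IsDataExtension j s T g v V) (hT : 0 < T)
    (hg : IsBoundaryData j s T g) (ℓ : Fin j) (k : ℕ) (hk : (k : ℝ) + 1 / 2 < dataOrder j s ℓ) :
    ∫ η : ℝ, (η : ℂ) ^ k * V ℓ η = 0 :=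
  integral_pow_mul_eq_zero_of_traceZero (h.hasFourierFunction ℓ) (h.jnorm_lt_top ℓ) hT
    (h.agreeOn ℓ) hk (hg.compatible ℓ k hk)

theorem le_sum_intervalSobolevNorm_of_isDataExtension {j : ℕ} {s T : ℝ} {g : Fin j → 𝓢'(ℝ, ℂ)}
    (hg : IsBoundaryData j s T g) {X : ℝ≥0∞} {c : ℝ≥0}
    (h : ∀ v V, IsDataExtension j s T g v V → X ≤ c * ∑ ℓ, jnorm (dataOrder j s ℓ) (V ℓ)) :
    X ≤ (c * ∑ ℓ : Fin j, (2 ^ |dataOrder j s ℓ| : ℝ).toNNReal : ℝ≥0) *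
      ∑ ℓ, intervalSobolevNorm T (dataOrder j s ℓ) (g ℓ) := by
  refine le_sum_intervalSobolevNorm hg fun v hv hfin => ?_
  refine (h v (fun ℓ => fourierFunction (v ℓ))
    ⟨fun ℓ => (hasFourierFunction_of_sobolevNorm (hfin ℓ)).1,
      fun ℓ => (hasFourierFunction_of_sobolevNorm (hfin ℓ)).2, hv⟩).trans ?_
  rw [ENNReal.coe_mul, mul_assoc, ENNReal.ofNNReal_finsetSum, Finset.sum_mul]
  gcongr with ℓ
  refine (jnorm_le_sobolevNorm _ (hasFourierFunction_of_sobolevNorm (hfin ℓ)).1).trans ?_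
  refine mul_le_mul' le_rfl ?_
  exact Finset.single_le_sum (f := fun ℓ => sobolevNorm (dataOrder j s ℓ) (v ℓ))
    (fun _ _ => bot_le) (Finset.mem_univ ℓ)

theorem sum_le_mul_sum {ι : Type*} [Fintype ι] {C : ι → ℝ≥0} {f g : ι → ℝ≥0∞}
    (h : ∀ i, f i ≤ C i * g i) : ∑ i, f i ≤ (∑ i, C i : ℝ≥0) * ∑ i, g i := by
  rw [ENNReal.ofNNReal_finsetSum, Finset.sum_mul]
  refine Finset.sum_le_sum fun i _ => (h i).trans (mul_le_mul' le_rfl ?_)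
  exact Finset.single_le_sum (f := g) (fun _ _ => bot_le) (Finset.mem_univ i)

theorem exists_halfLineSobolevNorm_pureSolution_le {j : ℕ} {s : ℝ}
    (hs : ∀ ℓ : Fin j, ∀ k : ℕ, s ≠ (ℓ : ℕ) + 1 / 2 + k * (2 * j + 1)) (hs0 : 0 ≤ s) :
    ∃ c : ℝ≥0, ∀ T : ℝ, 0 < T → ∀ g : Fin j → 𝓢'(ℝ, ℂ), IsBoundaryData j s T g → ∀ t : ℝ, t ≤ T →
      halfLineSobolevNorm s (fun x => pureSolution j T g x t) ≤
        c * ∑ ℓ, intervalSobolevNorm T (dataOrder j s ℓ) (g ℓ) := by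
  have hsj : -(j : ℝ) - 1 / 2 < s := by linarith [(Nat.cast_nonneg j : (0 : ℝ) ≤ j)]
  obtain ⟨a, ha⟩ := exists_schwartzMap_eq_one
  obtain ⟨C, hC⟩ := exists_halfLine_raySolution_le j hs0
  obtain ⟨A, hA⟩ := exists_isCutoff_halfCutoff a
  choose C' hC' using fun ℓ : Fin j => exists_jnorm_halfCutoff_le_of_ne (lt_dataOrder hsj ℓ)
    (fun k => dataOrder_ne (hs ℓ k)) a
  refine ⟨_, fun T hT g hg t ht => le_sum_intervalSobolevNorm_of_isDataExtension
    (c := C * ∑ ℓ, C' ℓ) hg fun v V h => ?_⟩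
  have hS : 1 ≤ max 1 T := le_max_left _ _
  have hb := fun ℓ => hC' ℓ (max 1 T) (V ℓ) hS (h.aestronglyMeasurable ℓ) (h.jnorm_lt_top ℓ)
    (h.integral_pow_mul_eq_zero hT hg ℓ)
  have hext := hC (fun ℓ => multiplier (halfCutoff a (max 1 T)) (V ℓ))
    (fun ℓ => stronglyMeasurable_multiplier (hA _ (by linarith)).integrable
      (h.aestronglyMeasurable ℓ))
    (fun ℓ => (hb ℓ).trans_lt (ENNReal.mul_lt_top ENNReal.coe_lt_top (h.jnorm_lt_top ℓ))) t
  have hext' := hext.congr measurableSet_Ioi (u' := fun x => pureSolution j T g x t)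
    fun x hx => (h.pureSolution_eq_halfCutoff hsj hT (le_max_right _ _) hg ha hx ht).symm
  refine (hext'.restrictionNorm_le fun ζ => by unfold sobolevWeight; positivity).trans ?_
  rw [ENNReal.coe_mul, mul_assoc]
  gcongr
  exact sum_le_mul_sum hb

theorem exists_halfLineSobolevNorm_pureSolution_le_of_lt {j : ℕ} {s : ℝ} (hs0 : 0 ≤ s)
    (hs1 : s < 1 / 2) :
    ∃ c : ℝ≥0, ∀ T : ℝ, 0 < T → ∀ g : Fin j → 𝓢'(ℝ, ℂ), IsBoundaryData j s T g → ∀ t : ℝ,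
      halfLineSobolevNorm s (fun x => pureSolution j T g x t) ≤
        c * ∑ ℓ, intervalSobolevNorm T (dataOrder j s ℓ) (g ℓ) := by
  have hsj : -(j : ℝ) - 1 / 2 < s := by linarith [(Nat.cast_nonneg j : (0 : ℝ) ≤ j)]
  obtain ⟨C, hC⟩ := exists_halfLine_raySolution_le j hs0
  choose C' hC' using fun ℓ : Fin j => exists_jnorm_multiplier_le (lt_dataOrder hsj ℓ)
    (dataOrder_lt hs1 ℓ)
  refine ⟨_, fun T hT g hg t => le_sum_intervalSobolevNorm_of_isDataExtension
    (c := C * ∑ ℓ, C' ℓ * (2 : ℝ).toNNReal) hg fun v V h => ?_⟩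
  have hc := isCutoff_intervalCutoff hT.le
  have hb : ∀ ℓ, jnorm (dataOrder j s ℓ) (multiplier (intervalCutoff 0 T) (V ℓ)) ≤
      (C' ℓ * (2 : ℝ).toNNReal : ℝ≥0) * jnorm (dataOrder j s ℓ) (V ℓ) := fun ℓ => by
    rw [ENNReal.coe_mul]
    exact hC' ℓ 2 _ (V ℓ) hc (h.aestronglyMeasurable ℓ) (h.jnorm_lt_top ℓ)
  have hext := hC (fun ℓ => multiplier (intervalCutoff 0 T) (V ℓ))
    (fun ℓ => stronglyMeasurable_multiplier hc.integrable (h.aestronglyMeasurable ℓ))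
    (fun ℓ => (hb ℓ).trans_lt (ENNReal.mul_lt_top ENNReal.coe_lt_top (h.jnorm_lt_top ℓ))) t
  have hext' := hext.congr measurableSet_Ioi (u' := fun x => pureSolution j T g x t)
    fun x _ => (h.pureSolution_eq_interval hsj hT hg x t).symm
  refine (hext'.restrictionNorm_le fun ζ => by unfold sobolevWeight; positivity).trans ?_
  rw [ENNReal.coe_mul, mul_assoc]
  gcongr
  exact sum_le_mul_sum hb

theorem exists_bourgainNorm_pureSolution_le {j : ℕ} {s : ℝ}
    (hs : ∀ ℓ : Fin j, ∀ k : ℕ, s ≠ (ℓ : ℕ) + 1 / 2 + k * (2 * j + 1))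
    (hsj : -(j : ℝ) - 1 / 2 < s) {b α : ℝ} (hb0 : 0 ≤ b) (hb : b < 1 / 2) (hα : 0 < α) (T₀ : ℝ) :
    ∃ c : ℝ≥0, ∀ T : ℝ, 0 < T → T ≤ T₀ → ∀ g : Fin j → 𝓢'(ℝ, ℂ), IsBoundaryData j s T g →
      bourgainNorm (2 * j + 1) s b α T (pureSolution j T g) ≤
        c * ∑ ℓ, intervalSobolevNorm T (dataOrder j s ℓ) (g ℓ) := by
  obtain ⟨a, ha⟩ := exists_schwartzMap_eq_one
  obtain ⟨C, hC⟩ := exists_halfStrip_raySolution_le j (s := s) hb0 hb hα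
  obtain ⟨A, hA⟩ := exists_isCutoff_halfCutoff a
  choose C' hC' using fun ℓ : Fin j => exists_jnorm_halfCutoff_le_of_ne (lt_dataOrder hsj ℓ)
    (fun k => dataOrder_ne (hs ℓ k)) a
  set S : ℝ := max 1 T₀ with hSdef
  have hS : 1 ≤ S := le_max_left _ _
  have hc := hA S (by linarith)
  set K : ℝ := A + ∫ τ, ‖halfCutoff a S τ‖ with hK
  have hK0 : 0 ≤ K := add_nonneg hc.nonneg (integral_nonneg fun _ => norm_nonneg _)
  set E : Fin j → ℝ≥0 := fun ℓ => (embeddingConst (dataOrder j s ℓ + 1)).toNNReal with hE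
  have hEtop : ∀ ℓ, embeddingConst (dataOrder j s ℓ + 1) ≠ ⊤ := fun ℓ =>
    (embeddingConst_lt_top (by linarith [lt_dataOrder hsj ℓ])).ne
  refine ⟨_, fun T hT hTT g hg => le_sum_intervalSobolevNorm_of_isDataExtension
    (c := C * ∑ ℓ, (C' ℓ + K.toNNReal * E ℓ)) hg fun v V h => ?_⟩
  have hbd := fun ℓ => hC' ℓ S (V ℓ) hS (h.aestronglyMeasurable ℓ) (h.jnorm_lt_top ℓ)
    (h.integral_pow_mul_eq_zero hT hg ℓ)
  set B : Fin j → ℝ := fun ℓ =>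
    K * (embeddingConst (dataOrder j s ℓ + 1) * jnorm (dataOrder j s ℓ) (V ℓ)).toReal with hB
  have hext := hC (fun ℓ => multiplier (halfCutoff a S) (V ℓ)) B
    (fun ℓ => stronglyMeasurable_multiplier hc.integrable (h.aestronglyMeasurable ℓ))
    (fun ℓ => mul_nonneg hK0 ENNReal.toReal_nonneg)
    (fun ℓ => norm_multiplier_le hK0 hc.norm_hatKernel_le (lt_dataOrder hsj ℓ)
      (h.aestronglyMeasurable ℓ) (h.jnorm_lt_top ℓ))
    (fun ℓ => (hbd ℓ).trans_lt (ENNReal.mul_lt_top ENNReal.coe_lt_top (h.jnorm_lt_top ℓ))) T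
  have hext' := hext.congr (measurableSet_halfStrip T)
    (u' := fun z => pureSolution j T g (z 0) (z 1)) fun z hz =>
      (h.pureSolution_eq_halfCutoff hsj hT (hTT.trans (le_max_right _ _)) hg ha hz.1
        hz.2.2.le).symm
  refine (hext'.restrictionNorm_le fun ζ => bourgainWeight_nonneg _ _ _ _ _ _).trans ?_
  rw [ENNReal.coe_mul, mul_assoc]
  gcongr
  refine sum_le_mul_sum fun ℓ => ?_
  rw [ENNReal.coe_add, add_mul]
  refine add_le_add (hbd ℓ) (le_of_eq ?_)
  rw [hB, ENNReal.ofReal_mul hK0, ENNReal.ofReal_toReal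
    (ENNReal.mul_ne_top (hEtop ℓ) (h.jnorm_lt_top ℓ).ne), ENNReal.coe_mul, hE,
    ENNReal.coe_toNNReal (hEtop ℓ), mul_assoc]
  rfl

end Assembly

end KdVm

end

theorem theorem3p2 (j : ℕ) (hj : 1 ≤ j) (s : ℝ)
    (hs : ∀ ℓ : Fin j, ∀ k : ℕ, s ≠ (ℓ : ℕ) + 1 / 2 + k * (2 * j + 1)) :
    (0 ≤ s → ∃ c : ℝ≥0, ∀ T : ℝ, 0 < T →
      ∀ g : Fin j → 𝓢'(ℝ, ℂ), KdVm.IsBoundaryData j s T g →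
        ∀ t : ℝ, (t ≤ T ∨ s < 1 / 2) →
          KdVm.halfLineSobolevNorm s (fun x => KdVm.pureSolution j T g x t) ≤
            c * ∑ ℓ, KdVm.intervalSobolevNorm T (KdVm.dataOrder j s ℓ) (g ℓ)) ∧
    (-(j : ℝ) - 1 / 2 < s → ∀ b α : ℝ, 0 ≤ b → b < 1 / 2 → 1 / 2 < α →
      α ≤ 1 / 2 + (s + j + 1 / 2) / (2 * j + 1) →
      ∀ T₀ : ℝ, 0 < T₀ → ∃ c : ℝ≥0, ∀ T : ℝ, 0 < T → T ≤ T₀ →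
        ∀ g : Fin j → 𝓢'(ℝ, ℂ), KdVm.IsBoundaryData j s T g →
          KdVm.bourgainNorm (2 * j + 1) s b α T (KdVm.pureSolution j T g) ≤
            c * ∑ ℓ, KdVm.intervalSobolevNorm T (KdVm.dataOrder j s ℓ) (g ℓ)) := by
  refine ⟨fun hs0 => ?_, fun hsj b α hb0 hb hα _ T₀ _ =>
    KdVm.exists_bourgainNorm_pureSolution_le hs hsj hb0 hb (by linarith) T₀⟩
  obtain ⟨c₁, h₁⟩ := KdVm.exists_halfLineSobolevNorm_pureSolution_le hs hs0
  rcases lt_or_ge s (1 / 2) with hs1 | hs1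
  · obtain ⟨c₂, h₂⟩ := KdVm.exists_halfLineSobolevNorm_pureSolution_le_of_lt (j := j) hs0 hs1
    exact ⟨c₂, fun T hT g hg t _ => h₂ T hT g hg t⟩
  · exact ⟨c₁, fun T hT g hg t ht =>
      h₁ T hT g hg t (ht.resolve_right (not_lt.2 hs1))⟩
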